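/- Let $\Lambda>0$ and let $M<0$, or $M>0$ with $9M^2\Lambda<1$. Put $V(r)=1-\frac{2M}{r}-\frac{\Lambda r^2}{3}$ and let $r_{\mathrm c}$ be the largest positive zero of $V$. For $\mathrm T>0$ let $\mathrm{FC}_\pm[\mathrm T]$ ($\pm$ being the sign of $M$) be the Kantowski–Sachs spacetime $\{(r,t,\omega): r>r_{\mathrm c},\ t\in\mathbb R/2\mathrm T\mathbb Z,\ \omega\in S^2\}$ with the metric $-V\,dt^2+V^{-1}dr^2+r^2\mathbf g_{[S^2]}$, time-oriented so that $r$ increases to the future, where $\mathbf g_{[S^2]}$ is the standard metric of $S^2$; its Killing flow is $t\mapsto t+s$, $s\in\mathbb R$. For $K,C\in\mathbb R$ put $D(r)=V(r)+\big(\frac{Kr}{3}-\frac{C}{r^2}\big)^2$. Let $\mathscr{KC}_1$ be the set of all $(K,C)$ with $K>0$ for which $D$ has simple positive zeros $r_{\min}<r_{\max}$ with $D>0$ on $(r_{\min},r_{\max})$ and $r_{\mathrm c}<r_{\min}$. Given $(K,C)\in\mathscr{KC}_1$, let $r(l)$, $l\in\mathbb R$, be the smooth nonconstant positive solution of $r'^2=D(r)$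 with $r(0)=r_{\min}$, which is even and periodic with period $2L$, $L=\int_{r_{\min}}^{r_{\max}}D(r)^{-1/2}dr$. The associated compact spherically symmetric CMC data set is $S^1\times S^2$ with $S^1=\mathbb R/2L\mathbb Z$ and $$g=dl^2+r(l)^2\,\mathbf g_{[S^2]},\qquad k=\frac K3\,g+C\Big(\frac{2}{r(l)^3}\,dl^2-\frac1{r(l)}\,\mathbf g_{[S^2]}\Big);$$ its $n$-fold covering ($n\ge1$) is given by the same formulas on $(\mathbb R/2nL\mathbb Z)\times S^2$. An embedding of the data (or of a covering) is a smooth embedding whose induced metric is $g$ and whose second fundamental form with respect to the future-directed unit normal $N$, $(X,Y)\mapsto\langle\nabla_XN,Y\rangle$, is $k$; its image then has constant mean curvature $K$. Put $$\mathcal T=\Big|\int_0^L V(r(l))^{-1}\Big(\frac{K\,r(l)}{3}-\frac{C}{r(l)^2}\Big)\,dl\Big|.$$ Then, for all $\mathrm T>0$ and all integers $n\ge1$: 1. The data set embeds in $\mathrm{FC}_\pm[\mathrm T]$ if and only if $\mathrm T=\mathcal T$. 2. The $n$-fold covering of the data set embeds in $\mathrm{FC}_\pm[\mathrm T]$ if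 and only if $\mathrm T=n\mathcal T$. 3. The image of every such embedding is a Cauchy hypersurface of $\mathrm{FC}_\pm[\mathrm T]$: every inextendible causal curve meets it exactly once. 4. The embeddings are unique modulo the Killing flow: the images of any two embeddings of the $n$-fold covering in $\mathrm{FC}_\pm[\mathrm T]$ differ by a translation $t\mapsto t+s$. -/

import Mathlib

open Set Filter Topology MeasureTheory
open scoped Manifold ContDiff RealInnerProductSpace

noncomputable section

namespace KottlerCMC

/-! ## The Kottler-Schwarzschild-de Sitter metric and its future cosmological region -/

/-- Euclidean three-space. -/
abbrev E3 : Type := EuclideanSpace ℝ (Fin 3)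

/-- The round unit two-sphere, with the smooth structure that Mathlib puts on it. -/
abbrev S2 : Type := Metric.sphere (0 : E3) 1

instance finrankE3 : Fact (Module.finrank ℝ E3 = 2 + 1) := ⟨by simp⟩

/-- `V(r) = 1 - 2M/r - Λ r²/3`. -/
def V (M Λ r : ℝ) : ℝ := 1 - 2 * M / r - Λ * r ^ 2 / 3

/-- The radius `r_c` of the cosmological horizon: the largest positive zero of `V`. -/
def horizon (M Λ : ℝ) : ℝ := sSup {r : ℝ | 0 < r ∧ V M Λ r = 0}

/-- The Kottler-Schwarzschild-de Sitter metric `-V dt² + V⁻¹ dr² + r² g_{S²}` at the point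
`p = (t, x)` of `ℝ × ℝ³`. The point `x = r ω` of `ℝ³ ∖ {0}` encodes the area radius
`r = ‖x‖` and the point `ω = x / ‖x‖` of `S²`; hence `dr(u) = ⟪x, u⟫ / ‖x‖` and
`r² g_{S²} = |dx|² - dr²`. -/
def metric (M Λ : ℝ) (p u v : ℝ × E3) : ℝ :=
  -V M Λ ‖p.2‖ * (u.1 * v.1)
    + (V M Λ ‖p.2‖)⁻¹ * (⟪p.2, u.2⟫ / ‖p.2‖) * (⟪p.2, v.2⟫ / ‖p.2‖)
    + (⟪u.2, v.2⟫ - (⟪p.2, u.2⟫ / ‖p.2‖) * (⟪p.2, v.2⟫ / ‖p.2‖))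

/-- The Christoffel symbols of the first kind of `metric` in the coordinates of `ℝ × ℝ³`:
`christoffel M Λ p u v w = g(∇_u v, w)` at `p`, where `∇` is the Levi-Civita connection of
the metric `g` and `u, v, w` are extended as constant vector fields (Koszul formula). -/
def christoffel (M Λ : ℝ) (p u v w : ℝ × E3) : ℝ :=
  (1 / 2) * (fderiv ℝ (fun q => metric M Λ q v w) p u
    + fderiv ℝ (fun q => metric M Λ q u w) p v
    - fderiv ℝ (fun q => metric M Λ q u v) p w)

/-- The spacetime `FC[T]`: the future cosmological region `{r > r_c}` with `t = -T` and `t = T`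
identified, i.e. with `t` taken modulo `2T`. It carries the metric `metric`, which does not
depend on `t`, and the time orientation for which `r` increases to the future. It is `FC₊[T]`
for `M > 0` and `FC₋[T]` for `M < 0`. -/
abbrev FC (M Λ T : ℝ) : Type :=
  {p : AddCircle (2 * T) × E3 // horizon M Λ < ‖p.2‖}

/-- The Killing flow, i.e. the flow `t ↦ t + s` of the Killing vector field `∂_t`, on `FC[T]`. -/
def killingFlow {M Λ T : ℝ} (s : ℝ) (p : FC M Λ T) : FC M Λ T :=
  ⟨(p.1.1 + (s : AddCircle (2 * T)), p.1.2), p.2⟩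

/-- `c` is a lift of the map `γ` into `FC[T]` to the covering space
`{(t, x) : ‖x‖ > r_c} ⊆ ℝ × ℝ³` of `FC[T]`. -/
def IsLift {M Λ T : ℝ} {A : Type} (γ : A → FC M Λ T) (c : A → ℝ × E3) : Prop :=
  ∀ a, (γ a).1 = (((c a).1 : AddCircle (2 * T)), (c a).2)

/-- A future-directed vector at `p`: one along which `r` increases. For nonzero causal vectors
at a point with `V < 0` this is the time orientation of the future cosmological region. -/
def IsFutureDirected (p u : ℝ × E3) : Prop := 0 < ⟪p.2, u.2⟫

/-! ## Cauchy hypersurfaces -/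

/-- `γ` is a future-directed causal `C¹` curve in `FC[T]`, parametrized by `ℝ`. -/
def IsCausalCurve {M Λ T : ℝ} (γ : ℝ → FC M Λ T) : Prop :=
  ∃ c : ℝ → ℝ × E3, ContDiff ℝ 1 c ∧ IsLift γ c ∧
    ∀ s, metric M Λ (c s) (deriv c s) (deriv c s) ≤ 0 ∧ IsFutureDirected (c s) (deriv c s)

/-- `γ` has neither a future nor a past end point. -/
def IsInextendible {M Λ T : ℝ} (γ : ℝ → FC M Λ T) : Prop :=
  (¬ ∃ p, Tendsto γ atTop (𝓝 p)) ∧ (¬ ∃ p, Tendsto γ atBot (𝓝 p))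

/-- `S` is a Cauchy hypersurface: each inextendible causal curve meets it exactly once. -/
def IsCauchy {M Λ T : ℝ} (S : Set (FC M Λ T)) : Prop :=
  ∀ γ : ℝ → FC M Λ T, IsCausalCurve γ → IsInextendible γ → ∃! s, γ s ∈ S

/-! ## Compact spherically symmetric CMC data -/

/-- `D(r) = V(r) + (K r/3 - C/r²)²`. -/
def D (M Λ K C r : ℝ) : ℝ := V M Λ r + (K * r / 3 - C / r ^ 2) ^ 2

/-- `0 < r_min < r_max` are simple zeros of `D`, and `D > 0` in between. -/
structure IsWell (M Λ K C rmin rmax : ℝ) : Prop where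
  pos : 0 < rmin
  lt : rmin < rmax
  zero_min : D M Λ K C rmin = 0
  zero_max : D M Λ K C rmax = 0
  simple_min : deriv (D M Λ K C) rmin ≠ 0
  simple_max : deriv (D M Λ K C) rmax ≠ 0
  pos_between : ∀ r ∈ Ioo rmin rmax, 0 < D M Λ K C r

/-- The parameter space `𝒦𝒞₁`: pairs `(K, C)` for which `D` has two zeros `r_min < r_max` as in
`IsWell`, and these satisfy `r_c < r_min`. This condition describes two domains, which are
exchanged by `(K, C) ↦ (-K, -C)`; `𝒦𝒞₁` is the one in which `K > 0`. -/
def KC1 (M Λ : ℝ) : Set (ℝ × ℝ) :=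
  {q | 0 < q.1 ∧ (∃ rmin rmax, IsWell M Λ q.1 q.2 rmin rmax) ∧
    ∀ rmin rmax, IsWell M Λ q.1 q.2 rmin rmax → horizon M Λ < rmin}

/-- The radius function `r(l)` of the data: the smooth, positive, nonconstant solution of
`r'² = D(r)` with `r(0) = r_min`. (It oscillates between `r_min` and `r_max`, it is even,
and its period is `2L`.) -/
structure IsRadius (M Λ K C rmin : ℝ) (r : ℝ → ℝ) : Prop where
  smooth : ContDiff ℝ ∞ r
  pos : ∀ l, 0 < r l
  ode : ∀ l, deriv r l ^ 2 = D M Λ K C (r l)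
  init : r 0 = rmin
  nonconst : ∃ l, r l ≠ rmin

/-- The half-period `L = ∫_{r_min}^{r_max} D(r)^{-1/2} dr`. -/
def halfPeriod (M Λ K C rmin rmax : ℝ) : ℝ :=
  ∫ ρ in rmin..rmax, (√(D M Λ K C ρ))⁻¹

/-- `𝒯 = |∫_0^L V(r(l))⁻¹ (K r(l)/3 - C/r(l)²) dl|`, with `L` the half-period. -/
def calT (M Λ K C rmin rmax : ℝ) (r : ℝ → ℝ) : ℝ :=
  |∫ l in (0 : ℝ)..halfPeriod M Λ K C rmin rmax,
    (V M Λ (r l))⁻¹ * (K * r l / 3 - C / r l ^ 2)|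

/-- The model with corners of `ℝ × S²`. -/
abbrev IData := (𝓘(ℝ, ℝ)).prod (𝓡 2)

/-- The one-form `dl` on `ℝ × S²`. -/
def dl (p : ℝ × S2) (X : TangentSpace IData p) : ℝ :=
  mvfderiv IData (fun q : ℝ × S2 => q.1) p X

/-- The `S²`-part of a tangent vector of `ℝ × S²`, as a vector of `ℝ³`. -/
def sphereVec (p : ℝ × S2) (X : TangentSpace IData p) : E3 :=
  mvfderiv IData (fun q : ℝ × S2 => (q.2 : E3)) p X

/-- The standard metric of `S²`, pulled back to `ℝ × S²`. -/
def gS2 (p : ℝ × S2) (X Y : TangentSpace IData p) : ℝ :=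
  ⟪sphereVec p X, sphereVec p Y⟫

/-- The first fundamental form `g = dl² + r(l)² g_{S²}` of the data, on the universal cover
`ℝ × S²` of `S¹ × S²`. -/
def dataMetric (r : ℝ → ℝ) (p : ℝ × S2) (X Y : TangentSpace IData p) : ℝ :=
  dl p X * dl p Y + r p.1 ^ 2 * gS2 p X Y

/-- The second fundamental form `k = (K/3) g + C (2 r⁻³ dl² - r⁻¹ g_{S²})` of the data, on the
universal cover `ℝ × S²` of `S¹ × S²`. -/
def dataSecond (K C : ℝ) (r : ℝ → ℝ) (p : ℝ × S2) (X Y : TangentSpace IData p) : ℝ :=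
  K / 3 * dataMetric r p X Y
    + C * (2 / r p.1 ^ 3 * (dl p X * dl p Y) - 1 / r p.1 * gS2 p X Y)

/-! ## Embeddings of the data -/

/-- A smooth map `Φ` from `ℝ × S²` to the cover `{(t, x) : ‖x‖ > r_c}` of `FC[T]` induces
the data `(g, k)`: the pull-back of the spacetime metric is `g`, and
`k(X, Y) = g(∇_X N, Y)` where `N` is the future-directed unit normal. -/
structure Induces (M Λ K C : ℝ) (r : ℝ → ℝ) (Φ : ℝ × S2 → ℝ × E3) : Prop where
  first : ∀ (p : ℝ × S2) (X Y : TangentSpace IData p),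
    metric M Λ (Φ p) (mvfderiv IData Φ p X) (mvfderiv IData Φ p Y) = dataMetric r p X Y
  second : ∃ N : ℝ × S2 → ℝ × E3, ContMDiff IData 𝓘(ℝ, ℝ × E3) ∞ N ∧
    (∀ p, metric M Λ (Φ p) (N p) (N p) = -1) ∧
    (∀ p, IsFutureDirected (Φ p) (N p)) ∧
    (∀ (p : ℝ × S2) (X : TangentSpace IData p),
      metric M Λ (Φ p) (N p) (mvfderiv IData Φ p X) = 0) ∧
    (∀ (p : ℝ × S2) (X Y : TangentSpace IData p),
      metric M Λ (Φ p) (mvfderiv IData N p X) (mvfderiv IData Φ p Y)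
        + christoffel M Λ (Φ p) (mvfderiv IData Φ p X) (N p) (mvfderiv IData Φ p Y)
        = dataSecond K C r p X Y)

/-- The manifold `S¹ × S²` of the `n`-fold covering of the data, where `S¹ = ℝ / (n · 2L) ℤ`;
for `n = 1` it is the manifold of the data themselves. -/
abbrev DataManifold (n : ℕ) (L : ℝ) : Type := AddCircle ((n : ℝ) * (2 * L)) × S2

/-- `φ` is a smooth embedding into `FC[T]` of the `n`-fold covering of the data with radius
function `r` and half-period `L`: it is a topological embedding which is smooth and induces
`(g, k)`. Smoothness and the induced data are read off a lift `Φ` of `φ` to the universal cover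
`ℝ × S²` of the domain and to the cover of `FC[T]`; as `ℝ × S²` is simply connected, each
continuous `φ` has such a lift, and `φ` is smooth iff `Φ` is. (The map `φ` is an immersion,
since `g` is positive definite.) -/
structure IsDataEmbedding (M Λ K C T : ℝ) (n : ℕ) (L : ℝ) (r : ℝ → ℝ)
    (φ : DataManifold n L → FC M Λ T) : Prop where
  isEmbedding : IsEmbedding φ
  exists_lift : ∃ Φ : ℝ × S2 → ℝ × E3,
    IsLift (fun p : ℝ × S2 => φ ((p.1 : AddCircle ((n : ℝ) * (2 * L))), p.2)) Φ ∧
    ContMDiff IData 𝓘(ℝ, ℝ × E3) ∞ Φ ∧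
    Induces M Λ K C r Φ

end KottlerCMC

end

/-! Write χ(r) = Kr/3 − C/r², so that D = V + χ² (`drift` is χ). Existence is a computation: on the
universal cover ℝ × S² the map (l, z) ↦ (h(l), r(l) z) with h' = χ/(−V) (`height`, `refMap`) induces
(g, k), by r'² = V + χ² and r'' = D'(r)/2 (`induces_refMap`). On the well χ > 0 (`drift_pos`), so h
is odd, strictly increasing, and satisfies h(l + 2L) = h(l) + 2𝒯. For T = n𝒯 the map therefore
descends to an embedding of the n-fold covering (`exists_embedding`).

The heart is the converse. An embedding is not assumed to be spherically symmetric, but every lift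
that induces (g, k) has the form (t₀ ± h(l), r(l) A(z)) with A : S² → S² surjective (`normal_form`).
The reason is the Gauss equation: g and k determine the values of the spacetime curvature on vectors
tangent to the hypersurface (`IsHypersurface.curvature_eq`). This curvature is a constant-curvature
part plus a part proportional to M/r³ that distinguishes the (t, r)-plane from the angular plane.
Since M ≠ 0, comparison with the reference map determines r and forces ∂_l to have no angular
component (`gauss_algebra`, `rigidity_of_curvature_eq`). The first fundamental form then yields the
first derivatives of the lift, and these integrate to the normal form.

The Gauss equation is derived extrinsically. The region r > r_c embeds isometrically into a flat
space of dimension six (`flatMap`). For maps into a flat space, the Gauss equation only expresses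
that partial derivatives commute (`gauss_flat`); splitting second derivatives into parts tangent to
the hypersurface, along N, and normal to the spacetime isolates the spacetime curvature.

Given the normal form, the image depends only on t₀, because r is even and h is odd; this is
uniqueness modulo the Killing flow. Closing up around the circle makes n𝒯 an integer multiple of T,
and injectivity excludes multiples greater than one (`period_eq`). Finally, the image is a graph r =
R(t) with |R'| < −V, which every inextendible causal curve crosses exactly once (`isCauchy_slice`).
-/

noncomputable section

namespace KottlerCMC

/-! ## The lapse and the horizon -/

/-- The parameter range in which a cosmological horizon exists. -/
abbrev Subextremal (M Λ : ℝ) : Prop := M < 0 ∨ (0 < M ∧ 9 * M ^ 2 * Λ < 1)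

/-- The derivative of `V`. -/
def dV (M Λ r : ℝ) : ℝ := 2 * M / r ^ 2 - 2 * Λ * r / 3

/-- The second derivative of `V`. -/
def ddV (M Λ r : ℝ) : ℝ := -4 * M / r ^ 3 - 2 * Λ / 3

lemma hasDerivAt_V (M Λ : ℝ) {r : ℝ} (hr : r ≠ 0) : HasDerivAt (V M Λ) (dV M Λ r) r := by
  unfold V dV
  have h1 : HasDerivAt (fun x : ℝ => 2 * M / x) (2 * M * (-(r ^ 2)⁻¹)) r := by
    simpa [div_eq_mul_inv] using (hasDerivAt_inv hr).const_mul (2 * M)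
  have h2 : HasDerivAt (fun x : ℝ => Λ * x ^ 2 / 3) (Λ * (2 * r) / 3) r := by
    simpa using (((hasDerivAt_pow 2 r).const_mul Λ).div_const 3)
  convert! (h1.const_sub 1).sub h2 using 1
  field_simp

lemma hasDerivAt_dV (M Λ : ℝ) {r : ℝ} (hr : r ≠ 0) : HasDerivAt (dV M Λ) (ddV M Λ r) r := by
  unfold dV ddV
  have h1 : HasDerivAt (fun x : ℝ => 2 * M / x ^ 2) (2 * M * (-(2 * r) / (r ^ 2) ^ 2)) r := by
    have := ((hasDerivAt_pow 2 r).inv (pow_ne_zero 2 hr)).const_mul (2 * M)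
    simpa [div_eq_mul_inv] using this
  have h2 : HasDerivAt (fun x : ℝ => 2 * Λ * x / 3) (2 * Λ / 3) r := by
    simpa using (((hasDerivAt_id r).const_mul (2 * Λ)).div_const 3)
  convert! h1.sub h2 using 1
  field_simp
  ring

lemma V_eq_div (M Λ : ℝ) {r : ℝ} (hr : 0 < r) :
    V M Λ r = (r - 2 * M - Λ * r ^ 3 / 3) / r := by
  unfold V; field_simp

lemma cubic_neg_of_large {Λ M r : ℝ} (hΛ : 0 < Λ) (hr : 1 + 3 / Λ + 6 * |M| / Λ < r) :
    r - 2 * M - Λ * r ^ 3 / 3 < 0 := by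
  have h1 : 0 < 3 / Λ := by positivity
  have h2 : 0 ≤ 6 * |M| / Λ := by positivity
  have hr1 : 1 < r := by linarith
  have h3 : Λ + 3 + 6 * |M| < Λ * r := by
    have := mul_lt_mul_of_pos_left hr hΛ
    have e : Λ * (1 + 3 / Λ + 6 * |M| / Λ) = Λ + 3 + 6 * |M| := by field_simp
    linarith
  have h4 := neg_abs_le M
  have hM := abs_nonneg M
  have h5 : (Λ + 3 + 6 * |M|) * r ^ 2 < Λ * r * r ^ 2 :=
    mul_lt_mul_of_pos_right h3 (by positivity)
  have h6 : r < r ^ 2 := by nlinarith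
  nlinarith

lemma exists_cubic_eq_zero {Λ M a : ℝ} (hΛ : 0 < Λ)
    (hpos : 0 < a - 2 * M - Λ * a ^ 3 / 3) :
    ∃ r, a < r ∧ r - 2 * M - Λ * r ^ 3 / 3 = 0 := by
  set b : ℝ := max a (1 + 3 / Λ + 6 * |M| / Λ) + 1 with hb
  have hab : a ≤ b := by have := le_max_left a (1 + 3 / Λ + 6 * |M| / Λ); linarith
  have hbneg := cubic_neg_of_large (M := M) hΛ
    (show 1 + 3 / Λ + 6 * |M| / Λ < b by
      have := le_max_right a (1 + 3 / Λ + 6 * |M| / Λ); linarith)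
  have hc : ContinuousOn (fun r : ℝ => r - 2 * M - Λ * r ^ 3 / 3) (Icc a b) := by fun_prop
  obtain ⟨r, hr, h0⟩ := intermediate_value_Icc' hab hc ⟨hbneg.le, hpos.le⟩
  refine ⟨r, lt_of_le_of_ne hr.1 ?_, h0⟩
  rintro rfl
  exact hpos.ne' h0

lemma V_eq_zero_iff (M Λ : ℝ) {r : ℝ} (hr : 0 < r) :
    V M Λ r = 0 ↔ r - 2 * M - Λ * r ^ 3 / 3 = 0 := by
  rw [V_eq_div M Λ hr, div_eq_zero_iff]; simp [hr.ne']

lemma bddAbove_zeros {M Λ : ℝ} (hΛ : 0 < Λ) : BddAbove {r : ℝ | 0 < r ∧ V M Λ r = 0} := by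
  refine ⟨1 + 3 / Λ + 6 * |M| / Λ, fun r hr => ?_⟩
  by_contra! h
  exact (cubic_neg_of_large hΛ h).ne ((V_eq_zero_iff M Λ hr.1).1 hr.2)

/-- For M < 0 the cubic r − 2M − Λr³/3 is positive at 0; for M > 0 its value at 3M is M(1 − 9M²Λ) >
0. The bound 3M < r is recorded because it makes V decreasing beyond the horizon. -/
lemma exists_zero_V {M Λ : ℝ} (hΛ : 0 < Λ) (hM : Subextremal M Λ) :
    ∃ r, 0 < r ∧ 3 * M < r ∧ V M Λ r = 0 := by
  rcases hM with hM | ⟨hM, h9⟩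
  · obtain ⟨r, hr, h0⟩ := exists_cubic_eq_zero (M := M) (a := 0) hΛ (by norm_num; linarith)
    exact ⟨r, hr, by linarith, (V_eq_zero_iff M Λ hr).2 h0⟩
  · obtain ⟨r, hr, h0⟩ := exists_cubic_eq_zero (M := M) (a := 3 * M) hΛ (by nlinarith)
    have : 0 < r := by linarith
    exact ⟨r, this, hr, (V_eq_zero_iff M Λ this).2 h0⟩

lemma horizon_pos {M Λ : ℝ} (hΛ : 0 < Λ) (hM : Subextremal M Λ) : 0 < horizon M Λ := by
  obtain ⟨r, h1, -, h3⟩ := exists_zero_V hΛ hM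
  exact h1.trans_le (le_csSup (bddAbove_zeros hΛ) ⟨h1, h3⟩)

lemma three_mul_lt_horizon {M Λ : ℝ} (hΛ : 0 < Λ) (hM : Subextremal M Λ) :
    3 * M < horizon M Λ := by
  obtain ⟨r, h1, h2, h3⟩ := exists_zero_V hΛ hM
  exact h2.trans_le (le_csSup (bddAbove_zeros hΛ) ⟨h1, h3⟩)

lemma V_neg {M Λ r : ℝ} (hΛ : 0 < Λ) (hM : Subextremal M Λ) (hr : horizon M Λ < r) :
    V M Λ r < 0 := by
  have hr0 : 0 < r := (horizon_pos hΛ hM).trans hr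
  by_contra! h
  have key : ∃ s, r ≤ s ∧ V M Λ s = 0 := by
    rcases h.eq_or_lt with h | h
    · exact ⟨r, le_rfl, h.symm⟩
    · rw [V_eq_div M Λ hr0] at h
      have h' : 0 < r - 2 * M - Λ * r ^ 3 / 3 := (div_pos_iff_of_pos_right hr0).1 h
      obtain ⟨s, hs, h0⟩ := exists_cubic_eq_zero hΛ h'
      exact ⟨s, hs.le, (V_eq_zero_iff M Λ (hr0.trans hs)).2 h0⟩
  obtain ⟨s, hs, h0⟩ := key
  have : s ≤ horizon M Λ := le_csSup (bddAbove_zeros hΛ) ⟨hr0.trans_le hs, h0⟩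
  linarith

/-- From V < 0 one has r − 2M < Λr³/3; with r > 3M this gives 3M − Λr³ < 3(3M − r) < 0. -/
lemma dV_neg {M Λ r : ℝ} (hΛ : 0 < Λ) (hM : Subextremal M Λ) (hr : horizon M Λ < r) :
    dV M Λ r < 0 := by
  have hr0 : 0 < r := (horizon_pos hΛ hM).trans hr
  have hV := V_neg hΛ hM hr
  rw [V_eq_div M Λ hr0, div_lt_iff₀ hr0, zero_mul] at hV
  have h3 := (three_mul_lt_horizon hΛ hM).trans hr
  have e : dV M Λ r = 2 * (3 * M - Λ * r ^ 3) / (3 * r ^ 2) := by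
    unfold dV; field_simp
  rw [e, div_lt_iff₀ (by positivity), zero_mul]
  linarith

lemma strictAntiOn_V {M Λ : ℝ} (hΛ : 0 < Λ) (hM : Subextremal M Λ) :
    StrictAntiOn (V M Λ) (Ioi (horizon M Λ)) := by
  have h0 := horizon_pos hΛ hM
  refine strictAntiOn_of_deriv_neg (convex_Ioi _) (fun r hr => ?_) (fun r hr => ?_)
  · exact (hasDerivAt_V M Λ (h0.trans hr).ne').continuousAt.continuousWithinAt
  · rw [interior_Ioi] at hr
    rw [(hasDerivAt_V M Λ (h0.trans hr).ne').deriv]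
    exact dV_neg hΛ hM hr

/-- The function `K r / 3 - C / r²`. -/
def drift (K C r : ℝ) : ℝ := K * r / 3 - C / r ^ 2

/-- The derivative of `drift`. -/
def ddrift (K C r : ℝ) : ℝ := K / 3 + 2 * C / r ^ 3

lemma hasDerivAt_drift (K C : ℝ) {r : ℝ} (hr : r ≠ 0) :
    HasDerivAt (drift K C) (ddrift K C r) r := by
  unfold drift ddrift
  have h1 : HasDerivAt (fun x : ℝ => C / x ^ 2) (C * (-(2 * r) / (r ^ 2) ^ 2)) r := by
    have := ((hasDerivAt_pow 2 r).inv (pow_ne_zero 2 hr)).const_mul C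
    simpa [div_eq_mul_inv] using this
  have h2 : HasDerivAt (fun x : ℝ => K * x / 3) (K / 3) r := by
    simpa using (((hasDerivAt_id r).const_mul K).div_const 3)
  convert! h2.sub h1 using 1
  field_simp
  ring

lemma D_eq (M Λ K C r : ℝ) : D M Λ K C r = V M Λ r + drift K C r ^ 2 := rfl

/-- The derivative of `D`. -/
def dD (M Λ K C r : ℝ) : ℝ := dV M Λ r + 2 * drift K C r * ddrift K C r

lemma hasDerivAt_D (M Λ K C : ℝ) {r : ℝ} (hr : r ≠ 0) :
    HasDerivAt (D M Λ K C) (dD M Λ K C r) r := by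
  unfold dD
  convert! (hasDerivAt_V M Λ hr).add ((hasDerivAt_drift K C hr).pow 2) using 1
  simp

lemma IsWell.D_nonneg {M Λ K C a b : ℝ} (h : IsWell M Λ K C a b) {r : ℝ} (hr : r ∈ Icc a b) :
    0 ≤ D M Λ K C r := by
  rcases hr.1.eq_or_lt with rfl | h1
  · exact h.zero_min.ge
  rcases hr.2.eq_or_lt with rfl | h2
  · exact h.zero_max.ge
  exact (h.pos_between r ⟨h1, h2⟩).le

/-- Since D ≥ 0 and V < 0 on the well, the drift has no zero there and keeps its sign. Were it
negative, C would be positive, the drift would be larger at b than at a, and its square smaller. As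
V decreases too, this gives D(b) < D(a), although both vanish. -/
lemma drift_pos {M Λ K C a b : ℝ} (hΛ : 0 < Λ) (hM : Subextremal M Λ) (hK : 0 < K)
    (h : IsWell M Λ K C a b) (hor : horizon M Λ < a) {r : ℝ} (hr : r ∈ Icc a b) :
    0 < drift K C r := by
  have ha := h.pos
  have hne : ∀ s ∈ Icc a b, drift K C s ≠ 0 := fun s hs h0 => by
    have h1 := h.D_nonneg hs
    rw [D_eq, h0] at h1
    have := V_neg hΛ hM (hor.trans_le hs.1)
    linarith
  have hcont : ContinuousOn (drift K C) (Icc a b) := fun s hs =>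
    (hasDerivAt_drift K C (ha.trans_le hs.1).ne').continuousAt.continuousWithinAt
  have hmin : a ∈ Icc a b := ⟨le_rfl, h.lt.le⟩
  have hmax : b ∈ Icc a b := ⟨h.lt.le, le_rfl⟩
  by_contra! hneg
  have hneg : drift K C r < 0 := lt_of_le_of_ne hneg (hne r hr)
  have hall : ∀ s ∈ Icc a b, drift K C s < 0 := fun s hs => by
    by_contra! hp
    obtain ⟨u, hu, hu0⟩ := isPreconnected_Icc.intermediate_value hr hs hcont ⟨hneg.le, hp⟩
    exact hne u hu hu0
  have hC : 0 < C := by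
    by_contra! hC
    have : 0 ≤ -C / r ^ 2 := div_nonneg (by linarith) (by positivity)
    have hr0 := ha.trans_le hr.1
    have h2 : 0 < K * r / 3 := by positivity
    unfold drift at hneg
    rw [neg_div] at this
    linarith
  have hlt : drift K C a < drift K C b := by
    have hb := ha.trans h.lt
    have h1 : C / b ^ 2 < C / a ^ 2 :=
      div_lt_div_of_pos_left hC (by positivity) (pow_lt_pow_left₀ h.lt ha.le two_ne_zero)
    have h2 := mul_lt_mul_of_pos_left h.lt hK
    unfold drift
    linarith
  have hVlt := strictAntiOn_V hΛ hM hor (hor.trans h.lt) h.lt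
  have e1 := h.zero_min
  have e2 := h.zero_max
  rw [D_eq] at e1 e2
  have := hall a hmin
  have := hall b hmax
  nlinarith

section

/-! ## The radius function -/

/-- Uniqueness for the first-order system satisfied by (f, f'). A Lipschitz bound on [a, b] suffices
since both solutions stay there; the force D'/2 is singular at r = 0. -/
lemma eq_of_second_order_ode {g f f' h h' : ℝ → ℝ} {a b t₀ : ℝ} {k : NNReal}
    (hg : LipschitzOnWith k g (Icc a b))
    (hf : ∀ t, HasDerivAt f (f' t) t) (hf' : ∀ t, HasDerivAt f' (g (f t)) t)
    (hfm : ∀ t, f t ∈ Icc a b)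
    (hh : ∀ t, HasDerivAt h (h' t) t) (hh' : ∀ t, HasDerivAt h' (g (h t)) t)
    (hhm : ∀ t, h t ∈ Icc a b) (h0 : f t₀ = h t₀) (h0' : f' t₀ = h' t₀) : f = h := by
  let v : ℝ → ℝ × ℝ → ℝ × ℝ := fun _ p => (p.2, g p.1)
  have hv : ∀ t : ℝ, LipschitzOnWith (max 1 (k * 1)) (v t) (Icc a b ×ˢ univ) := fun t =>
    (LipschitzWith.prod_snd.lipschitzOnWith).prodMk
      (hg.comp LipschitzWith.prod_fst.lipschitzOnWith (fun p hp => hp.1))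
  have := ODE_solution_unique_univ (v := v) (s := fun _ => Icc a b ×ˢ univ) (t₀ := t₀)
    (f := fun t => (f t, f' t)) (g := fun t => (h t, h' t)) hv
    (fun t => ⟨(hf t).prodMk (hf' t), hfm t, trivial⟩)
    (fun t => ⟨(hh t).prodMk (hh' t), hhm t, trivial⟩) (by simp [h0, h0'])
  funext t
  exact congrArg Prod.fst (congrFun this t)

lemma contDiffAt_dD (M Λ K C : ℝ) {r : ℝ} (hr : r ≠ 0) : ContDiffAt ℝ 1 (dD M Λ K C) r := by
  unfold dD dV drift ddrift
  fun_prop (disch := positivity)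

lemma exists_lipschitzOnWith_dD (M Λ K C : ℝ) {a : ℝ} (b : ℝ) (ha : 0 < a) :
    ∃ k, LipschitzOnWith k (fun r => dD M Λ K C r / 2) (Icc a b) := by
  refine LocallyLipschitzOn.exists_lipschitzOnWith_of_compact isCompact_Icc fun r hr => ?_
  have h1 : ContDiffAt ℝ 1 (fun r => dD M Λ K C r / 2) r :=
    (contDiffAt_dD M Λ K C (ha.trans_le hr.1).ne').div_const 2
  obtain ⟨k, t, ht, hk⟩ := h1.exists_lipschitzOnWith
  exact ⟨k, t, mem_nhdsWithin_of_mem_nhds ht, hk⟩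

/-! ### Motion in the potential well -/

section Well

variable {M Λ K C a b : ℝ}

lemma IsWell.dD_min_pos (h : IsWell M Λ K C a b) : 0 < dD M Λ K C a := by
  have hd := (hasDerivAt_D M Λ K C h.pos.ne').deriv
  refine lt_of_le_of_ne ?_ (fun h0 => h.simple_min (hd.trans h0.symm))
  by_contra! hneg
  have h1 := eventually_nhdsWithin_sign_eq_of_deriv_neg (by rw [hd]; exact hneg) h.zero_min
  have h2 : ∀ᶠ x in 𝓝[>] a, x ∈ Ioo a b := Ioo_mem_nhdsGT h.lt
  obtain ⟨x, hx, hx'⟩ := ((h1.filter_mono nhdsWithin_le_nhds).and h2).exists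
  rw [sign_pos (h.pos_between x hx'), sign_neg (by linarith [hx'.1])] at hx
  exact absurd hx (by decide)

lemma IsWell.dD_max_neg (h : IsWell M Λ K C a b) : dD M Λ K C b < 0 := by
  have hd := (hasDerivAt_D M Λ K C (h.pos.trans h.lt).ne').deriv
  refine lt_of_le_of_ne ?_ (fun h0 => h.simple_max (hd.trans h0))
  by_contra! hpos
  have h1 := eventually_nhdsWithin_sign_eq_of_deriv_pos (by rw [hd]; exact hpos) h.zero_max
  have h2 : ∀ᶠ x in 𝓝[<] b, x ∈ Ioo a b := Ioo_mem_nhdsLT h.lt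
  obtain ⟨x, hx, hx'⟩ := ((h1.filter_mono nhdsWithin_le_nhds).and h2).exists
  rw [sign_pos (h.pos_between x hx'), sign_neg (by linarith [hx'.2])] at hx
  exact absurd hx (by decide)

lemma IsWell.eventually_neg_left (h : IsWell M Λ K C a b) :
    ∀ᶠ x in 𝓝[<] a, D M Λ K C x < 0 := by
  have hd := (hasDerivAt_D M Λ K C h.pos.ne').deriv
  have h1 := eventually_nhdsWithin_sign_eq_of_deriv_pos (by rw [hd]; exact h.dD_min_pos) h.zero_min
  filter_upwards [h1.filter_mono nhdsWithin_le_nhds, self_mem_nhdsWithin] with x hx hxa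
  rw [sign_neg (sub_neg.2 hxa)] at hx
  exact sign_eq_neg_one_iff.1 hx

lemma IsWell.eventually_neg_right (h : IsWell M Λ K C a b) :
    ∀ᶠ x in 𝓝[>] b, D M Λ K C x < 0 := by
  have hd := (hasDerivAt_D M Λ K C (h.pos.trans h.lt).ne').deriv
  have h1 := eventually_nhdsWithin_sign_eq_of_deriv_neg (by rw [hd]; exact h.dD_max_neg) h.zero_max
  filter_upwards [h1.filter_mono nhdsWithin_le_nhds, self_mem_nhdsWithin] with x hx hxa
  rw [sign_neg (sub_neg.2 hxa)] at hx
  exact sign_eq_neg_one_iff.1 hx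

lemma IsWell.eq_or_eq_of_D_eq_zero (h : IsWell M Λ K C a b) {x : ℝ} (hx : x ∈ Icc a b)
    (h0 : D M Λ K C x = 0) : x = a ∨ x = b := by
  by_contra! hne
  exact (h.pos_between x ⟨lt_of_le_of_ne hx.1 (Ne.symm hne.1), lt_of_le_of_ne hx.2 hne.2⟩).ne' h0

variable {r : ℝ → ℝ}

lemma IsRadius.continuous (hr : IsRadius M Λ K C a r) : Continuous r := hr.smooth.continuous

lemma IsRadius.hasDerivAt (hr : IsRadius M Λ K C a r) (l : ℝ) : HasDerivAt r (deriv r l) l :=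
  (hr.smooth.differentiable (by simp) l).hasDerivAt

lemma IsRadius.contDiff_deriv (hr : IsRadius M Λ K C a r) : ContDiff ℝ ∞ (deriv r) :=
  (contDiff_infty_iff_deriv.1 hr.smooth).2

lemma IsRadius.D_nonneg (hr : IsRadius M Λ K C a r) (l : ℝ) : 0 ≤ D M Λ K C (r l) := by
  rw [← hr.ode]; positivity

/-- The range of r is an interval that contains a and on which D ≥ 0, whereas D < 0 just outside the
well because the zeros are simple. -/
lemma IsRadius.mem_Icc (h : IsWell M Λ K C a b) (hr : IsRadius M Λ K C a r) (l : ℝ) :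
    r l ∈ Icc a b := by
  have hI : ∀ {x y : ℝ}, x ∈ range r → y ∈ range r → Icc x y ⊆ range r := fun hx hy =>
    (isPreconnected_range hr.continuous).ordConnected.out hx hy
  have ha : a ∈ range r := ⟨0, hr.init⟩
  constructor
  · by_contra! hl
    have h1 : ∀ᶠ x in 𝓝[<] a, x ∈ Ioo (r l) a := Ioo_mem_nhdsLT hl
    obtain ⟨x, hx, hx'⟩ := (h.eventually_neg_left.and h1).exists
    obtain ⟨l', rfl⟩ := hI ⟨l, rfl⟩ ha ⟨hx'.1.le, hx'.2.le⟩
    exact absurd (hr.D_nonneg l') (not_le.2 hx)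
  · by_contra! hl
    have h1 : ∀ᶠ x in 𝓝[>] b, x ∈ Ioo b (r l) := Ioo_mem_nhdsGT hl
    obtain ⟨x, hx, hx'⟩ := (h.eventually_neg_right.and h1).exists
    obtain ⟨l', rfl⟩ := hI ha ⟨l, rfl⟩ ⟨(h.lt.trans hx'.1).le, hx'.2.le⟩
    exact absurd (hr.D_nonneg l') (not_le.2 hx)

/-- Differentiating r'² = D(r) gives e r' = 0 for e = 2r'' − D'(r), which says nothing where r' = 0.
On the open set {e ≠ 0}, r' vanishes locally, so r is at an end of the well and e is one of two
fixed nonzero numbers. Hence this set is also closed, and it is not all of ℝ because r is not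
constant. -/
lemma IsRadius.hasDerivAt_deriv (h : IsWell M Λ K C a b) (hr : IsRadius M Λ K C a r) (l : ℝ) :
    HasDerivAt (deriv r) (dD M Λ K C (r l) / 2) l := by
  have hsm : ∀ l, HasDerivAt (deriv r) (deriv (deriv r) l) l := fun l =>
    (hr.contDiff_deriv.differentiable (by simp) l).hasDerivAt
  let e : ℝ → ℝ := fun l => 2 * deriv (deriv r) l - dD M Λ K C (r l)
  have he : Continuous e := by
    have h1 : Continuous (deriv (deriv r)) := (contDiff_infty_iff_deriv.1 hr.contDiff_deriv).2.continuous
    have h2 : Continuous fun l => dD M Λ K C (r l) := continuous_iff_continuousAt.2 fun l =>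
      ContinuousAt.comp (g := dD M Λ K C) (contDiffAt_dD M Λ K C (hr.pos l).ne').continuousAt
        hr.continuous.continuousAt
    exact (h1.const_mul 2).sub h2
  have hprod : ∀ l, e l * deriv r l = 0 := fun l => by
    have h1 : HasDerivAt (fun l => deriv r l ^ 2) (2 * deriv r l * deriv (deriv r) l) l := by
      convert! (hsm l).pow 2 using 1; simp
    have h2 : HasDerivAt (fun l => D M Λ K C (r l)) (dD M Λ K C (r l) * deriv r l) l :=
      (hasDerivAt_D M Λ K C (hr.pos l).ne').comp l (hr.hasDerivAt l)
    have h3 : (fun l => deriv r l ^ 2) = fun l => D M Λ K C (r l) := funext hr.ode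
    rw [h3] at h1
    have := h1.unique h2
    simp only [e]
    linear_combination this
  have hval : ∀ l, e l ≠ 0 → e l = -dD M Λ K C a ∨ e l = -dD M Λ K C b := fun l hl => by
    have hev : ∀ᶠ l' in 𝓝 l, deriv r l' = 0 := by
      filter_upwards [he.continuousAt.eventually_ne hl] with l' hl'
      exact (mul_eq_zero.1 (hprod l')).resolve_left hl'
    have h2 : deriv (deriv r) l = 0 := by
      rw [Filter.EventuallyEq.deriv_eq (f := fun _ => (0 : ℝ)) hev]; simp
    have h3 := hr.ode l
    rw [hev.self_of_nhds] at h3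
    have h4 : e l = -dD M Λ K C (r l) := by simp [e, h2]
    rcases h.eq_or_eq_of_D_eq_zero (hr.mem_Icc h l) (by rw [← h3]; norm_num) with h5 | h5
    · left; rw [h4, h5]
    · right; rw [h4, h5]
  have hset : {l | e l ≠ 0} = e ⁻¹' {-dD M Λ K C a, -dD M Λ K C b} := by
    ext l
    refine ⟨fun hl => hval l hl, fun hl => ?_⟩
    rcases hl with hl | hl
    · exact fun h0 => neg_ne_zero.2 h.dD_min_pos.ne' (hl.symm.trans h0)
    · exact fun h0 => neg_ne_zero.2 h.dD_max_neg.ne ((mem_singleton_iff.1 hl).symm.trans h0)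
  have hclopen : IsClopen {l | e l ≠ 0} :=
    ⟨hset ▸ (Set.toFinite _).isClosed.preimage he, isOpen_ne.preimage he⟩
  have hempty : {l | e l ≠ 0} = ∅ := by
    refine (isClopen_iff.1 hclopen).resolve_right fun huniv => ?_
    obtain ⟨l, hl⟩ := hr.nonconst
    apply hl
    rw [← hr.init]
    refine is_const_of_deriv_eq_zero (hr.smooth.differentiable (by simp)) (fun l => ?_) l 0
    exact (mul_eq_zero.1 (hprod l)).resolve_left (huniv ▸ mem_univ l : l ∈ {l | e l ≠ 0})
  have he0 : e l = 0 := by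
    by_contra hne
    exact (hempty ▸ hne : l ∈ (∅ : Set ℝ))
  convert! hsm l using 1
  simp only [e] at he0
  linarith

lemma IsRadius.eq_of_solution (h : IsWell M Λ K C a b) (hr : IsRadius M Λ K C a r)
    {f f' : ℝ → ℝ} {t₀ : ℝ} (hf : ∀ t, HasDerivAt f (f' t) t)
    (hf' : ∀ t, HasDerivAt f' (dD M Λ K C (f t) / 2) t) (hfm : ∀ t, f t ∈ Icc a b)
    (h0 : f t₀ = r t₀) (h0' : f' t₀ = deriv r t₀) : f = r := by
  obtain ⟨k, hk⟩ := exists_lipschitzOnWith_dD M Λ K C b h.pos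
  exact eq_of_second_order_ode hk hf hf' hfm hr.hasDerivAt (hr.hasDerivAt_deriv h)
    (hr.mem_Icc h) h0 h0'

/-- A solution of the radius equation is symmetric about each of its critical points. -/
lemma IsRadius.symm_of_deriv_eq_zero (h : IsWell M Λ K C a b) (hr : IsRadius M Λ K C a r)
    {t₀ : ℝ} (h0 : deriv r t₀ = 0) (l : ℝ) : r (2 * t₀ - l) = r l := by
  have hd : ∀ t, HasDerivAt (fun t : ℝ => 2 * t₀ - t) (-1) t := fun t => by
    simpa using (hasDerivAt_id t).const_sub (2 * t₀)
  have := hr.eq_of_solution h (f := fun t => r (2 * t₀ - t)) (f' := fun t => -deriv r (2 * t₀ - t))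
    (t₀ := t₀)
    (fun t => by convert! (hr.hasDerivAt (2 * t₀ - t)).comp t (hd t) using 1; ring)
    (fun t => by
      convert! ((hr.hasDerivAt_deriv h (2 * t₀ - t)).comp t (hd t)).neg using 1; ring)
    (fun t => hr.mem_Icc h _) (by ring_nf) (by simp [two_mul, h0])
  exact congrFun this l

lemma IsRadius.deriv_zero (h : IsWell M Λ K C a b) (hr : IsRadius M Λ K C a r) :
    deriv r 0 = 0 := by
  have := hr.ode 0
  rw [hr.init, h.zero_min] at this
  exact pow_eq_zero_iff two_ne_zero |>.1 this

lemma IsRadius.even (h : IsWell M Λ K C a b) (hr : IsRadius M Λ K C a r) (l : ℝ) :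
    r (-l) = r l := by
  simpa using hr.symm_of_deriv_eq_zero h (hr.deriv_zero h) l

/-- A convergent function whose derivative converges has derivative tending to `0`. -/
lemma limit_deriv_eq_zero {f f' : ℝ → ℝ} {A ℓ : ℝ} (hf : ∀ t, HasDerivAt f (f' t) t)
    (hA : Tendsto f atTop (𝓝 A)) (hℓ : Tendsto f' atTop (𝓝 ℓ)) : ℓ = 0 := by
  have h1 : ∀ t : ℝ, ∃ ξ ∈ Ioo t (t + 1), f' ξ = f (t + 1) - f t := fun t => by
    obtain ⟨ξ, hξ, h⟩ := exists_hasDerivAt_eq_slope f f' (show t < t + 1 by linarith)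
      (fun x _ => (hf x).continuousAt.continuousWithinAt) (fun x _ => hf x)
    exact ⟨ξ, hξ, by rw [h]; simp⟩
  choose ξ hξ hξ' using h1
  have h2 : Tendsto ξ atTop atTop := tendsto_atTop_mono (fun t => (hξ t).1.le) tendsto_id
  have h3 : Tendsto (fun t => f (t + 1) - f t) atTop (𝓝 (A - A)) :=
    (hA.comp (tendsto_atTop_add_const_right _ 1 tendsto_id)).sub hA
  rw [sub_self] at h3
  exact tendsto_nhds_unique ((hℓ.comp h2).congr hξ') h3

lemma IsRadius.eventually_deriv_pos (h : IsWell M Λ K C a b) (hr : IsRadius M Λ K C a r) :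
    ∀ᶠ l in 𝓝[>] 0, 0 < deriv r l := by
  have h1 : deriv (deriv r) 0 > 0 := by
    rw [(hr.hasDerivAt_deriv h 0).deriv, hr.init]
    exact half_pos h.dD_min_pos
  filter_upwards [(eventually_nhdsWithin_sign_eq_of_deriv_pos h1 (hr.deriv_zero h)).filter_mono
    nhdsWithin_le_nhds, self_mem_nhdsWithin] with l hl hl0
  rw [sub_zero, sign_pos (mem_Ioi.1 hl0)] at hl
  exact sign_eq_one_iff.1 hl

/-- Otherwise r increases to a limit A in the well. Then r' and r'' converge as well, hence to 0, so
D(A) = D'(A) = 0, contrary to the simplicity of the zeros. -/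
lemma IsRadius.exists_critical (h : IsWell M Λ K C a b) (hr : IsRadius M Λ K C a r) :
    ∃ l, 0 < l ∧ deriv r l = 0 := by
  by_contra! hne
  have hpos : ∀ l ∈ Ioi (0 : ℝ), 0 < deriv r l := by
    obtain ⟨l₀, hl₀, hl₀'⟩ := ((hr.eventually_deriv_pos h).and self_mem_nhdsWithin).exists
    intro l hl
    by_contra! hneg
    obtain ⟨u, hu, hu0⟩ := isPreconnected_Ioi.intermediate_value hl hl₀'
      hr.contDiff_deriv.continuous.continuousOn ⟨hneg, hl₀.le⟩
    exact hne u hu hu0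
  have hmono : StrictMonoOn r (Ici 0) := strictMonoOn_of_deriv_pos (convex_Ici 0)
    hr.continuous.continuousOn (by simpa using hpos)
  have hmono' : Monotone fun l => r (max 0 l) := fun x y hxy =>
    hmono.monotoneOn (mem_Ici.2 (le_max_left _ _)) (mem_Ici.2 (le_max_left _ _))
      (max_le_max le_rfl hxy)
  have hlim := tendsto_atTop_ciSup hmono' ⟨b, by rintro _ ⟨l, rfl⟩; exact (hr.mem_Icc h _).2⟩
  set A := ⨆ l, r (max 0 l)
  have hlim : Tendsto r atTop (𝓝 A) := hlim.congr' (by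
    filter_upwards [eventually_ge_atTop 0] with l hl; rw [max_eq_right hl])
  have hA : A ∈ Icc a b := isClosed_Icc.mem_of_tendsto hlim (Eventually.of_forall (hr.mem_Icc h))
  have hA0 : A ≠ 0 := (h.pos.trans_le hA.1).ne'
  have hd : Tendsto (deriv r) atTop (𝓝 (√(D M Λ K C A))) := by
    have h1 : Tendsto (fun l => √(D M Λ K C (r l))) atTop (𝓝 (√(D M Λ K C A))) :=
      (Real.continuous_sqrt.tendsto _).comp
        ((hasDerivAt_D M Λ K C hA0).continuousAt.tendsto.comp hlim)
    refine h1.congr' ?_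
    filter_upwards [eventually_gt_atTop 0] with l hl
    rw [← hr.ode, Real.sqrt_sq (hpos l hl).le]
  have h0 := limit_deriv_eq_zero hr.hasDerivAt hlim hd
  have hdd : Tendsto (fun l => dD M Λ K C (r l) / 2) atTop (𝓝 (dD M Λ K C A / 2)) :=
    ((contDiffAt_dD M Λ K C hA0).continuousAt.tendsto.comp hlim).div_const 2
  have h1 := limit_deriv_eq_zero (hr.hasDerivAt_deriv h) hd hdd
  rw [Real.sqrt_eq_zero (h.D_nonneg hA)] at h0
  rcases h.eq_or_eq_of_D_eq_zero hA h0 with h2 | h2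
  · rw [h2] at h1; linarith [h.dD_min_pos]
  · rw [h2] at h1; linarith [h.dD_max_neg]

lemma IsRadius.exists_first_critical (h : IsWell M Λ K C a b) (hr : IsRadius M Λ K C a r) :
    ∃ l, 0 < l ∧ deriv r l = 0 ∧ ∀ s ∈ Ioo 0 l, 0 < deriv r s := by
  obtain ⟨l₁, hl₁, hl₁'⟩ := hr.exists_critical h
  obtain ⟨ε, hε, hε'⟩ := mem_nhdsGT_iff_exists_Ioo_subset.1 (hr.eventually_deriv_pos h)
  have hε0 : (0 : ℝ) < ε := hε
  -- The cut-off ε keeps the critical point 0 out of S, so that S is closed with positive infimum;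
  -- no positive critical point is lost, as r' > 0 on (0, ε).
  let S : Set ℝ := {l | ε ≤ l ∧ deriv r l = 0}
  have hS : IsClosed S := isClosed_Ici.inter
    (isClosed_eq hr.contDiff_deriv.continuous continuous_const)
  have hSb : BddBelow S := ⟨ε, fun l hl => hl.1⟩
  have hmem : ∀ s, 0 < s → deriv r s = 0 → s ∈ S := fun s hs hs0 => by
    refine ⟨?_, hs0⟩
    by_contra! hlt
    exact (hε' ⟨hs, hlt⟩ : 0 < deriv r s).ne' hs0
  have hin := hS.csInf_mem ⟨l₁, hmem l₁ hl₁ hl₁'⟩ hSb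
  refine ⟨sInf S, hε0.trans_le hin.1, hin.2, fun s hs => ?_⟩
  by_contra! hneg
  have hp : 0 < deriv r (min (s / 2) (ε / 2)) := hε' ⟨lt_min (half_pos hs.1) (half_pos hε0),
    (min_le_right _ _).trans_lt (half_lt_self hε0)⟩
  have hlt : min (s / 2) (ε / 2) < s := (min_le_left _ _).trans_lt (half_lt_self hs.1)
  obtain ⟨u, hu, hu0⟩ := intermediate_value_Icc' hlt.le
    hr.contDiff_deriv.continuous.continuousOn ⟨hneg, hp.le⟩
  have hu1 : 0 < u := (lt_min (half_pos hs.1) (half_pos hε0)).trans_le hu.1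
  have := csInf_le hSb (hmem u hu1 hu0)
  linarith [hu.2, hs.2]

/-- The half-period is the first critical point of `r`, and `r` increases up to it. -/
lemma IsRadius.halfPeriod_spec (h : IsWell M Λ K C a b) (hr : IsRadius M Λ K C a r) :
    0 < halfPeriod M Λ K C a b ∧ deriv r (halfPeriod M Λ K C a b) = 0 ∧
      ∀ s ∈ Ioo 0 (halfPeriod M Λ K C a b), 0 < deriv r s := by
  obtain ⟨l, hl, hl0, hlpos⟩ := hr.exists_first_critical h
  suffices halfPeriod M Λ K C a b = l by rw [this]; exact ⟨hl, hl0, hlpos⟩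
  have hmono : StrictMonoOn r (Icc 0 l) := strictMonoOn_of_deriv_pos (convex_Icc 0 l)
    hr.continuous.continuousOn (by simpa using hlpos)
  have hrl : r l = b := by
    have h1 := hr.ode l
    rw [hl0] at h1
    refine (h.eq_or_eq_of_D_eq_zero (hr.mem_Icc h l) (by rw [← h1]; norm_num)).resolve_left ?_
    rw [← hr.init]
    exact (hmono ⟨le_rfl, hl.le⟩ ⟨hl.le, le_rfl⟩ hl).ne'
  have himg : r '' Ioo 0 l = Ioo a b := by
    apply Subset.antisymm
    · rintro _ ⟨s, hs, rfl⟩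
      rw [← hr.init, ← hrl]
      exact ⟨hmono ⟨le_rfl, hl.le⟩ (Ioo_subset_Icc_self hs) hs.1,
        hmono (Ioo_subset_Icc_self hs) ⟨hl.le, le_rfl⟩ hs.2⟩
    · have := intermediate_value_Ioo hl.le hr.continuous.continuousOn
      rwa [hr.init, hrl] at this
  -- The substitution ρ = r(s) turns D(ρ)^{-1/2} dρ into ds, since r' = √D(r) on (0, l).
  have hint := integral_image_eq_integral_abs_deriv_smul (s := Ioo 0 l) measurableSet_Ioo
    (fun x _ => (hr.hasDerivAt x).hasDerivWithinAt) (hmono.injOn.mono Ioo_subset_Icc_self)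
    (fun ρ => (√(D M Λ K C ρ))⁻¹)
  rw [himg] at hint
  unfold halfPeriod
  rw [intervalIntegral.integral_of_le h.lt.le, integral_Ioc_eq_integral_Ioo, hint]
  rw [setIntegral_congr_fun (g := fun _ => (1 : ℝ)) measurableSet_Ioo]
  · simp [hl.le]
  · intro s hs
    have hp := hlpos s hs
    simp only [smul_eq_mul]
    rw [← hr.ode, Real.sqrt_sq hp.le, abs_of_pos hp, mul_inv_cancel₀ hp.ne']

lemma IsRadius.symm_halfPeriod (h : IsWell M Λ K C a b) (hr : IsRadius M Λ K C a r) (l : ℝ) :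
    r (2 * halfPeriod M Λ K C a b - l) = r l :=
  hr.symm_of_deriv_eq_zero h (hr.halfPeriod_spec h).2.1 l

/-- The reflections about 0 and about L compose to the translation by 2L. -/
lemma IsRadius.periodic (h : IsWell M Λ K C a b) (hr : IsRadius M Λ K C a r) :
    Function.Periodic r (2 * halfPeriod M Λ K C a b) := fun l => by
  have := hr.symm_halfPeriod h (-l)
  rw [hr.even h] at this
  rw [← this]; ring_nf

end Well

end

section

/-! ## Maps on `ℝ × S²` and their radially constant extensions to `ℝ × ℝ³` -/

/-- The inclusion of `ℝ × S²` into `ℝ × ℝ³`. -/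
def incl (p : ℝ × S2) : ℝ × E3 := (p.1, (p.2 : E3))

lemma contMDiff_fst_data : ContMDiff IData 𝓘(ℝ, ℝ) ∞ (fun q : ℝ × S2 => q.1) := contMDiff_fst

lemma contMDiff_snd_data : ContMDiff IData 𝓘(ℝ, E3) ∞ (fun q : ℝ × S2 => (q.2 : E3)) :=
  (contMDiff_coe_sphere (n := 2) (E := E3)).comp contMDiff_snd

lemma contMDiff_incl : ContMDiff IData 𝓘(ℝ, ℝ × E3) ∞ incl :=
  contMDiff_fst_data.prodMk_space contMDiff_snd_data

variable {X : Type*} [NormedAddCommGroup X] [NormedSpace ℝ X]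

lemma mvfderiv_incl (p : ℝ × S2) (Y : TangentSpace IData p) :
    mvfderiv IData incl p Y = (dl p Y, sphereVec p Y) := by
  have h1 : MDifferentiableAt IData 𝓘(ℝ, ℝ × E3) incl p :=
    contMDiff_incl.mdifferentiableAt (by simp)
  have h2 := mfderiv_comp_apply (I := IData) (I' := 𝓘(ℝ, ℝ × E3)) (I'' := 𝓘(ℝ, ℝ)) (f := incl) p
    (differentiableAt_fst (p := incl p)).mdifferentiableAt h1 Y
  have h3 := mfderiv_comp_apply (I := IData) (I' := 𝓘(ℝ, ℝ × E3)) (I'' := 𝓘(ℝ, E3)) (f := incl) p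
    (differentiableAt_snd (p := incl p)).mdifferentiableAt h1 Y
  rw [mfderiv_eq_fderiv, fderiv_fst] at h2
  rw [mfderiv_eq_fderiv, fderiv_snd] at h3
  exact Prod.ext h2.symm h3.symm

/-- Together with the retraction `retr`, this reduces calculus on ℝ × S² to Fréchet derivatives on
an open subset of ℝ × ℝ³. -/
lemma mvfderiv_comp_incl {H : ℝ × E3 → X} (p : ℝ × S2) (hH : DifferentiableAt ℝ H (incl p))
    (Y : TangentSpace IData p) :
    mvfderiv IData (fun p => H (incl p)) p Y = fderiv ℝ H (incl p) (dl p Y, sphereVec p Y) := by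
  have h1 : MDifferentiableAt IData 𝓘(ℝ, ℝ × E3) incl p :=
    contMDiff_incl.mdifferentiableAt (by simp)
  have h2 := mfderiv_comp_apply (I := IData) (I' := 𝓘(ℝ, ℝ × E3)) (I'' := 𝓘(ℝ, X)) p
    hH.mdifferentiableAt h1 Y
  rw [← mvfderiv_incl p Y, ← mfderiv_eq_fderiv]
  exact h2

lemma inner_sphereVec (p : ℝ × S2) (Y : TangentSpace IData p) :
    ⟪(p.2 : E3), sphereVec p Y⟫ = 0 := by
  have h := mvfderiv_comp_incl (H := fun q : ℝ × E3 => ⟪q.2, q.2⟫) p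
    (differentiableAt_snd.inner ℝ differentiableAt_snd) Y
  have h1 : (fun p : ℝ × S2 => ⟪(incl p).2, (incl p).2⟫) = fun _ => (1 : ℝ) := by
    funext p
    simp [incl]
  have h2 : fderiv ℝ (fun q : ℝ × E3 => ⟪q.2, q.2⟫) (incl p) (dl p Y, sphereVec p Y)
      = 2 * ⟪(p.2 : E3), sphereVec p Y⟫ := by
    rw [fderiv_inner_apply ℝ (by fun_prop) (by fun_prop)]
    rw [fderiv_snd]
    simp [incl, real_inner_comm]
    ring
  rw [h1, h2, mvfderiv_const] at h
  simp at h
  exact h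

/-- A point of `S²`. -/
instance : Inhabited S2 := ⟨⟨EuclideanSpace.single 0 1, by simp⟩⟩

/-- The projection of `ℝ³ ∖ {0}` to `S²`. -/
def proj (x : E3) : S2 :=
  if h : x = 0 then default else ⟨‖x‖⁻¹ • x, by
    have : ‖x‖ ≠ 0 := norm_ne_zero_iff.2 h
    simp [norm_smul, this]⟩

lemma coe_proj {x : E3} (h : x ≠ 0) : (proj x : E3) = ‖x‖⁻¹ • x := by simp [proj, h]

lemma proj_coe (z : S2) : proj (z : E3) = z := by
  have h : (z : E3) ≠ 0 := ne_zero_of_mem_unit_sphere z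
  apply Subtype.ext
  rw [coe_proj h]
  simp

lemma contMDiffAt_proj {x : E3} (hx : x ≠ 0) : ContMDiffAt 𝓘(ℝ, E3) (𝓡 2) ∞ proj x := by
  have hn : 0 < ‖x‖ := norm_pos_iff.2 hx
  let β : ContDiffBump x := ⟨‖x‖ / 4, ‖x‖ / 2, by positivity, by linarith⟩
  -- The map g is the identity near x and stays within ‖x‖/2 of x everywhere, so it never vanishes.
  -- Normalizing it gives a globally smooth map into the sphere that agrees with `proj` near x.
  let g : E3 → E3 := fun y => x + β y • (y - x)
  have hg : ContDiff ℝ ∞ g := by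
    have := β.contDiff (n := ⊤)
    fun_prop
  have hg0 : ∀ y, g y ≠ 0 := fun y h0 => by
    have h1 : ‖β y • (y - x)‖ ≤ ‖x‖ / 2 := by
      rw [norm_smul, Real.norm_of_nonneg β.nonneg]
      by_cases hy : ‖y - x‖ ≤ ‖x‖ / 2
      · exact (mul_le_of_le_one_left (norm_nonneg _) β.le_one).trans hy
      · have : β y = 0 := β.zero_of_le_dist (by rw [dist_eq_norm]; exact (not_le.1 hy).le)
        rw [this, zero_mul]; positivity
    have h2 : x = -(β y • (y - x)) := eq_neg_of_add_eq_zero_left h0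
    have h3 : ‖x‖ = ‖β y • (y - x)‖ := by conv_lhs => rw [h2, norm_neg]
    linarith
  have hgs : ContDiff ℝ ∞ fun y => ‖g y‖⁻¹ • g y :=
    ((hg.norm ℝ hg0).inv fun y => norm_ne_zero_iff.2 (hg0 y)).smul hg
  have hmem : ∀ y, ‖g y‖⁻¹ • g y ∈ Metric.sphere (0 : E3) 1 := fun y => by
    have : ‖g y‖ ≠ 0 := norm_ne_zero_iff.2 (hg0 y)
    simp [norm_smul, this]
  have hG := ContMDiff.codRestrict_sphere (n := 2) hgs.contMDiff hmem
  refine (hG x).congr_of_eventuallyEq ?_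
  have hev : ∀ᶠ y in 𝓝 x, y ∈ Metric.closedBall x (‖x‖ / 4) :=
    Metric.closedBall_mem_nhds x (by positivity)
  filter_upwards [hev] with y hy
  have hgy : g y = y := by
    have : β y = 1 := β.one_of_mem_closedBall hy
    simp [g, this]
  have hy0 : y ≠ 0 := hgy ▸ hg0 y
  apply Subtype.ext
  rw [coe_proj hy0]
  simp [hgy]

/-- The retraction of `ℝ × (ℝ³ ∖ {0})` onto `ℝ × S²`. -/
def retr (q : ℝ × E3) : ℝ × S2 := (q.1, proj q.2)

lemma retr_incl (p : ℝ × S2) : retr (incl p) = p := by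
  simp [retr, incl, proj_coe]

/-- The set `ℝ × (ℝ³ ∖ {0})`. -/
def punctured : Set (ℝ × E3) := {q | q.2 ≠ 0}

lemma isOpen_punctured : IsOpen punctured := isOpen_ne.preimage continuous_snd

lemma incl_mem_punctured (p : ℝ × S2) : incl p ∈ punctured := ne_zero_of_mem_unit_sphere p.2

lemma contMDiffAt_retr {q : ℝ × E3} (hq : q ∈ punctured) :
    ContMDiffAt 𝓘(ℝ, ℝ × E3) IData ∞ retr q := by
  refine ContMDiffAt.prodMk contDiff_fst.contMDiff.contMDiffAt ?_
  exact ContMDiffAt.comp (g := proj) q (contMDiffAt_proj hq) contDiff_snd.contMDiff.contMDiffAt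

lemma contDiffOn_comp_retr {Φ : ℝ × S2 → X} (hΦ : ContMDiff IData 𝓘(ℝ, X) ∞ Φ) :
    ContDiffOn ℝ ∞ (fun q => Φ (retr q)) punctured := fun q hq =>
  ((hΦ.contMDiffAt.comp q (contMDiffAt_retr hq)).contDiffAt).contDiffWithinAt

lemma differentiableAt_comp_retr {Φ : ℝ × S2 → X} (hΦ : ContMDiff IData 𝓘(ℝ, X) ∞ Φ)
    {q : ℝ × E3} (hq : q ∈ punctured) : DifferentiableAt ℝ (fun q => Φ (retr q)) q :=
  ((contDiffOn_comp_retr hΦ).contDiffAt (isOpen_punctured.mem_nhds hq)).differentiableAt (by simp)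

/-- The differential of the retraction `retr`. -/
def retrVec (q : ℝ × E3) (v : ℝ × E3) : TangentSpace IData (retr q) :=
  mfderiv 𝓘(ℝ, ℝ × E3) IData retr q v

lemma fderiv_comp_retr {Φ : ℝ × S2 → X} (hΦ : ContMDiff IData 𝓘(ℝ, X) ∞ Φ) {q : ℝ × E3}
    (hq : q ∈ punctured) (v : ℝ × E3) :
    fderiv ℝ (fun q => Φ (retr q)) q v = mvfderiv IData Φ (retr q) (retrVec q v) := by
  have h := mfderiv_comp_apply (I := 𝓘(ℝ, ℝ × E3)) (I' := IData) (I'' := 𝓘(ℝ, X)) q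
    (hΦ.mdifferentiableAt (by simp) : MDifferentiableAt IData 𝓘(ℝ, X) Φ (retr q))
    ((contMDiffAt_retr hq).mdifferentiableAt (by simp)) v
  rw [← mfderiv_eq_fderiv]
  exact h

end

section

/-! ## The metric and its Christoffel symbols in terms of radial and angular parts -/

/-- The radial component `dr(u)` of a vector `u` at the point `x` of `ℝ³`. -/
def radial (x u : E3) : ℝ := ⟪x, u⟫ / ‖x‖

/-- The inner product of the angular parts of the vectors `u` and `v` at the point `x` of `ℝ³`. -/
def angular (x u v : E3) : ℝ := ⟪u, v⟫ - radial x u * radial x v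

lemma metric_eq (M Λ : ℝ) (p u v : ℝ × E3) : metric M Λ p u v =
    -V M Λ ‖p.2‖ * (u.1 * v.1) + (V M Λ ‖p.2‖)⁻¹ * radial p.2 u.2 * radial p.2 v.2
      + angular p.2 u.2 v.2 := rfl

lemma angular_comm (x u v : E3) : angular x u v = angular x v u := by
  unfold angular; rw [real_inner_comm, mul_comm (radial x u)]

lemma metric_comm (M Λ : ℝ) (p u v : ℝ × E3) : metric M Λ p u v = metric M Λ p v u := by
  rw [metric_eq, metric_eq, angular_comm]; ring

lemma hasDerivAt_norm {c : ℝ → E3} {c' : E3} {s : ℝ} (hc : HasDerivAt c c' s) (h0 : c s ≠ 0) :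
    HasDerivAt (fun s => ‖c s‖) (radial (c s) c') s := by
  have h1 := hc.norm_sq.sqrt (pow_ne_zero 2 (norm_ne_zero_iff.2 h0))
  simp only [Real.sqrt_sq (norm_nonneg _)] at h1
  convert! h1 using 1
  unfold radial
  have := norm_ne_zero_iff.2 h0
  field_simp

lemma hasDerivAt_radial {c v : ℝ → E3} {c' v' : E3} {s : ℝ} (hc : HasDerivAt c c' s)
    (hv : HasDerivAt v v' s) (h0 : c s ≠ 0) :
    HasDerivAt (fun s => radial (c s) (v s))
      (angular (c s) c' (v s) / ‖c s‖ + radial (c s) v') s := by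
  have hn := norm_ne_zero_iff.2 h0
  convert! (hc.inner ℝ hv).div (hasDerivAt_norm hc h0) hn using 1
  unfold angular radial
  field_simp
  ring

lemma fderiv_apply_of_line {E X : Type*} [NormedAddCommGroup E] [NormedSpace ℝ E]
    [NormedAddCommGroup X] [NormedSpace ℝ X] {f : E → X} {p u : E} {f' : X}
    (hf : DifferentiableAt ℝ f p) (h : HasDerivAt (fun s : ℝ => f (p + s • u)) f' 0) :
    fderiv ℝ f p u = f' := by
  have hline : HasDerivAt (fun s : ℝ => p + s • u) u 0 := by
    simpa using ((hasDerivAt_id (0 : ℝ)).smul_const u).const_add p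
  have hf' : HasFDerivAt f (fderiv ℝ f p) (p + (0 : ℝ) • u) := by
    simpa using hf.hasFDerivAt
  exact (hf'.comp_hasDerivAt 0 hline).unique h

lemma hasDerivAt_line_snd (p u : ℝ × E3) : HasDerivAt (fun s : ℝ => (p + s • u).2) u.2 0 := by
  have : HasDerivAt (fun s : ℝ => p.2 + s • u.2) u.2 0 := by
    simpa using ((hasDerivAt_id (0 : ℝ)).smul_const u.2).const_add p.2
  exact this

lemma hasDerivAt_line_fst (p u : ℝ × E3) : HasDerivAt (fun s : ℝ => (p + s • u).1) u.1 0 := by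
  have : HasDerivAt (fun s : ℝ => p.1 + s * u.1) u.1 0 := by
    simpa using ((hasDerivAt_id (0 : ℝ)).mul_const u.1).const_add p.1
  exact this

lemma fderiv_metric {M Λ : ℝ} {p : ℝ × E3} (hp : p.2 ≠ 0) (hV : V M Λ ‖p.2‖ ≠ 0)
    (u v w : ℝ × E3) :
    fderiv ℝ (fun q => metric M Λ q v w) p u =
      -dV M Λ ‖p.2‖ * radial p.2 u.2 * (v.1 * w.1)
      - dV M Λ ‖p.2‖ / V M Λ ‖p.2‖ ^ 2 * radial p.2 u.2 * radial p.2 v.2 * radial p.2 w.2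
      + ((V M Λ ‖p.2‖)⁻¹ - 1) * (angular p.2 u.2 v.2 * radial p.2 w.2
          + angular p.2 u.2 w.2 * radial p.2 v.2) / ‖p.2‖ := by
  have hn := norm_ne_zero_iff.2 hp
  have h2 := hasDerivAt_line_snd p u
  have h0 : (p + (0 : ℝ) • u).2 ≠ 0 := by simpa using hp
  have hN := hasDerivAt_norm h2 h0
  have hrad : ∀ v : E3, HasDerivAt (fun s : ℝ => radial (p + s • u).2 v)
      (angular p.2 u.2 v / ‖p.2‖) 0 := fun v => by
    have := hasDerivAt_radial h2 (hasDerivAt_const (0 : ℝ) v) h0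
    simpa [radial] using this
  simp only [zero_smul, add_zero] at hN h0
  have hVd : HasDerivAt (fun s : ℝ => V M Λ ‖(p + s • u).2‖)
      (dV M Λ ‖p.2‖ * radial p.2 u.2) 0 := by
    have : HasDerivAt (V M Λ) (dV M Λ ‖p.2‖) ‖(p + (0 : ℝ) • u).2‖ := by
      simpa using hasDerivAt_V M Λ hn
    exact this.comp (0 : ℝ) hN
  have hV0 : V M Λ ‖(p + (0 : ℝ) • u).2‖ ≠ 0 := by simpa using hV
  refine fderiv_apply_of_line ?_ ?_
  · have hd : DifferentiableAt ℝ (fun q : ℝ × E3 => ‖q.2‖) p := differentiableAt_snd.norm ℝ hp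
    have hVdiff : DifferentiableAt ℝ (fun q : ℝ × E3 => V M Λ ‖q.2‖) p :=
      DifferentiableAt.comp (g := V M Λ) p (hasDerivAt_V M Λ hn).differentiableAt hd
    have hr : ∀ v : E3, DifferentiableAt ℝ (fun q : ℝ × E3 => ⟪q.2, v⟫ / ‖q.2‖) p := fun v => by
      simp only [div_eq_mul_inv]
      exact (differentiableAt_snd.inner ℝ (differentiableAt_const v)).mul (hd.inv hn)
    unfold metric
    exact ((hVdiff.neg.mul_const _).add (((hVdiff.inv hV).mul (hr _)).mul (hr _))).add
      (((differentiableAt_const _)).sub ((hr _).mul (hr _)))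
  · have := ((hVd.neg.mul_const (v.1 * w.1)).add
      (((hVd.inv hV0).mul (hrad v.2)).mul (hrad w.2))).add
      ((hasDerivAt_const (0 : ℝ) ⟪v.2, w.2⟫).sub ((hrad v.2).mul (hrad w.2)))
    convert! this using 1
    simp only [zero_smul, add_zero]
    simp only [Pi.inv_apply, Pi.mul_apply, zero_smul, add_zero]
    field_simp
    ring

lemma christoffel_eq {M Λ : ℝ} {p : ℝ × E3} (hp : p.2 ≠ 0) (hV : V M Λ ‖p.2‖ ≠ 0)
    (u v w : ℝ × E3) :
    christoffel M Λ p u v w =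
      -dV M Λ ‖p.2‖ / 2 * (radial p.2 u.2 * (v.1 * w.1) + radial p.2 v.2 * (u.1 * w.1)
        - radial p.2 w.2 * (u.1 * v.1))
      - dV M Λ ‖p.2‖ / (2 * V M Λ ‖p.2‖ ^ 2)
        * (radial p.2 u.2 * radial p.2 v.2 * radial p.2 w.2)
      + ((V M Λ ‖p.2‖)⁻¹ - 1) * (angular p.2 u.2 v.2 / ‖p.2‖) * radial p.2 w.2 := by
  unfold christoffel
  rw [fderiv_metric hp hV, fderiv_metric hp hV, fderiv_metric hp hV, angular_comm p.2 v.2 u.2,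
    angular_comm p.2 w.2 u.2, angular_comm p.2 w.2 v.2]
  field_simp
  ring

/-! ## The reference embedding -/

/-- The parameters of compact spherically symmetric CMC data together with their radius function. -/
structure Profile (M Λ K C a b : ℝ) (r : ℝ → ℝ) : Prop where
  Λ_pos : 0 < Λ
  subextremal : Subextremal M Λ
  K_pos : 0 < K
  well : IsWell M Λ K C a b
  horizon_lt : horizon M Λ < a
  radius : IsRadius M Λ K C a r

/-- The function `t = ∫ (-V)⁻¹ (K r / 3 - C / r²) dl` of the spherically symmetric embedding. -/
def height (M Λ K C : ℝ) (r : ℝ → ℝ) (l : ℝ) : ℝ :=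
  ∫ s in (0 : ℝ)..l, drift K C (r s) / -V M Λ (r s)

/-- The slope of `height`. -/
def slope (M Λ K C : ℝ) (r : ℝ → ℝ) (l : ℝ) : ℝ := drift K C (r l) / -V M Λ (r l)

namespace Profile

variable {M Λ K C a b : ℝ} {r : ℝ → ℝ}

lemma horizon_lt_r (h : Profile M Λ K C a b r) (l : ℝ) : horizon M Λ < r l :=
  h.horizon_lt.trans_le (h.radius.mem_Icc h.well l).1

lemma V_neg (h : Profile M Λ K C a b r) (l : ℝ) : V M Λ (r l) < 0 :=
  KottlerCMC.V_neg h.Λ_pos h.subextremal (h.horizon_lt_r l)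

lemma drift_pos (h : Profile M Λ K C a b r) (l : ℝ) : 0 < drift K C (r l) :=
  KottlerCMC.drift_pos h.Λ_pos h.subextremal h.K_pos h.well h.horizon_lt
    (h.radius.mem_Icc h.well l)

lemma slope_pos (h : Profile M Λ K C a b r) (l : ℝ) : 0 < slope M Λ K C r l :=
  div_pos (h.drift_pos l) (neg_pos.2 (h.V_neg l))

lemma contDiff_V (h : Profile M Λ K C a b r) : ContDiff ℝ ∞ fun l => V M Λ (r l) := by
  have h1 := h.radius.smooth
  have h2 : ∀ l, r l ≠ 0 := fun l => (h.radius.pos l).ne'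
  unfold V
  fun_prop (disch := assumption)

lemma contDiff_drift (h : Profile M Λ K C a b r) : ContDiff ℝ ∞ fun l => drift K C (r l) := by
  have h1 := h.radius.smooth
  have h2 : ∀ l, r l ^ 2 ≠ 0 := fun l => pow_ne_zero 2 (h.radius.pos l).ne'
  unfold drift
  fun_prop (disch := assumption)

lemma contDiff_slope (h : Profile M Λ K C a b r) : ContDiff ℝ ∞ (slope M Λ K C r) :=
  h.contDiff_drift.div h.contDiff_V.neg fun l => (neg_pos.2 (h.V_neg l)).ne'

lemma hasDerivAt_height (h : Profile M Λ K C a b r) (l : ℝ) :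
    HasDerivAt (height M Λ K C r) (slope M Λ K C r l) l :=
  (h.contDiff_slope.continuous.integral_hasStrictDerivAt 0 l).hasDerivAt

lemma contDiff_height (h : Profile M Λ K C a b r) : ContDiff ℝ ∞ (height M Λ K C r) := by
  rw [contDiff_infty_iff_deriv]
  refine ⟨fun l => (h.hasDerivAt_height l).differentiableAt, ?_⟩
  rw [show deriv (height M Λ K C r) = slope M Λ K C r from
    funext fun l => (h.hasDerivAt_height l).deriv]
  exact h.contDiff_slope

end Profile

/-- The spherically symmetric map `(l, x) ↦ (height l, r(l) x)`. -/
def refMap (M Λ K C : ℝ) (r : ℝ → ℝ) (q : ℝ × E3) : ℝ × E3 :=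
  (height M Λ K C r q.1, r q.1 • q.2)

/-- The future unit normal of the map `refMap`. -/
def refNormal (M Λ K C : ℝ) (r : ℝ → ℝ) (q : ℝ × E3) : ℝ × E3 :=
  (deriv r q.1 / -V M Λ (r q.1), drift K C (r q.1) • q.2)

lemma radial_smul_add {z v : E3} {ρ : ℝ} (hρ : 0 < ρ) (hz : ‖z‖ = 1) (hv : ⟪z, v⟫ = 0) (α : ℝ) :
    radial (ρ • z) (α • z + v) = α := by
  unfold radial
  rw [inner_smul_left, inner_add_right, hv, inner_smul_right, real_inner_self_eq_norm_sq, hz,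
    norm_smul, hz, Real.norm_of_nonneg hρ.le]
  simp
  field_simp

lemma angular_smul_add {z v v' : E3} {ρ : ℝ} (hρ : 0 < ρ) (hz : ‖z‖ = 1) (hv : ⟪z, v⟫ = 0)
    (hv' : ⟪z, v'⟫ = 0) (α α' : ℝ) :
    angular (ρ • z) (α • z + v) (α' • z + v') = ⟪v, v'⟫ := by
  unfold angular
  rw [radial_smul_add hρ hz hv, radial_smul_add hρ hz hv', inner_add_left, inner_add_right,
    inner_add_right, inner_smul_left, inner_smul_left, inner_smul_right, inner_smul_right,
    real_inner_self_eq_norm_sq, hz, hv', real_inner_comm z v, hv]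
  simp

namespace Profile

variable {M Λ K C a b : ℝ} {r : ℝ → ℝ}

lemma contDiff_refMap (h : Profile M Λ K C a b r) : ContDiff ℝ ∞ (refMap M Λ K C r) := by
  have h1 := h.contDiff_height
  have h2 := h.radius.smooth
  unfold refMap
  fun_prop

lemma contDiff_refNormal (h : Profile M Λ K C a b r) : ContDiff ℝ ∞ (refNormal M Λ K C r) := by
  have h1 := h.contDiff_V
  have h2 := h.contDiff_drift
  have h3 := h.radius.contDiff_deriv
  have h4 : ContDiff ℝ ∞ fun l => deriv r l / -V M Λ (r l) :=
    h3.div h1.neg fun l => (neg_pos.2 (h.V_neg l)).ne'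
  unfold refNormal
  exact (h4.comp contDiff_fst).prodMk ((h2.comp contDiff_fst).smul contDiff_snd)

lemma fderiv_refMap (h : Profile M Λ K C a b r) (q v : ℝ × E3) :
    fderiv ℝ (refMap M Λ K C r) q v =
      (slope M Λ K C r q.1 * v.1, (deriv r q.1 * v.1) • q.2 + r q.1 • v.2) := by
  refine fderiv_apply_of_line (h.contDiff_refMap.differentiable (by simp) q) ?_
  have h1 := hasDerivAt_line_fst q v
  have h2 := hasDerivAt_line_snd q v
  have e1 : (q + (0 : ℝ) • v).1 = q.1 := by simp
  have hh : HasDerivAt (height M Λ K C r) (slope M Λ K C r q.1) (q + (0 : ℝ) • v).1 := by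
    rw [e1]; exact h.hasDerivAt_height q.1
  have hr : HasDerivAt r (deriv r q.1) (q + (0 : ℝ) • v).1 := by
    rw [e1]; exact h.radius.hasDerivAt q.1
  have := (hh.comp (0 : ℝ) h1).prodMk ((hr.comp (0 : ℝ) h1).smul h2)
  convert! this using 1
  simp [add_comm]

lemma fderiv_refNormal (h : Profile M Λ K C a b r) (q v : ℝ × E3) :
    fderiv ℝ (refNormal M Λ K C r) q v =
      ((dD M Λ K C (r q.1) / 2 / -V M Λ (r q.1)
          + deriv r q.1 ^ 2 * dV M Λ (r q.1) / V M Λ (r q.1) ^ 2) * v.1,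
        (ddrift K C (r q.1) * deriv r q.1 * v.1) • q.2 + drift K C (r q.1) • v.2) := by
  refine fderiv_apply_of_line (h.contDiff_refNormal.differentiable (by simp) q) ?_
  have h1 := hasDerivAt_line_fst q v
  have h2 := hasDerivAt_line_snd q v
  have e1 : (q + (0 : ℝ) • v).1 = q.1 := by simp
  have hr0 := (h.radius.pos q.1).ne'
  have hV0 := (neg_pos.2 (h.V_neg q.1)).ne'
  have hr := h.radius.hasDerivAt q.1
  have hVd : HasDerivAt (fun l => -V M Λ (r l)) (-(dV M Λ (r q.1) * deriv r q.1)) q.1 :=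
    ((hasDerivAt_V M Λ hr0).comp q.1 hr).neg
  have hN : HasDerivAt (fun l => deriv r l / -V M Λ (r l)) (dD M Λ K C (r q.1) / 2 / -V M Λ (r q.1)
          + deriv r q.1 ^ 2 * dV M Λ (r q.1) / V M Λ (r q.1) ^ 2) (q + (0 : ℝ) • v).1 := by
    rw [e1]
    convert! (h.radius.hasDerivAt_deriv h.well q.1).div hVd hV0 using 1
    have := (h.V_neg q.1).ne
    field_simp
    ring
  have hd : HasDerivAt (fun l => drift K C (r l)) (ddrift K C (r q.1) * deriv r q.1)
      (q + (0 : ℝ) • v).1 := by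
    rw [e1]
    exact (hasDerivAt_drift K C hr0).comp q.1 hr
  have := (hN.comp (0 : ℝ) h1).prodMk ((hd.comp (0 : ℝ) h1).smul h2)
  convert! this using 1
  simp [add_comm]

/-- The first fundamental form and the unit normal reduce to r'² = V + χ². For k, its eigenvalue
along dl is K/3 + 2C/r³ = χ'(r), and along the sphere it is K/3 − C/r³ = χ/r. -/
theorem induces_refMap (h : Profile M Λ K C a b r) :
    Induces M Λ K C r (fun p => refMap M Λ K C r (incl p)) := by
  have hd : ∀ (p : ℝ × S2) (Y : TangentSpace IData p),
      mvfderiv IData (fun p => refMap M Λ K C r (incl p)) p Y =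
        (slope M Λ K C r p.1 * dl p Y,
          (deriv r p.1 * dl p Y) • (p.2 : E3) + r p.1 • sphereVec p Y) := fun p Y => by
    rw [mvfderiv_comp_incl p (h.contDiff_refMap.differentiable (by simp) _), h.fderiv_refMap]
    rfl
  have hN : ∀ (p : ℝ × S2) (Y : TangentSpace IData p),
      mvfderiv IData (fun p => refNormal M Λ K C r (incl p)) p Y =
        ((dD M Λ K C (r p.1) / 2 / -V M Λ (r p.1)
          + deriv r p.1 ^ 2 * dV M Λ (r p.1) / V M Λ (r p.1) ^ 2) * dl p Y,
        (ddrift K C (r p.1) * deriv r p.1 * dl p Y) • (p.2 : E3)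
          + drift K C (r p.1) • sphereVec p Y) := fun p Y => by
    rw [mvfderiv_comp_incl p (h.contDiff_refNormal.differentiable (by simp) _),
      h.fderiv_refNormal]
    rfl
  have hpos : ∀ p : ℝ × S2, (refMap M Λ K C r (incl p)).2 = r p.1 • (p.2 : E3) := fun p => rfl
  have hnormal : ∀ p : ℝ × S2, refNormal M Λ K C r (incl p) =
      (deriv r p.1 / -V M Λ (r p.1), drift K C (r p.1) • (p.2 : E3) + 0) := fun p => by
    rw [add_zero]; rfl
  have hz : ∀ p : ℝ × S2, ‖(p.2 : E3)‖ = 1 := fun p => norm_eq_of_mem_sphere p.2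
  have hnorm : ∀ p : ℝ × S2, ‖r p.1 • (p.2 : E3)‖ = r p.1 := fun p => by
    rw [norm_smul, hz, Real.norm_of_nonneg (h.radius.pos _).le, mul_one]
  have hs : ∀ (p : ℝ × S2) (Y : TangentSpace IData p) (α : ℝ),
      ⟪(p.2 : E3), α • sphereVec p Y⟫ = 0 := fun p Y α => by
    rw [inner_smul_right, inner_sphereVec, mul_zero]
  have hode : ∀ l, deriv r l ^ 2 = V M Λ (r l) + drift K C (r l) ^ 2 := h.radius.ode
  refine ⟨fun p Y Z => ?_, fun p => refNormal M Λ K C r (incl p), ?_, fun p => ?_, fun p => ?_,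
    fun p Y => ?_, fun p Y Z => ?_⟩
  · have hV := (h.V_neg p.1).ne
    rw [hd, hd, metric_eq]
    simp only [hpos, hnorm]
    rw [radial_smul_add (h.radius.pos _) (hz p) (hs p Y _),
      radial_smul_add (h.radius.pos _) (hz p) (hs p Z _),
      angular_smul_add (h.radius.pos _) (hz p) (hs p Y _) (hs p Z _)]
    simp only [inner_smul_left, inner_smul_right, dataMetric, gS2, slope]
    simp only [conj_trivial]
    have := hode p.1
    field_simp
    linear_combination (dl p Y * dl p Z) * this
  · exact h.contDiff_refNormal.contMDiff.comp contMDiff_incl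
  · have hV := (h.V_neg p.1).ne
    beta_reduce
    rw [hnormal, metric_eq]
    simp only [hpos, hnorm]
    rw [radial_smul_add (h.radius.pos _) (hz p) (inner_zero_right _),
      angular_smul_add (h.radius.pos _) (hz p) (inner_zero_right _) (inner_zero_right _)]
    have := hode p.1
    rw [inner_zero_left]
    field_simp
    linear_combination -this
  · have h1 := h.radius.pos p.1
    have h2 := h.drift_pos p.1
    unfold IsFutureDirected
    beta_reduce
    rw [hnormal, hpos]
    simp only [add_zero, inner_smul_left, inner_smul_right, real_inner_self_eq_norm_sq, hz]
    simp only [conj_trivial]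
    positivity
  · have hV := (h.V_neg p.1).ne
    beta_reduce
    rw [hnormal, hd, metric_eq]
    simp only [hpos, hnorm]
    rw [radial_smul_add (h.radius.pos _) (hz p) (inner_zero_right _),
      radial_smul_add (h.radius.pos _) (hz p) (hs p Y _),
      angular_smul_add (h.radius.pos _) (hz p) (inner_zero_right _) (hs p Y _), slope]
    rw [inner_zero_left]
    field_simp
    ring
  · have hV := (h.V_neg p.1).ne
    have hr0 := h.radius.pos p.1
    have hp2 : (refMap M Λ K C r (incl p)).2 ≠ 0 := by
      rw [hpos, ← norm_ne_zero_iff, hnorm]; exact hr0.ne'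
    beta_reduce
    rw [christoffel_eq hp2 (by rw [hpos, hnorm]; exact hV), hd, hd, hN, hnormal, metric_eq]
    simp only [hpos, hnorm]
    rw [radial_smul_add (h.radius.pos _) (hz p) (inner_zero_right _),
      radial_smul_add (h.radius.pos _) (hz p) (hs p Y _),
      radial_smul_add (h.radius.pos _) (hz p) (hs p Y _),
      radial_smul_add (h.radius.pos _) (hz p) (hs p Z _),
      angular_smul_add (h.radius.pos _) (hz p) (hs p Y _) (hs p Z _),
      angular_smul_add (h.radius.pos _) (hz p) (hs p Y _) (inner_zero_right _)]
    simp only [inner_smul_left, inner_smul_right, dataSecond, dataMetric, gS2, slope, dD,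
      inner_zero_right]
    simp only [conj_trivial]
    have e := hode p.1
    have e1 : K / 3 * r p.1 ^ 2 - C / r p.1 = r p.1 * drift K C (r p.1) := by
      unfold drift; field_simp
    have e2 : K / 3 + C * (2 / r p.1 ^ 3) = ddrift K C (r p.1) := by
      unfold ddrift; ring
    generalize hσ : ⟪sphereVec p Y, sphereVec p Z⟫ = σ
    have e3 : K / 3 * (dl p Y * dl p Z + r p.1 ^ 2 * σ) +
        C * (2 / r p.1 ^ 3 * (dl p Y * dl p Z) - 1 / r p.1 * σ)
        = ddrift K C (r p.1) * (dl p Y * dl p Z) + r p.1 * drift K C (r p.1) * σ := by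
      rw [← e1, ← e2]; ring
    rw [e3]
    generalize drift K C (r p.1) = χ at *
    generalize ddrift K C (r p.1) = χ' at *
    generalize V M Λ (r p.1) = v at *
    generalize dV M Λ (r p.1) = v' at *
    generalize deriv r p.1 = x at *
    generalize dl p Y = y at *
    generalize dl p Z = z at *
    generalize r p.1 = ρ at *
    clear e1 e2 e3
    -- Once V is eliminated through r'² = V + χ², a rational identity in free variables remains.
    obtain rfl : v = x ^ 2 - χ ^ 2 := by linarith
    field_simp
    ring

end Profile

end

section

/-! ## Directional derivatives and the Gauss equation in a flat space -/

section Flat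

variable {E H : Type*} [NormedAddCommGroup E] [NormedSpace ℝ E] [NormedAddCommGroup H]
  [NormedSpace ℝ H]

/-- The derivative of `f` in the direction of the constant vector field `v`. -/
def dirDeriv (v : E) (f : E → H) (q : E) : H := fderiv ℝ f q v

lemma contDiffOn_dirDeriv {f : E → H} {U : Set E} (hU : IsOpen U) (hf : ContDiffOn ℝ ∞ f U)
    (v : E) : ContDiffOn ℝ ∞ (dirDeriv v f) U :=
  (hf.fderiv_of_isOpen hU (m := ∞) (by simp)).clm_apply contDiffOn_const

lemma _root_.ContDiffOn.differentiableAt_of_mem {f : E → H} {U : Set E} (hf : ContDiffOn ℝ ∞ f U)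
    (hU : IsOpen U) {q : E} (hq : q ∈ U) : DifferentiableAt ℝ f q :=
  (hf.contDiffAt (hU.mem_nhds hq)).differentiableAt (by simp)

lemma dirDeriv_congr {f g : E → H} {U : Set E} (hU : IsOpen U) (hfg : EqOn f g U) (v : E) :
    EqOn (dirDeriv v f) (dirDeriv v g) U := fun q hq => by
  have : f =ᶠ[𝓝 q] g := hfg.eventuallyEq_of_mem (hU.mem_nhds hq)
  simp only [dirDeriv, this.fderiv_eq]

lemma dirDeriv_dirDeriv {f : E → H} {U : Set E} (hU : IsOpen U) (hf : ContDiffOn ℝ ∞ f U)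
    {q : E} (hq : q ∈ U) (u v : E) :
    dirDeriv u (dirDeriv v f) q = fderiv ℝ (fderiv ℝ f) q u v := by
  have h1 : DifferentiableAt ℝ (fderiv ℝ f) q :=
    ContDiffOn.differentiableAt_of_mem (hf.fderiv_of_isOpen hU (m := ∞) (by simp)) hU hq
  unfold dirDeriv
  rw [fderiv_clm_apply h1 (differentiableAt_const v)]
  simp

lemma dirDeriv_comm {f : E → H} {U : Set E} (hU : IsOpen U) (hf : ContDiffOn ℝ ∞ f U)
    {q : E} (hq : q ∈ U) (u v : E) :
    dirDeriv u (dirDeriv v f) q = dirDeriv v (dirDeriv u f) q := by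
  rw [dirDeriv_dirDeriv hU hf hq, dirDeriv_dirDeriv hU hf hq]
  exact ((hf.contDiffAt (hU.mem_nhds hq)).isSymmSndFDerivAt
    (by simpa using WithTop.coe_le_coe.2 (le_top : (2 : ℕ∞) ≤ ⊤))) u v

lemma dirDeriv_bilin (B : H →L[ℝ] H →L[ℝ] ℝ) {f g : E → H} {q : E}
    (hf : DifferentiableAt ℝ f q) (hg : DifferentiableAt ℝ g q) (u : E) :
    dirDeriv u (fun q => B (f q) (g q)) q = B (dirDeriv u f q) (g q) + B (f q) (dirDeriv u g q) := by
  unfold dirDeriv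
  rw [B.fderiv_of_bilinear hf hg]
  simp [add_comm]

variable {B : H →L[ℝ] H →L[ℝ] ℝ} {Ψ : E → H} {U : Set E}

/-- The Koszul formula for constant fields, valid because second derivatives are symmetric. It makes
the tangential part of the second derivatives depend on the first fundamental form alone. -/
lemma koszul_flat (hB : ∀ x y, B x y = B y x) (hU : IsOpen U) (hΨ : ContDiffOn ℝ ∞ Ψ U) {q : E} (hq : q ∈ U) (u v w : E) :
    B (dirDeriv u (dirDeriv v Ψ) q) (dirDeriv w Ψ q) =
      1 / 2 * (dirDeriv u (fun q => B (dirDeriv v Ψ q) (dirDeriv w Ψ q)) q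
        + dirDeriv v (fun q => B (dirDeriv u Ψ q) (dirDeriv w Ψ q)) q
        - dirDeriv w (fun q => B (dirDeriv u Ψ q) (dirDeriv v Ψ q)) q) := by
  have hd : ∀ v, DifferentiableAt ℝ (dirDeriv v Ψ) q := fun v =>
    (contDiffOn_dirDeriv hU hΨ v).differentiableAt_of_mem hU hq
  rw [dirDeriv_bilin B (hd v) (hd w), dirDeriv_bilin B (hd u) (hd w),
    dirDeriv_bilin B (hd u) (hd v), dirDeriv_comm hU hΨ hq w u, dirDeriv_comm hU hΨ hq w v,
    dirDeriv_comm hU hΨ hq v u, hB (dirDeriv v Ψ q), hB (dirDeriv u Ψ q) (dirDeriv v _ q)]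
  ring

/-- The third derivatives cancel. By `koszul_flat` the left side depends only on the first
fundamental form, hence so does the right side: this is the Gauss equation without a curvature
tensor. -/
lemma gauss_flat (hU : IsOpen U) (hΨ : ContDiffOn ℝ ∞ Ψ U) {q : E} (hq : q ∈ U) (u v w z : E) :
    dirDeriv u (fun q => B (dirDeriv v (dirDeriv w Ψ) q) (dirDeriv z Ψ q)) q
      - dirDeriv v (fun q => B (dirDeriv u (dirDeriv w Ψ) q) (dirDeriv z Ψ q)) q =
    B (dirDeriv v (dirDeriv w Ψ) q) (dirDeriv u (dirDeriv z Ψ) q)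
      - B (dirDeriv u (dirDeriv w Ψ) q) (dirDeriv v (dirDeriv z Ψ) q) := by
  have hw := contDiffOn_dirDeriv hU hΨ w
  have hz := (contDiffOn_dirDeriv hU hΨ z).differentiableAt_of_mem hU hq
  have hd : ∀ v, DifferentiableAt ℝ (dirDeriv v (dirDeriv w Ψ)) q := fun v =>
    (contDiffOn_dirDeriv hU hw v).differentiableAt_of_mem hU hq
  rw [dirDeriv_bilin B (hd v) hz, dirDeriv_bilin B (hd u) hz, dirDeriv_comm hU hw hq u v]
  ring

/-- Maps into a flat space with the same first fundamental form have the same Christoffel symbols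
and the same Gauss curvature terms. -/
lemma eq_of_first_fundamental_form (hB : ∀ x y, B x y = B y x) (hU : IsOpen U)
    (hΨ : ContDiffOn ℝ ∞ Ψ U) {Ψ₀ : E → H} (hΨ₀ : ContDiffOn ℝ ∞ Ψ₀ U)
    (hg : ∀ q ∈ U, ∀ v w, B (dirDeriv v Ψ q) (dirDeriv w Ψ q)
      = B (dirDeriv v Ψ₀ q) (dirDeriv w Ψ₀ q)) {q : E} (hq : q ∈ U) (u v w z : E) :
    B (dirDeriv u (dirDeriv v Ψ) q) (dirDeriv w Ψ q)
        = B (dirDeriv u (dirDeriv v Ψ₀) q) (dirDeriv w Ψ₀ q) ∧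
      B (dirDeriv v (dirDeriv w Ψ) q) (dirDeriv u (dirDeriv z Ψ) q)
        - B (dirDeriv u (dirDeriv w Ψ) q) (dirDeriv v (dirDeriv z Ψ) q)
      = B (dirDeriv v (dirDeriv w Ψ₀) q) (dirDeriv u (dirDeriv z Ψ₀) q)
        - B (dirDeriv u (dirDeriv w Ψ₀) q) (dirDeriv v (dirDeriv z Ψ₀) q) := by
  have hg' : ∀ (u v w : E), EqOn (dirDeriv u (fun q => B (dirDeriv v Ψ q) (dirDeriv w Ψ q)))
      (dirDeriv u (fun q => B (dirDeriv v Ψ₀ q) (dirDeriv w Ψ₀ q))) U := fun u v w =>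
    dirDeriv_congr hU (fun q hq => hg q hq v w) u
  have hc : ∀ (u v w : E), EqOn (fun q => B (dirDeriv u (dirDeriv v Ψ) q) (dirDeriv w Ψ q))
      (fun q => B (dirDeriv u (dirDeriv v Ψ₀) q) (dirDeriv w Ψ₀ q)) U := fun u v w q hq => by
    simp only
    rw [koszul_flat hB hU hΨ hq, koszul_flat hB hU hΨ₀ hq, hg' u v w hq, hg' v u w hq, hg' w u v hq]
  refine ⟨hc u v w hq, ?_⟩
  rw [← gauss_flat hU hΨ hq, ← gauss_flat hU hΨ₀ hq, dirDeriv_congr hU (hc v w z) u hq,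
    dirDeriv_congr hU (hc u w z) v hq]

end Flat

/-! ### Second derivatives of compositions -/

section Chain

variable {E G H : Type*} [NormedAddCommGroup E] [NormedSpace ℝ E] [NormedAddCommGroup G]
  [NormedSpace ℝ G] [NormedAddCommGroup H] [NormedSpace ℝ H]

/-- The derivative along `Φ` of the push-forward by `F` of a vector field `N` along `Φ`. -/
lemma dirDeriv_pushforward {F : G → H} {Φ N : E → G} {Ω : Set G} (hΩ : IsOpen Ω)
    (hF : ContDiffOn ℝ ∞ F Ω) {q : E} (hq : Φ q ∈ Ω) (hΦ : DifferentiableAt ℝ Φ q)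
    (hN : DifferentiableAt ℝ N q) (u : E) :
    dirDeriv u (fun q => fderiv ℝ F (Φ q) (N q)) q =
      dirDeriv (dirDeriv u Φ q) (dirDeriv (N q) F) (Φ q)
        + fderiv ℝ F (Φ q) (dirDeriv u N q) := by
  have h1 : DifferentiableAt ℝ (fderiv ℝ F) (Φ q) :=
    ContDiffOn.differentiableAt_of_mem (hF.fderiv_of_isOpen hΩ (m := ∞) (by simp)) hΩ hq
  rw [dirDeriv_dirDeriv hΩ hF hq]
  have h2 := (h1.hasFDerivAt.comp q hΦ.hasFDerivAt).clm_apply hN.hasFDerivAt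
  have h3 := h2.fderiv
  unfold dirDeriv
  simp only [Function.comp_apply] at h3
  rw [h3]
  simp [add_comm]

lemma dirDeriv_comp {F : G → H} {Φ : E → G} {q : E} (hF : DifferentiableAt ℝ F (Φ q))
    (hΦ : DifferentiableAt ℝ Φ q) (u : E) :
    dirDeriv u (fun q => F (Φ q)) q = fderiv ℝ F (Φ q) (dirDeriv u Φ q) := by
  unfold dirDeriv
  have := fderiv_comp q hF hΦ
  simp only [Function.comp_def] at this
  rw [this]
  rfl

lemma dirDeriv_dirDeriv_comp {F : G → H} {Φ : E → G} {Ω : Set G} {U : Set E} (hΩ : IsOpen Ω)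
    (hF : ContDiffOn ℝ ∞ F Ω) (hU : IsOpen U) (hΦ : ContDiffOn ℝ ∞ Φ U) (hmaps : MapsTo Φ U Ω)
    {q : E} (hq : q ∈ U) (u v : E) :
    dirDeriv u (dirDeriv v (fun q => F (Φ q))) q =
      dirDeriv (dirDeriv u Φ q) (dirDeriv (dirDeriv v Φ q) F) (Φ q)
        + fderiv ℝ F (Φ q) (dirDeriv u (dirDeriv v Φ) q) := by
  rw [← dirDeriv_pushforward hΩ hF (hmaps hq) (hΦ.differentiableAt_of_mem hU hq)
    ((contDiffOn_dirDeriv hU hΦ v).differentiableAt_of_mem hU hq)]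
  refine dirDeriv_congr hU (fun q hq => ?_) u hq
  exact dirDeriv_comp (hF.differentiableAt_of_mem hΩ (hmaps hq))
    (hΦ.differentiableAt_of_mem hU hq) v

end Chain

/-- Expansion of a symmetric bilinear form in an orthogonal basis. -/
lemma bilin_eq_sum_of_orthogonal {G : Type*} [AddCommGroup G] [Module ℝ G] [FiniteDimensional ℝ G]
    {n : ℕ} (hn : Module.finrank ℝ G = n) (β : LinearMap.BilinForm ℝ G) (e : Fin n → G)
    (he : ∀ i j, i ≠ j → β (e i) (e j) = 0) (he' : ∀ i, β (e i) (e i) ≠ 0) (x y : G) :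
    β x y = ∑ i, β x (e i) * β (e i) y / β (e i) (e i) := by
  have hli : LinearIndependent ℝ e :=
    LinearMap.linearIndependent_of_isOrthoᵢ (B := β) (fun i j hij => he i j hij) he'
  let b := basisOfLinearIndependentOfCardEqFinrank' e hli (by simp [hn])
  have hb : ∀ i, b i = e i := fun i => by simp [b]
  have hx : ∀ x j, β x (e j) = b.repr x j * β (e j) (e j) := fun x j => by
    conv_lhs => rw [← b.sum_repr x]
    simp only [map_sum, map_smul, LinearMap.sum_apply, LinearMap.smul_apply, smul_eq_mul, hb]
    exact Finset.sum_eq_single j (fun i _ hij => by rw [he i j hij, mul_zero]) (by simp)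
  conv_lhs => rw [← b.sum_repr x]
  simp only [map_sum, map_smul, LinearMap.sum_apply, LinearMap.smul_apply, smul_eq_mul, hb]
  refine Finset.sum_congr rfl fun i _ => ?_
  rw [hx x i]
  have := he' i
  field_simp

end

section

/-! ## An isometric embedding of the cosmological region into a flat space -/

/-- The flat space `ℝ³ × ℝ³`, with the bilinear form `flatForm`. -/
abbrev FlatSpace : Type := ℝ × ℝ × ℝ × E3

/-- The bilinear form `-a c' - c a' + b b' + ⟪x, x'⟫` on `FlatSpace`. -/
def flatForm : FlatSpace →L[ℝ] FlatSpace →L[ℝ] ℝ :=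
  let A : FlatSpace →L[ℝ] ℝ := .fst ℝ _ _
  let B : FlatSpace →L[ℝ] ℝ := (ContinuousLinearMap.fst ℝ _ _).comp (.snd ℝ _ _)
  let C : FlatSpace →L[ℝ] ℝ := (ContinuousLinearMap.fst ℝ ℝ E3).comp
    ((ContinuousLinearMap.snd ℝ ℝ (ℝ × E3)).comp (.snd ℝ _ _))
  let X : FlatSpace →L[ℝ] E3 := (ContinuousLinearMap.snd ℝ ℝ E3).comp
    ((ContinuousLinearMap.snd ℝ ℝ (ℝ × E3)).comp (.snd ℝ _ _))
  let I : E3 →L[ℝ] E3 →L[ℝ] ℝ := innerSL ℝ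
  I.bilinearComp X X + B.smulRight B - A.smulRight C - C.smulRight A

lemma flatForm_apply (P Q : FlatSpace) : flatForm P Q =
    -(P.1 * Q.2.2.1) - P.2.2.1 * Q.1 + P.2.1 * Q.2.1 + ⟪P.2.2.2, Q.2.2.2⟫ := by
  simp only [flatForm, add_apply, sub_apply,
    ContinuousLinearMap.bilinearComp_apply, ContinuousLinearMap.smulRight_apply]
  change ⟪P.2.2.2, Q.2.2.2⟫ + P.2.1 * Q.2.1 - P.1 * Q.2.2.1 - P.2.2.1 * Q.1 = _
  ring

lemma flatForm_comm (P Q : FlatSpace) : flatForm P Q = flatForm Q P := by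
  rw [flatForm_apply, flatForm_apply, real_inner_comm]; ring

/-- The cosmological region in `ℝ × ℝ³`. -/
def exterior (M Λ : ℝ) : Set (ℝ × E3) := {p | horizon M Λ < ‖p.2‖}

lemma isOpen_exterior (M Λ : ℝ) : IsOpen (exterior M Λ) :=
  isOpen_lt continuous_const continuous_snd.norm

/-- Functions `w` and `h` of the area radius for which `flatMap w h` is an isometric embedding. -/
structure FlatProfile (M Λ : ℝ) (w h : ℝ → ℝ) : Prop where
  contDiffOn_w : ContDiffOn ℝ ∞ w (Ioi (horizon M Λ))
  contDiffOn_h : ContDiffOn ℝ ∞ h (Ioi (horizon M Λ))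
  sq : ∀ s ∈ Ioi (horizon M Λ), w s ^ 2 = -V M Λ s
  deriv_mul : ∀ s ∈ Ioi (horizon M Λ), 2 * (deriv w s * deriv h s) = 1 - (V M Λ s)⁻¹

lemma exists_antideriv {f : ℝ → ℝ} {a : ℝ} (hf : ContDiffOn ℝ ∞ f (Ioi a)) :
    ∃ F : ℝ → ℝ, ContDiffOn ℝ ∞ F (Ioi a) ∧ ∀ s ∈ Ioi a, deriv F s = f s := by
  let F : ℝ → ℝ := fun s => ∫ x in (a + 1)..s, f x
  have hF : ∀ s ∈ Ioi a, HasDerivAt F (f s) s := fun s hs => by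
    have hs' : a < s := hs
    have hsub : uIcc (a + 1) s ⊆ Ioi a := fun x hx => by
      have : min (a + 1) s ≤ x := hx.1
      exact (lt_min (by linarith) hs').trans_le this
    exact intervalIntegral.integral_hasDerivAt_right (hf.continuousOn.mono hsub).intervalIntegrable
      (hf.continuousOn.stronglyMeasurableAtFilter isOpen_Ioi s hs)
      (hf.continuousOn.continuousAt (Ioi_mem_nhds hs'))
  have hd : ∀ s ∈ Ioi a, deriv F s = f s := fun s hs => (hF s hs).deriv
  refine ⟨F, ?_, hd⟩
  rw [contDiffOn_infty_iff_deriv_of_isOpen isOpen_Ioi]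
  exact ⟨fun s hs => (hF s hs).differentiableAt.differentiableWithinAt, hf.congr hd⟩

/-- Up to sign w = √(−V) is forced. Then w' = −V'/(2w) does not vanish since V' < 0 beyond the
horizon, and h is a primitive of (1 − V⁻¹)/(2w'). -/
lemma exists_flatProfile {M Λ : ℝ} (hΛ : 0 < Λ) (hM : Subextremal M Λ) :
    ∃ w h, FlatProfile M Λ w h := by
  have h0 := horizon_pos hΛ hM
  have hne : ∀ s ∈ Ioi (horizon M Λ), s ≠ 0 := fun s hs => (h0.trans hs).ne'
  have hV : ∀ s ∈ Ioi (horizon M Λ), V M Λ s < 0 := fun s hs => V_neg hΛ hM hs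
  have hVs : ContDiffOn ℝ ∞ (V M Λ) (Ioi (horizon M Λ)) := by
    unfold V
    fun_prop (disch := assumption)
  have hdVs : ContDiffOn ℝ ∞ (dV M Λ) (Ioi (horizon M Λ)) := by
    have hne2 : ∀ s ∈ Ioi (horizon M Λ), s ^ 2 ≠ 0 := fun s hs => pow_ne_zero 2 (hne s hs)
    unfold dV
    fun_prop (disch := assumption)
  let w : ℝ → ℝ := fun s => √(-V M Λ s)
  have hw : ContDiffOn ℝ ∞ w (Ioi (horizon M Λ)) :=
    hVs.neg.sqrt fun s hs => (neg_pos.2 (hV s hs)).ne'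
  have hf : ContDiffOn ℝ ∞ (fun s => (1 - (V M Λ s)⁻¹) * w s / -dV M Λ s) (Ioi (horizon M Λ)) :=
    ((contDiffOn_const.sub (hVs.inv fun s hs => (hV s hs).ne)).mul hw).div hdVs.neg
      fun s hs => (neg_pos.2 (dV_neg hΛ hM hs)).ne'
  obtain ⟨h, hh, hh'⟩ := exists_antideriv hf
  refine ⟨w, h, hw, hh, fun s hs => Real.sq_sqrt (neg_pos.2 (hV s hs)).le, fun s hs => ?_⟩
  have hVp := neg_pos.2 (hV s hs)
  have hws : 0 < w s := Real.sqrt_pos.2 hVp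
  have hdw : deriv w s = -dV M Λ s / (2 * w s) :=
    ((hasDerivAt_V M Λ (hne s hs)).neg.sqrt hVp.ne').deriv
  rw [hdw, hh' s hs]
  have := (dV_neg hΛ hM hs).ne
  have := (hV s hs).ne
  field_simp

namespace FlatProfile

variable {M Λ : ℝ} {w h : ℝ → ℝ}

lemma hasDerivAt_of_contDiffOn {f : ℝ → ℝ} {a s : ℝ} (hf : ContDiffOn ℝ ∞ f (Ioi a))
    (hs : s ∈ Ioi a) : HasDerivAt f (deriv f s) s ∧ HasDerivAt (deriv f) (deriv (deriv f) s) s :=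
  ⟨(hf.differentiableAt_of_mem isOpen_Ioi hs).hasDerivAt,
    (((contDiffOn_infty_iff_deriv_of_isOpen isOpen_Ioi).1 hf).2.differentiableAt_of_mem
      isOpen_Ioi hs).hasDerivAt⟩

/-- The relations between the derivatives of `w`, `h` and `V`. -/
lemma relations (hΛ : 0 < Λ) (hM : Subextremal M Λ) (hp : FlatProfile M Λ w h) {s : ℝ}
    (hs : s ∈ Ioi (horizon M Λ)) :
    2 * (w s * deriv w s) = -dV M Λ s ∧
    deriv w s ^ 2 + w s * deriv (deriv w) s = -ddV M Λ s / 2 ∧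
    deriv (deriv w) s * deriv h s + deriv w s * deriv (deriv h) s
      = dV M Λ s / (2 * V M Λ s ^ 2) := by
  have hne : ∀ s ∈ Ioi (horizon M Λ), s ≠ 0 := fun s hs => ((horizon_pos hΛ hM).trans hs).ne'
  have hw := fun s hs => hasDerivAt_of_contDiffOn (s := s) hp.contDiffOn_w hs
  have hh := fun s hs => hasDerivAt_of_contDiffOn (s := s) hp.contDiffOn_h hs
  have ev : ∀ s ∈ Ioi (horizon M Λ), ∀ᶠ x in 𝓝 s, x ∈ Ioi (horizon M Λ) :=
    fun s hs => Ioi_mem_nhds hs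
  have e1 : ∀ s ∈ Ioi (horizon M Λ), 2 * (w s * deriv w s) = -dV M Λ s := fun s hs => by
    have h1 := (hw s hs).1.pow 2
    have h2 : w ^ 2 =ᶠ[𝓝 s] fun s => -V M Λ s := by
      filter_upwards [ev s hs] with x hx using hp.sq x hx
    have := (h1.congr_of_eventuallyEq h2.symm).unique (hasDerivAt_V M Λ (hne s hs)).neg
    rw [← this]; simp; ring
  refine ⟨e1 s hs, ?_, ?_⟩
  · have h1 := ((hw s hs).1.mul (hw s hs).2).const_mul 2
    have h2 : (fun s => 2 * (w * deriv w) s) =ᶠ[𝓝 s] fun s => -dV M Λ s := by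
      filter_upwards [ev s hs] with x hx using e1 x hx
    have := (h1.congr_of_eventuallyEq h2.symm).unique (hasDerivAt_dV M Λ (hne s hs)).neg
    linarith
  · have hV := (V_neg hΛ hM hs).ne
    have h1 := ((hw s hs).2.mul (hh s hs).2).const_mul 2
    have h2 : (fun s => 2 * (deriv w * deriv h) s) =ᶠ[𝓝 s] fun s => 1 - (V M Λ s)⁻¹ := by
      filter_upwards [ev s hs] with x hx using hp.deriv_mul x hx
    have := (h1.congr_of_eventuallyEq h2.symm).unique
      (((hasDerivAt_V M Λ (hne s hs)).inv hV).const_sub 1)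
    have h3 : deriv (deriv w) s * deriv h s + deriv w s * deriv (deriv h) s
      = (-(-dV M Λ s / V M Λ s ^ 2)) / 2 := by rw [← this]; ring
    rw [h3]; field_simp

end FlatProfile

/-- The isometric embedding of the cosmological region into the flat space. -/
def flatMap (w h : ℝ → ℝ) (p : ℝ × E3) : FlatSpace :=
  (w ‖p.2‖, w ‖p.2‖ * p.1, w ‖p.2‖ * p.1 ^ 2 / 2 + h ‖p.2‖, p.2)

namespace FlatProfile

variable {M Λ : ℝ} {w h : ℝ → ℝ}

lemma ne_zero_of_mem_exterior (hΛ : 0 < Λ) (hM : Subextremal M Λ) {p : ℝ × E3}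
    (hp : p ∈ exterior M Λ) : p.2 ≠ 0 :=
  norm_pos_iff.1 ((horizon_pos hΛ hM).trans hp)

lemma contDiffOn_flatMap (hΛ : 0 < Λ) (hM : Subextremal M Λ) (H : FlatProfile M Λ w h) :
    ContDiffOn ℝ ∞ (flatMap w h) (exterior M Λ) := by
  have hn : ContDiffOn ℝ ∞ (fun p : ℝ × E3 => ‖p.2‖) (exterior M Λ) :=
    contDiffOn_snd.norm ℝ fun p hp => ne_zero_of_mem_exterior hΛ hM hp
  have hw : ContDiffOn ℝ ∞ (fun p : ℝ × E3 => w ‖p.2‖) (exterior M Λ) :=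
    H.contDiffOn_w.comp hn fun p hp => hp
  have hh : ContDiffOn ℝ ∞ (fun p : ℝ × E3 => h ‖p.2‖) (exterior M Λ) :=
    H.contDiffOn_h.comp hn fun p hp => hp
  unfold flatMap
  exact hw.prodMk ((hw.mul contDiffOn_fst).prodMk
    ((((hw.mul (contDiffOn_fst.pow 2)).div_const 2).add hh).prodMk contDiffOn_snd))

lemma dirDeriv_flatMap (hΛ : 0 < Λ) (hM : Subextremal M Λ) (H : FlatProfile M Λ w h)
    {p : ℝ × E3} (hp : p ∈ exterior M Λ) (u : ℝ × E3) :
    dirDeriv u (flatMap w h) p =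
      (deriv w ‖p.2‖ * radial p.2 u.2,
        deriv w ‖p.2‖ * radial p.2 u.2 * p.1 + w ‖p.2‖ * u.1,
        deriv w ‖p.2‖ * radial p.2 u.2 * p.1 ^ 2 / 2 + w ‖p.2‖ * (p.1 * u.1)
          + deriv h ‖p.2‖ * radial p.2 u.2, u.2) := by
  have hx := ne_zero_of_mem_exterior hΛ hM hp
  refine fderiv_apply_of_line
    ((H.contDiffOn_flatMap hΛ hM).differentiableAt_of_mem (isOpen_exterior M Λ) hp) ?_
  have h1 := hasDerivAt_line_fst p u
  have h2 := hasDerivAt_line_snd p u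
  have e : p + (0 : ℝ) • u = p := by simp
  have hN := hasDerivAt_norm h2 (by rw [e]; exact hx)
  have hw : HasDerivAt (fun s : ℝ => w ‖(p + s • u).2‖) (deriv w ‖p.2‖ * radial p.2 u.2) 0 := by
    rw [e] at hN
    refine HasDerivAt.comp (h₂ := w) (0 : ℝ) ?_ hN
    rw [e]; exact (hasDerivAt_of_contDiffOn H.contDiffOn_w hp).1
  have hh : HasDerivAt (fun s : ℝ => h ‖(p + s • u).2‖) (deriv h ‖p.2‖ * radial p.2 u.2) 0 := by
    rw [e] at hN
    refine HasDerivAt.comp (h₂ := h) (0 : ℝ) ?_ hN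
    rw [e]; exact (hasDerivAt_of_contDiffOn H.contDiffOn_h hp).1
  have := hw.prodMk ((hw.mul h1).prodMk ((((hw.mul (h1.pow 2)).div_const 2).add hh).prodMk h2))
  convert! this using 1
  refine Prod.ext rfl (Prod.ext ?_ (Prod.ext ?_ rfl))
  · simp
  · simp; ring

/-- The number α is the second derivative of w(‖x‖). Naming it exhibits the dependence on t in the
pattern α, αt + β, αt²/2 + tβ + γ, which the flat form later collapses. -/
lemma dirDeriv_dirDeriv_flatMap (hΛ : 0 < Λ) (hM : Subextremal M Λ) (H : FlatProfile M Λ w h)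
    {p : ℝ × E3} (hp : p ∈ exterior M Λ) (u v : ℝ × E3) {α : ℝ}
    (hα : α = deriv (deriv w) ‖p.2‖ * (radial p.2 u.2 * radial p.2 v.2)
      + deriv w ‖p.2‖ * (angular p.2 u.2 v.2 / ‖p.2‖)) :
    dirDeriv u (dirDeriv v (flatMap w h)) p =
      (α, α * p.1 + deriv w ‖p.2‖ * (radial p.2 u.2 * v.1 + radial p.2 v.2 * u.1),
        α * p.1 ^ 2 / 2
          + p.1 * (deriv w ‖p.2‖ * (radial p.2 u.2 * v.1 + radial p.2 v.2 * u.1))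
          + (w ‖p.2‖ * (u.1 * v.1) + deriv (deriv h) ‖p.2‖ * (radial p.2 u.2 * radial p.2 v.2)
            + deriv h ‖p.2‖ * (angular p.2 u.2 v.2 / ‖p.2‖)), 0) := by
  have hx := ne_zero_of_mem_exterior hΛ hM hp
  have hΩ := isOpen_exterior M Λ
  have hcd := contDiffOn_dirDeriv hΩ (H.contDiffOn_flatMap hΛ hM) v
  have h1 := hasDerivAt_line_fst p u
  have h2 := hasDerivAt_line_snd p u
  have e : p + (0 : ℝ) • u = p := by simp
  have hx0 : (p + (0 : ℝ) • u).2 ≠ 0 := by rw [e]; exact hx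
  have hN := hasDerivAt_norm h2 hx0
  have hr := hasDerivAt_radial h2 (hasDerivAt_const (0 : ℝ) v.2) hx0
  rw [e] at hN hr
  have key : ∀ {f : ℝ → ℝ}, HasDerivAt f (deriv f ‖p.2‖) ‖p.2‖ →
      HasDerivAt (fun s : ℝ => f ‖(p + s • u).2‖) (deriv f ‖p.2‖ * radial p.2 u.2) 0 := by
    intro f hf
    refine HasDerivAt.comp (h₂ := f) (0 : ℝ) ?_ hN
    rw [e]; exact hf
  have hw := key (hasDerivAt_of_contDiffOn H.contDiffOn_w hp).1
  have hw' := key (hasDerivAt_of_contDiffOn H.contDiffOn_w hp).2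
  have hh' := key (hasDerivAt_of_contDiffOn H.contDiffOn_h hp).2
  refine fderiv_apply_of_line (hcd.differentiableAt_of_mem hΩ hp) ?_
  have hev : ∀ᶠ s : ℝ in 𝓝 0, p + s • u ∈ exterior M Λ := by
    have hc : Continuous fun s : ℝ => p + s • u := by fun_prop
    exact hc.continuousAt.eventually_mem (hΩ.mem_nhds (by simpa using hp))
  have h3 := (hw'.mul hr).prodMk ((((hw'.mul hr).mul h1).add (hw.mul_const v.1)).prodMk
    ((((((hw'.mul hr).mul (h1.pow 2)).div_const 2).add (hw.mul (h1.mul_const v.1))).add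
      (hh'.mul hr)).prodMk (hasDerivAt_const (0 : ℝ) v.2)))
  refine HasDerivAt.congr_of_eventuallyEq ?_
    (hev.mono fun s hs => H.dirDeriv_flatMap hΛ hM hs v)
  convert! h3 using 1
  subst hα
  refine Prod.ext ?_ (Prod.ext ?_ (Prod.ext ?_ rfl))
  · simp [radial]; ring
  · simp [radial]; ring
  · simp [radial]; ring

/-- In −2 da dc + db² with a = w, b = wt, c = wt²/2 + h, the terms that contain t explicitly cancel
and w² dt² − 2w'h' dr² is left. The summand |dx|² = dr² + r² g_{S²} supplies the rest. -/
lemma flatForm_dirDeriv (hΛ : 0 < Λ) (hM : Subextremal M Λ) (H : FlatProfile M Λ w h)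
    {p : ℝ × E3} (hp : p ∈ exterior M Λ) (u v : ℝ × E3) :
    flatForm (dirDeriv u (flatMap w h) p) (dirDeriv v (flatMap w h) p) = metric M Λ p u v := by
  rw [H.dirDeriv_flatMap hΛ hM hp, H.dirDeriv_flatMap hΛ hM hp, flatForm_apply, metric_eq, angular]
  have e1 := H.sq _ hp
  have e2 := H.deriv_mul _ hp
  linear_combination (u.1 * v.1) * e1 - (radial p.2 u.2 * radial p.2 v.2) * e2

lemma christoffel_eq_flatForm (hΛ : 0 < Λ) (hM : Subextremal M Λ) (H : FlatProfile M Λ w h)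
    {p : ℝ × E3} (hp : p ∈ exterior M Λ) (u v z : ℝ × E3) :
    christoffel M Λ p u v z = flatForm (dirDeriv u (dirDeriv v (flatMap w h)) p)
      (dirDeriv z (flatMap w h) p) := by
  have hΩ := isOpen_exterior M Λ
  have hg : ∀ (u v z : ℝ × E3), dirDeriv u (fun q => flatForm (dirDeriv v (flatMap w h) q)
      (dirDeriv z (flatMap w h) q)) p = fderiv ℝ (fun q => metric M Λ q v z) p u :=
    fun u v z => dirDeriv_congr (g := fun q => metric M Λ q v z) hΩ
      (fun q hq => H.flatForm_dirDeriv hΛ hM hq v z) u hp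
  rw [koszul_flat flatForm_comm hΩ (H.contDiffOn_flatMap hΛ hM) hp, hg, hg, hg, christoffel]

end FlatProfile

/-- The Levi-Civita connection of the metric: `metric (connection u v) w = christoffel u v w`. -/
def connection (M Λ : ℝ) (p u v : ℝ × E3) : ℝ × E3 :=
  (dV M Λ ‖p.2‖ / (2 * V M Λ ‖p.2‖) * (radial p.2 u.2 * v.1 + radial p.2 v.2 * u.1),
    (V M Λ ‖p.2‖ * dV M Λ ‖p.2‖ / 2 * (u.1 * v.1)
      - dV M Λ ‖p.2‖ / (2 * V M Λ ‖p.2‖) * (radial p.2 u.2 * radial p.2 v.2)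
      + (1 - V M Λ ‖p.2‖) * (angular p.2 u.2 v.2 / ‖p.2‖)) • (‖p.2‖⁻¹ • p.2))

lemma radial_unit {x : E3} (hx : x ≠ 0) (c : ℝ) : radial x (c • (‖x‖⁻¹ • x)) = c := by
  have := norm_ne_zero_iff.2 hx
  unfold radial
  rw [inner_smul_right, inner_smul_right, real_inner_self_eq_norm_sq]
  field_simp

lemma angular_unit {x : E3} (hx : x ≠ 0) (c : ℝ) (v : E3) :
    angular x (c • (‖x‖⁻¹ • x)) v = 0 := by
  have := norm_ne_zero_iff.2 hx
  unfold angular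
  rw [radial_unit hx, radial, inner_smul_left, inner_smul_left]
  simp only [conj_trivial]
  field_simp
  ring

lemma metric_connection {M Λ : ℝ} {p : ℝ × E3} (hp : p.2 ≠ 0) (hV : V M Λ ‖p.2‖ ≠ 0)
    (u v z : ℝ × E3) : metric M Λ p (connection M Λ p u v) z = christoffel M Λ p u v z := by
  rw [christoffel_eq hp hV, metric_eq]
  simp only [connection]
  rw [radial_unit hp, angular_unit hp]
  field_simp
  ring

end

section

/-! ## The curvature of the spacetime -/

/-- The part of the metric in the directions of `t` and `r`. -/
def planar (M Λ : ℝ) (p u v : ℝ × E3) : ℝ :=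
  -V M Λ ‖p.2‖ * (u.1 * v.1) + (V M Λ ‖p.2‖)⁻¹ * (radial p.2 u.2 * radial p.2 v.2)

lemma metric_eq_planar_add (M Λ : ℝ) (p u v : ℝ × E3) :
    metric M Λ p u v = planar M Λ p u v + angular p.2 u.2 v.2 := by
  rw [metric_eq, planar]; ring

/-- The curvature tensor of the spacetime, `⟨R(u, v) w, z⟩`. -/
def curvature (M Λ : ℝ) (p u v w z : ℝ × E3) : ℝ :=
  (Λ / 3 - M / ‖p.2‖ ^ 3) * (metric M Λ p v w * metric M Λ p u z
      - metric M Λ p u w * metric M Λ p v z)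
  + 3 * (M / ‖p.2‖ ^ 3) * (planar M Λ p v w * planar M Λ p u z
      - planar M Λ p u w * planar M Λ p v z
      + (angular p.2 v.2 w.2 * angular p.2 u.2 z.2 - angular p.2 u.2 w.2 * angular p.2 v.2 z.2))

/-- The second fundamental form of the flat embedding. -/
def flatSecond (M Λ : ℝ) (w h : ℝ → ℝ) (p u v : ℝ × E3) : FlatSpace :=
  dirDeriv u (dirDeriv v (flatMap w h)) p - dirDeriv (connection M Λ p u v) (flatMap w h) p

namespace FlatProfile

variable {M Λ : ℝ} {w h : ℝ → ℝ}

lemma flatSecond_normal (hΛ : 0 < Λ) (hM : Subextremal M Λ) (H : FlatProfile M Λ w h)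
    {p : ℝ × E3} (hp : p ∈ exterior M Λ) (u v z : ℝ × E3) :
    flatForm (flatSecond M Λ w h p u v) (dirDeriv z (flatMap w h) p) = 0 := by
  rw [flatSecond, map_sub, sub_apply,
    ← H.christoffel_eq_flatForm hΛ hM hp, H.flatForm_dirDeriv hΛ hM hp,
    metric_connection (ne_zero_of_mem_exterior hΛ hM hp) (V_neg hΛ hM hp).ne, sub_self]

/-- The last two terms are symmetric in all four vectors and drop out of the antisymmetrization in
the Gauss equation. This is why w''h'' may remain unevaluated. -/
lemma flatForm_flatSecond (hΛ : 0 < Λ) (hM : Subextremal M Λ) (H : FlatProfile M Λ w h)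
    {p : ℝ × E3} (hp : p ∈ exterior M Λ) (u v u' v' : ℝ × E3) :
    flatForm (flatSecond M Λ w h p u v) (flatSecond M Λ w h p u' v') =
      ddV M Λ ‖p.2‖ / 2 * (radial p.2 u.2 * radial p.2 v.2 * (u'.1 * v'.1)
        + radial p.2 u'.2 * radial p.2 v'.2 * (u.1 * v.1))
      - dV M Λ ‖p.2‖ / (2 * ‖p.2‖) * (planar M Λ p u v * angular p.2 u'.2 v'.2
        + angular p.2 u.2 v.2 * planar M Λ p u' v')
      + (1 - V M Λ ‖p.2‖) / ‖p.2‖ ^ 2 * (angular p.2 u.2 v.2 * angular p.2 u'.2 v'.2)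
      - (dV M Λ ‖p.2‖ ^ 2 / (4 * V M Λ ‖p.2‖ ^ 3)
          + 2 * (deriv (deriv w) ‖p.2‖ * deriv (deriv h) ‖p.2‖))
        * (radial p.2 u.2 * radial p.2 v.2 * (radial p.2 u'.2 * radial p.2 v'.2))
      - V M Λ ‖p.2‖ * dV M Λ ‖p.2‖ ^ 2 / 4 * (u.1 * v.1 * (u'.1 * v'.1)) := by
  have hx := ne_zero_of_mem_exterior hΛ hM hp
  have hρ := norm_ne_zero_iff.2 hx
  have hV := (V_neg hΛ hM hp).ne
  -- Pythagoras: `flatSecond` is normal to the image of the spacetime, so its products are those of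
  -- the second derivatives minus those of their tangential parts.
  have h1 : flatForm (flatSecond M Λ w h p u v) (flatSecond M Λ w h p u' v') =
      flatForm (dirDeriv u (dirDeriv v (flatMap w h)) p)
        (dirDeriv u' (dirDeriv v' (flatMap w h)) p)
      - metric M Λ p (connection M Λ p u v) (connection M Λ p u' v') := by
    have h2 := H.flatSecond_normal hΛ hM hp u v (connection M Λ p u' v')
    have h3 := H.flatSecond_normal hΛ hM hp u' v' (connection M Λ p u v)
    rw [flatForm_comm] at h3
    have h4 := H.flatForm_dirDeriv hΛ hM hp (connection M Λ p u v) (connection M Λ p u' v')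
    simp only [flatSecond, map_sub, sub_apply] at h2 h3 ⊢
    linarith
  obtain ⟨r1, r2, r3⟩ := H.relations hΛ hM hp
  have r0 := H.sq _ hp
  have r4 := H.deriv_mul _ hp
  rw [h1, H.dirDeriv_dirDeriv_flatMap hΛ hM hp u v rfl,
    H.dirDeriv_dirDeriv_flatMap hΛ hM hp u' v' rfl, metric_eq]
  simp only [connection]
  rw [radial_unit hx, radial_unit hx, angular_unit hx, flatForm_apply, planar, planar]
  simp only [inner_zero_left]
  generalize angular p.2 u.2 v.2 = q
  generalize angular p.2 u'.2 v'.2 = q'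
  generalize radial p.2 u.2 = a
  generalize radial p.2 v.2 = b
  generalize radial p.2 u'.2 = a'
  generalize radial p.2 v'.2 = b'
  have r5 : deriv w ‖p.2‖ ^ 2 = -dV M Λ ‖p.2‖ ^ 2 / (4 * V M Λ ‖p.2‖) := by
    rw [eq_div_iff (mul_ne_zero four_ne_zero hV)]
    linear_combination (-2 * (w ‖p.2‖ * deriv w ‖p.2‖) + dV M Λ ‖p.2‖) * r1
      + 4 * deriv w ‖p.2‖ ^ 2 * r0
  have r6 : w ‖p.2‖ * deriv (deriv w) ‖p.2‖
      = -ddV M Λ ‖p.2‖ / 2 + dV M Λ ‖p.2‖ ^ 2 / (4 * V M Λ ‖p.2‖) := by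
    linear_combination r2 - r5
  generalize deriv (deriv w) ‖p.2‖ = w2 at *
  generalize deriv (deriv h) ‖p.2‖ = h2 at *
  generalize deriv w ‖p.2‖ = w1 at *
  generalize deriv h ‖p.2‖ = k1 at *
  generalize w ‖p.2‖ = w0 at *
  generalize V M Λ ‖p.2‖ = W at *
  generalize dV M Λ ‖p.2‖ = W1 at *
  generalize ddV M Λ ‖p.2‖ = W2 at *
  generalize ‖p.2‖ = ρ at *
  -- The flat form is invariant under the null rotation (α, β, γ) ↦ (α, αt + β, αt²/2 + tβ + γ), so
  -- t disappears.
  have expand : ∀ α α' β β' γ γ' : ℝ,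
      -(α * (α' * p.1 ^ 2 / 2 + p.1 * β' + γ')) - (α * p.1 ^ 2 / 2 + p.1 * β + γ) * α'
        + (α * p.1 + β) * (α' * p.1 + β') + 0 = -(α * γ') - γ * α' + β * β' := by
    intros; ring
  rw [expand]
  have e : -((w2 * (a * b) + w1 * (q / ρ)) * (w0 * (u'.1 * v'.1) + h2 * (a' * b') + k1 * (q' / ρ)))
      - (w0 * (u.1 * v.1) + h2 * (a * b) + k1 * (q / ρ)) * (w2 * (a' * b') + w1 * (q' / ρ))
      + w1 * (a * v.1 + b * u.1) * (w1 * (a' * v'.1 + b' * u'.1)) =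
      -(-W2 / 2 + W1 ^ 2 / (4 * W)) * (a * b * (u'.1 * v'.1) + a' * b' * (u.1 * v.1))
      - 2 * (w2 * h2) * (a * b * (a' * b'))
      - W1 / (2 * W ^ 2) * (a * b * (q' / ρ) + q / ρ * (a' * b'))
      + W1 / 2 * (q / ρ * (u'.1 * v'.1) + q' / ρ * (u.1 * v.1))
      - (1 - W⁻¹) * (q / ρ * (q' / ρ))
      + -W1 ^ 2 / (4 * W) * ((a * v.1 + b * u.1) * (a' * v'.1 + b' * u'.1)) := by
    linear_combination -(a * b * (u'.1 * v'.1) + a' * b' * (u.1 * v.1)) * r6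
      - (a * b * (q' / ρ) + q / ρ * (a' * b')) * r3
      - (q / ρ * (u'.1 * v'.1) + q' / ρ * (u.1 * v.1)) / 2 * r1
      - (q / ρ * (q' / ρ)) * r4
      + ((a * v.1 + b * u.1) * (a' * v'.1 + b' * u'.1)) * r5
  rw [e]
  field_simp
  ring

/-- The Gauss equation of the flat embedding. -/
lemma flatForm_flatSecond_antisymm (hΛ : 0 < Λ) (hM : Subextremal M Λ) (H : FlatProfile M Λ w h)
    {p : ℝ × E3} (hp : p ∈ exterior M Λ) (u v y z : ℝ × E3) :
    flatForm (flatSecond M Λ w h p v y) (flatSecond M Λ w h p u z)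
      - flatForm (flatSecond M Λ w h p u y) (flatSecond M Λ w h p v z)
    = curvature M Λ p u v y z := by
  have hρ := norm_ne_zero_iff.2 (ne_zero_of_mem_exterior hΛ hM hp)
  have hV := (V_neg hΛ hM hp).ne
  rw [H.flatForm_flatSecond hΛ hM hp, H.flatForm_flatSecond hΛ hM hp, curvature]
  simp only [metric_eq_planar_add]
  -- Here the explicit form of V enters: the coefficients of the planar, mixed and angular terms are
  -- all combinations of M/r³ and Λ/3.
  have e1 : ddV M Λ ‖p.2‖ / 2 = -(2 * (M / ‖p.2‖ ^ 3) + Λ / 3) := by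
    unfold ddV; field_simp; ring
  have e2 : dV M Λ ‖p.2‖ / (2 * ‖p.2‖) = M / ‖p.2‖ ^ 3 - Λ / 3 := by
    unfold dV; field_simp
  have e3 : (1 - V M Λ ‖p.2‖) / ‖p.2‖ ^ 2 = 2 * (M / ‖p.2‖ ^ 3) + Λ / 3 := by
    unfold V; field_simp; ring
  rw [e1, e2, e3]
  -- The metric of the (t, r)-plane has determinant −V · V⁻¹ = −1, so the 2 × 2 Gram determinant is
  -- minus a product of minors.
  have e4 : ∀ a b c d : ℝ × E3, planar M Λ p a b * planar M Λ p c d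
      - planar M Λ p c b * planar M Λ p a d =
      -(radial p.2 a.2 * radial p.2 b.2 * (c.1 * d.1) + radial p.2 c.2 * radial p.2 d.2
        * (a.1 * b.1) - (radial p.2 c.2 * radial p.2 b.2 * (a.1 * d.1)
        + radial p.2 a.2 * radial p.2 d.2 * (c.1 * b.1))) := by
    intro a b c d
    unfold planar
    field_simp
    ring
  have := e4 v y u z
  linear_combination (-(2 * (M / ‖p.2‖ ^ 3) + Λ / 3)) * this

end FlatProfile

end

section

/-! ## The Gauss equation of a hypersurface -/

lemma radial_add (x u v : E3) : radial x (u + v) = radial x u + radial x v := by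
  unfold radial; rw [inner_add_right, add_div]

lemma radial_smul (x : E3) (c : ℝ) (u : E3) : radial x (c • u) = c * radial x u := by
  unfold radial; rw [inner_smul_right, mul_div_assoc]

/-- The spacetime metric as a bilinear form. -/
def metricForm (M Λ : ℝ) (p : ℝ × E3) : LinearMap.BilinForm ℝ (ℝ × E3) :=
  LinearMap.mk₂ ℝ (metric M Λ p)
    (fun u u' v => by
      simp only [metric_eq, angular, Prod.fst_add, Prod.snd_add, radial_add, inner_add_left]; ring)
    (fun c u v => by
      simp only [metric_eq, angular, Prod.smul_fst, Prod.smul_snd, radial_smul, inner_smul_left,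
        smul_eq_mul, conj_trivial]; ring)
    (fun u v v' => by
      simp only [metric_eq, angular, Prod.fst_add, Prod.snd_add, radial_add, inner_add_right]; ring)
    (fun c u v => by
      simp only [metric_eq, angular, Prod.smul_fst, Prod.smul_snd, radial_smul, inner_smul_right,
        smul_eq_mul]; ring)

lemma metricForm_apply (M Λ : ℝ) (p u v : ℝ × E3) : metricForm M Λ p u v = metric M Λ p u v := rfl

/-- Parseval's identity for a Lorentzian orthonormal frame. -/
lemma metric_eq_sum_frame {M Λ : ℝ} {p n : ℝ × E3} {e : Fin 3 → ℝ × E3}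
    (he : ∀ i j, metric M Λ p (e i) (e j) = if i = j then 1 else 0)
    (hn : metric M Λ p n n = -1) (hne : ∀ i, metric M Λ p n (e i) = 0) (x y : ℝ × E3) :
    metric M Λ p x y = ∑ i, metric M Λ p x (e i) * metric M Λ p y (e i)
      - metric M Λ p x n * metric M Λ p y n := by
  let f : Fin 4 → ℝ × E3 := Fin.snoc e n
  have h1 : ∀ i : Fin 3, f i.castSucc = e i := fun i => by simp [f]
  have h2 : f (Fin.last 3) = n := Fin.snoc_last (α := fun _ => ℝ × E3) n e
  have hor : ∀ i j, i ≠ j → metricForm M Λ p (f i) (f j) = 0 := by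
    intro i j hij
    simp only [metricForm_apply]
    refine Fin.lastCases (motive := fun i => i ≠ j → metric M Λ p (f i) (f j) = 0) ?_ ?_ i hij
    · refine Fin.lastCases (fun h => absurd rfl h) (fun j _ => ?_) j
      rw [h1, h2, hne]
    · intro i
      refine Fin.lastCases (fun _ => ?_) (fun j h => ?_) j
      · rw [h1, h2, metric_comm, hne]
      · rw [h1, h1, he, if_neg fun h' => h (by rw [h'])]
  have hne' : ∀ i, metricForm M Λ p (f i) (f i) ≠ 0 := by
    intro i
    simp only [metricForm_apply]
    refine Fin.lastCases ?_ (fun i => ?_) i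
    · rw [h2, hn]; norm_num
    · rw [h1, he]; simp
  have hfin : Module.finrank ℝ (ℝ × E3) = 4 := by simp
  have := bilin_eq_sum_of_orthogonal hfin (metricForm M Λ p) f hor hne' x y
  simp only [metricForm_apply] at this
  rw [this, Fin.sum_univ_castSucc]
  simp only [h1, h2, hn, he, if_true, metric_comm M Λ p (e _) y, metric_comm M Λ p n y]
  simp only [div_one]
  ring

/-- `Φ` is a spacelike hypersurface with unit normal `N`, first fundamental form `g` and second
fundamental form `k`, defined on the open set `U`. -/
structure IsHypersurface {E : Type*} [NormedAddCommGroup E] [NormedSpace ℝ E] (M Λ : ℝ)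
    (U : Set E) (g k : E → E → E → ℝ) (Φ N : E → ℝ × E3) : Prop where
  contDiffOn : ContDiffOn ℝ ∞ Φ U
  contDiffOn_normal : ContDiffOn ℝ ∞ N U
  mapsTo : MapsTo Φ U (exterior M Λ)
  first : ∀ q ∈ U, ∀ u v, metric M Λ (Φ q) (dirDeriv u Φ q) (dirDeriv v Φ q) = g q u v
  unit : ∀ q ∈ U, metric M Λ (Φ q) (N q) (N q) = -1
  normal : ∀ q ∈ U, ∀ v, metric M Λ (Φ q) (N q) (dirDeriv v Φ q) = 0
  second : ∀ q ∈ U, ∀ u v, metric M Λ (Φ q) (dirDeriv u N q) (dirDeriv v Φ q)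
    + christoffel M Λ (Φ q) (dirDeriv u Φ q) (N q) (dirDeriv v Φ q) = k q u v

namespace IsHypersurface

variable {E : Type*} [NormedAddCommGroup E] [NormedSpace ℝ E] {M Λ : ℝ} {U : Set E}
  {g k : E → E → E → ℝ} {Φ N : E → ℝ × E3} {w h : ℝ → ℝ}

lemma contDiffOn_flatMap_comp (hΛ : 0 < Λ) (hM : Subextremal M Λ) (F : FlatProfile M Λ w h)
    (S : IsHypersurface M Λ U g k Φ N) : ContDiffOn ℝ ∞ (fun q => flatMap w h (Φ q)) U :=
  (F.contDiffOn_flatMap hΛ hM).comp S.contDiffOn S.mapsTo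

lemma dirDeriv_flatMap_comp (hΛ : 0 < Λ) (hM : Subextremal M Λ) (F : FlatProfile M Λ w h)
    (hU : IsOpen U) (S : IsHypersurface M Λ U g k Φ N) {q : E} (hq : q ∈ U) (u : E) :
    dirDeriv u (fun q => flatMap w h (Φ q)) q = dirDeriv (dirDeriv u Φ q) (flatMap w h) (Φ q) :=
  dirDeriv_comp ((F.contDiffOn_flatMap hΛ hM).differentiableAt_of_mem (isOpen_exterior M Λ)
    (S.mapsTo hq)) (S.contDiffOn.differentiableAt_of_mem hU hq) u

lemma flatForm_first (hΛ : 0 < Λ) (hM : Subextremal M Λ) (F : FlatProfile M Λ w h)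
    (hU : IsOpen U) (S : IsHypersurface M Λ U g k Φ N) {q : E} (hq : q ∈ U) (u v : E) :
    flatForm (dirDeriv u (fun q => flatMap w h (Φ q)) q)
      (dirDeriv v (fun q => flatMap w h (Φ q)) q) = g q u v := by
  rw [S.dirDeriv_flatMap_comp hΛ hM F hU hq, S.dirDeriv_flatMap_comp hΛ hM F hU hq,
    F.flatForm_dirDeriv hΛ hM (S.mapsTo hq), S.first q hq]

/-- Differentiate the orthogonality of the pushed-forward normal ν and ∂_vΨ, where Ψ is the flat
image. The product of ∂_uν with ∂_vΨ is k, because the flat embedding reproduces the Christoffel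
symbols. -/
lemma flatForm_second (hΛ : 0 < Λ) (hM : Subextremal M Λ) (F : FlatProfile M Λ w h)
    (hU : IsOpen U) (S : IsHypersurface M Λ U g k Φ N) {q : E} (hq : q ∈ U) (u v : E) :
    flatForm (dirDeriv u (dirDeriv v (fun q => flatMap w h (Φ q))) q)
      (dirDeriv (N q) (flatMap w h) (Φ q)) = -k q u v := by
  have hΩ := isOpen_exterior M Λ
  have hF := F.contDiffOn_flatMap hΛ hM
  have hΨ := S.contDiffOn_flatMap_comp hΛ hM F
  let ν : E → FlatSpace := fun q => fderiv ℝ (flatMap w h) (Φ q) (N q)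
  have hν : ContDiffOn ℝ ∞ ν U :=
    (((hF.fderiv_of_isOpen hΩ (m := ∞) (by simp)).comp S.contDiffOn S.mapsTo).clm_apply
      S.contDiffOn_normal)
  have h1 := dirDeriv_bilin flatForm (hν.differentiableAt_of_mem hU hq)
    ((contDiffOn_dirDeriv hU hΨ v).differentiableAt_of_mem hU hq) u
  have h2 : dirDeriv u (fun q => flatForm (ν q) (dirDeriv v (fun q => flatMap w h (Φ q)) q)) q
      = 0 := by
    have h3 : EqOn (fun q => flatForm (ν q) (dirDeriv v (fun q => flatMap w h (Φ q)) q))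
        (fun _ => 0) U := fun x hx => by
      simp only
      rw [S.dirDeriv_flatMap_comp hΛ hM F hU hx]
      exact (F.flatForm_dirDeriv hΛ hM (S.mapsTo hx) _ _).trans (S.normal x hx v)
    rw [dirDeriv_congr hU h3 u hq]
    simp [dirDeriv]
  have h4 : dirDeriv u ν q = _ := dirDeriv_pushforward hΩ hF (S.mapsTo hq)
    (S.contDiffOn.differentiableAt_of_mem hU hq)
    (S.contDiffOn_normal.differentiableAt_of_mem hU hq) u
  have h5 : flatForm (dirDeriv u ν q) (dirDeriv v (fun q => flatMap w h (Φ q)) q) = k q u v := by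
    rw [h4, S.dirDeriv_flatMap_comp hΛ hM F hU hq, map_add, add_apply,
      ← F.christoffel_eq_flatForm hΛ hM (S.mapsTo hq), ← S.second q hq,
      ← F.flatForm_dirDeriv hΛ hM (S.mapsTo hq)]
    exact add_comm _ _
  have h6 : dirDeriv (N q) (flatMap w h) (Φ q) = ν q := rfl
  rw [h6, flatForm_comm]
  linarith

/-- Decomposition of the second derivatives of the flat image of a hypersurface with respect to an
orthonormal frame. -/
lemma flatForm_dirDeriv_dirDeriv (hΛ : 0 < Λ) (hM : Subextremal M Λ) (F : FlatProfile M Λ w h)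
    (hU : IsOpen U) (S : IsHypersurface M Λ U g k Φ N) {q : E} (hq : q ∈ U) {d : Fin 3 → E}
    (hd : ∀ i j, g q (d i) (d j) = if i = j then 1 else 0) (u v y z : E) :
    flatForm (dirDeriv u (dirDeriv v (fun q => flatMap w h (Φ q))) q)
      (dirDeriv y (dirDeriv z (fun q => flatMap w h (Φ q))) q) =
    ∑ i, flatForm (dirDeriv u (dirDeriv v (fun q => flatMap w h (Φ q))) q)
        (dirDeriv (d i) (fun q => flatMap w h (Φ q)) q)
      * flatForm (dirDeriv y (dirDeriv z (fun q => flatMap w h (Φ q))) q)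
        (dirDeriv (d i) (fun q => flatMap w h (Φ q)) q)
    - k q u v * k q y z
    + flatForm (flatSecond M Λ w h (Φ q) (dirDeriv u Φ q) (dirDeriv v Φ q))
        (flatSecond M Λ w h (Φ q) (dirDeriv y Φ q) (dirDeriv z Φ q)) := by
  have hΩ := isOpen_exterior M Λ
  have hF := F.contDiffOn_flatMap hΛ hM
  have hm := S.mapsTo hq
  -- The vector acc u v is the covariant derivative of ∂_vΦ along u. The second derivative of the
  -- flat image is its push-forward plus the part II normal to the spacetime; Parseval's identity
  -- then expands acc in the frame, with product −k with N.
  let acc : E → E → ℝ × E3 := fun u v =>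
    connection M Λ (Φ q) (dirDeriv u Φ q) (dirDeriv v Φ q) + dirDeriv u (dirDeriv v Φ) q
  let II : E → E → FlatSpace := fun u v =>
    flatSecond M Λ w h (Φ q) (dirDeriv u Φ q) (dirDeriv v Φ q)
  have hdec : ∀ u v, dirDeriv u (dirDeriv v (fun q => flatMap w h (Φ q))) q
      = dirDeriv (acc u v) (flatMap w h) (Φ q) + II u v := fun u v => by
    rw [dirDeriv_dirDeriv_comp hΩ hF hU S.contDiffOn S.mapsTo hq]
    simp only [acc, II, flatSecond, dirDeriv, map_add]
    abel
  have hn : ∀ u v x, flatForm (II u v) (dirDeriv x (flatMap w h) (Φ q)) = 0 := fun u v x =>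
    F.flatSecond_normal hΛ hM hm _ _ x
  have htan : ∀ u v x, flatForm (dirDeriv u (dirDeriv v (fun q => flatMap w h (Φ q))) q)
      (dirDeriv x (flatMap w h) (Φ q)) = metric M Λ (Φ q) (acc u v) x := fun u v x => by
    rw [hdec, map_add, add_apply, hn, add_zero, F.flatForm_dirDeriv hΛ hM hm]
  have hP := metric_eq_sum_frame (fun i j => (S.first q hq (d i) (d j)).trans (hd i j))
    (S.unit q hq) (fun i => S.normal q hq (d i)) (acc u v) (acc y z)
  have hk : ∀ u v, metric M Λ (Φ q) (acc u v) (N q) = -k q u v := fun u v => by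
    rw [← htan, S.flatForm_second hΛ hM F hU hq]
  simp only [S.dirDeriv_flatMap_comp hΛ hM F hU hq, htan]
  have hB : flatForm (dirDeriv u (dirDeriv v (fun q => flatMap w h (Φ q))) q)
      (dirDeriv y (dirDeriv z (fun q => flatMap w h (Φ q))) q) =
      metric M Λ (Φ q) (acc u v) (acc y z) + flatForm (II u v) (II y z) := by
    rw [hdec y z, map_add, htan, hdec u v, map_add, add_apply,
      flatForm_comm (dirDeriv (acc u v) (flatMap w h) (Φ q)), hn, zero_add]
  rw [hB, hP, hk, hk]
  simp only [II]
  ring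

/-- Two hypersurfaces with the same first and second fundamental forms see the same values of the
spacetime curvature on their tangent spaces. -/
theorem curvature_eq (hΛ : 0 < Λ) (hM : Subextremal M Λ) (hU : IsOpen U)
    (S : IsHypersurface M Λ U g k Φ N) {Φ₀ N₀ : E → ℝ × E3} (S₀ : IsHypersurface M Λ U g k Φ₀ N₀)
    {q : E} (hq : q ∈ U) {d : Fin 3 → E}
    (hd : ∀ i j, g q (d i) (d j) = if i = j then 1 else 0) (u v y z : E) :
    curvature M Λ (Φ q) (dirDeriv u Φ q) (dirDeriv v Φ q) (dirDeriv y Φ q) (dirDeriv z Φ q) =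
      curvature M Λ (Φ₀ q) (dirDeriv u Φ₀ q) (dirDeriv v Φ₀ q) (dirDeriv y Φ₀ q)
        (dirDeriv z Φ₀ q) := by
  obtain ⟨w, h, F⟩ := exists_flatProfile hΛ hM
  have hs := S.contDiffOn_flatMap_comp hΛ hM F
  have hs₀ := S₀.contDiffOn_flatMap_comp hΛ hM F
  have key := fun u v y z => eq_of_first_fundamental_form flatForm_comm hU hs hs₀
    (fun q hq v y => (S.flatForm_first hΛ hM F hU hq v y).trans
      (S₀.flatForm_first hΛ hM F hU hq v y).symm) hq u v y z
  -- The first half of `key` does not involve the fourth vector, so any value serves.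
  have hc := fun u v y => (key u v y 0).1
  have hG := (key u v y z).2
  rw [← F.flatForm_flatSecond_antisymm hΛ hM (S.mapsTo hq),
    ← F.flatForm_flatSecond_antisymm hΛ hM (S₀.mapsTo hq)]
  have a1 := S.flatForm_dirDeriv_dirDeriv hΛ hM F hU hq hd v y u z
  have a2 := S.flatForm_dirDeriv_dirDeriv hΛ hM F hU hq hd u y v z
  have b1 := S₀.flatForm_dirDeriv_dirDeriv hΛ hM F hU hq hd v y u z
  have b2 := S₀.flatForm_dirDeriv_dirDeriv hΛ hM F hU hq hd u y v z
  simp only [hc] at a1 a2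
  linarith

end IsHypersurface

end

/-! ## Pointwise rigidity -/

/-- An orthonormal basis of the plane orthogonal to a nonzero vector. -/
lemma exists_angular_frame {x : E3} (hx : x ≠ 0) : ∃ f₁ f₂ : E3,
    ⟪f₁, f₁⟫ = 1 ∧ ⟪f₂, f₂⟫ = 1 ∧ ⟪f₁, f₂⟫ = 0 ∧ ⟪x, f₁⟫ = 0 ∧ ⟪x, f₂⟫ = 0 ∧
    ∀ u v, angular x u v = ⟪f₁, u⟫ * ⟪f₁, v⟫ + ⟪f₂, u⟫ * ⟪f₂, v⟫ := by
  have hn := norm_ne_zero_iff.2 hx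
  have hv : Orthonormal ℝ (({0} : Set (Fin 3)).domRestrict fun _ => ‖x‖⁻¹ • x) := by
    refine ⟨fun i => ?_, fun i j hij => ?_⟩
    · change ‖‖x‖⁻¹ • x‖ = 1
      rw [norm_smul, norm_inv, norm_norm, inv_mul_cancel₀ hn]
    · exact absurd (Subsingleton.elim i j) hij
  obtain ⟨b, hb⟩ := hv.exists_orthonormalBasis_extension_of_card_eq (by simp)
  have h0 : b 0 = ‖x‖⁻¹ • x := hb 0 rfl
  have hx' : x = ‖x‖ • b 0 := by rw [h0, smul_smul, mul_inv_cancel₀ hn, one_smul]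
  have hor : ∀ i j, ⟪b i, b j⟫ = if i = j then 1 else 0 := fun i j =>
    orthonormal_iff_ite.1 b.orthonormal i j
  refine ⟨b 1, b 2, by simp, by simp, by simp [hor], ?_, ?_, fun u v => ?_⟩
  · rw [hx', inner_smul_left, hor]; simp
  · rw [hx', inner_smul_left, hor]; simp
  · have h1 : ∀ u, radial x u = ⟪b 0, u⟫ := fun u => by
      rw [h0, inner_smul_left, radial]
      simp only [conj_trivial]
      ring
    rw [angular, h1, h1, ← b.sum_inner_mul_inner u v, Fin.sum_univ_three, real_inner_comm u (b 0),
      real_inner_comm u (b 1), real_inner_comm u (b 2)]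
    ring

/-- The algebraic core of the rigidity: the Gauss equations determine the mass function and the
plane spanned by the angular directions. -/
lemma gauss_algebra {m m₀ A₁ A₂ A₃ B₁ B₂ B₃ : ℝ} (hm : 0 < m * m₀)
    (e11 : m * (1 + 3 * (A₁ ^ 2 - B₁ ^ 2)) = -2 * m₀)
    (e22 : m * (1 + 3 * (A₂ ^ 2 - B₂ ^ 2)) = m₀)
    (e33 : m * (1 + 3 * (A₃ ^ 2 - B₃ ^ 2)) = m₀)
    (e12 : A₁ * A₂ = B₁ * B₂) (e13 : A₁ * A₃ = B₁ * B₃) (e23 : A₂ * A₃ = B₂ * B₃) :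
    m = m₀ ∧ B₁ ≠ 0 ∧ B₂ = 0 ∧ B₃ = 0 := by
  have hm0 : m ≠ 0 := left_ne_zero_of_mul hm.ne'
  have hm2 : 0 < m ^ 2 := by positivity
  -- Multiplication by m makes the right side −2mm₀ < 0, whatever the common sign of m and m₀.
  have hlt : 0 < B₁ ^ 2 - A₁ ^ 2 := by
    have h1 : m ^ 2 * (1 + 3 * (A₁ ^ 2 - B₁ ^ 2)) = -2 * (m * m₀) := by
      linear_combination m * e11
    by_contra! hle
    have : 0 < m ^ 2 * (1 + 3 * (A₁ ^ 2 - B₁ ^ 2)) := mul_pos hm2 (by linarith)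
    linarith
  have hB1 : B₁ ≠ 0 := by
    rintro rfl
    nlinarith [sq_nonneg A₁]
  have h23 : A₂ * A₃ = 0 := by
    have : (B₁ ^ 2 - A₁ ^ 2) * (A₂ * A₃) = 0 := by
      linear_combination B₁ ^ 2 * e23 - B₁ * B₂ * e13 - A₁ * A₃ * e12
    exact (mul_eq_zero.1 this).resolve_left hlt.ne'
  have zero_of_eq : ∀ {A B : ℝ}, A₁ * A = B₁ * B → A ^ 2 - B ^ 2 = 0 → B = 0 := by
    intro A B h1 h2
    have h3 : (B₁ ^ 2 - A₁ ^ 2) * A ^ 2 = 0 := by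
      linear_combination B₁ ^ 2 * h2 - (A₁ * A + B₁ * B) * h1
    have h4 : A ^ 2 = 0 := (mul_eq_zero.1 h3).resolve_left hlt.ne'
    have h5 : B ^ 2 = 0 := by linarith
    exact pow_eq_zero_iff two_ne_zero |>.1 h5
  have sub_zero_of : ∀ {A B : ℝ}, m * (1 + 3 * (A ^ 2 - B ^ 2)) = m₀ → m = m₀ →
      A ^ 2 - B ^ 2 = 0 := by
    intro A B h1 h2
    rw [← h2] at h1
    have h3 : m * (A ^ 2 - B ^ 2) = 0 := by linarith
    exact (mul_eq_zero.1 h3).resolve_left hm0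
  -- One of A₂, A₃ vanishes; then so does the B of the same index, and the corresponding diagonal
  -- equation reads m = m₀.
  have hmm : m = m₀ := by
    rcases mul_eq_zero.1 h23 with h | h
    · rw [h, mul_zero] at e12
      have hb : B₂ = 0 := (mul_eq_zero.1 e12.symm).resolve_left hB1
      rw [h, hb] at e22
      linarith
    · rw [h, mul_zero] at e13
      have hb : B₃ = 0 := (mul_eq_zero.1 e13.symm).resolve_left hB1
      rw [h, hb] at e33
      linarith
  exact ⟨hmm, hB1, zero_of_eq e12 (sub_zero_of e22 hmm), zero_of_eq e13 (sub_zero_of e33 hmm)⟩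

/-- The (t, r)-plane and the angular plane are both two-dimensional, so the antisymmetrized products
of their metrics factor into 2 × 2 minors, with opposite signs since only the first is Lorentzian.
-/
lemma curvature_frame {M Λ : ℝ} {p : ℝ × E3} (hV : V M Λ ‖p.2‖ ≠ 0) {e : Fin 3 → ℝ × E3}
    (he : ∀ i j, metric M Λ p (e i) (e j) = if i = j then 1 else 0) {f₁ f₂ : E3}
    (hf : ∀ u v, angular p.2 u v = ⟪f₁, u⟫ * ⟪f₁, v⟫ + ⟪f₂, u⟫ * ⟪f₂, v⟫) (i j k l : Fin 3) :
    curvature M Λ p (e i) (e j) (e k) (e l) =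
      (Λ / 3 - M / ‖p.2‖ ^ 3) * ((if j = k then 1 else 0) * (if i = l then 1 else 0)
        - (if i = k then 1 else 0) * (if j = l then 1 else 0))
      + 3 * (M / ‖p.2‖ ^ 3) *
        (((e i).1 * radial p.2 (e j).2 - (e j).1 * radial p.2 (e i).2)
            * ((e k).1 * radial p.2 (e l).2 - (e l).1 * radial p.2 (e k).2)
          - (⟪f₁, (e i).2⟫ * ⟪f₂, (e j).2⟫ - ⟪f₁, (e j).2⟫ * ⟪f₂, (e i).2⟫)
            * (⟪f₁, (e k).2⟫ * ⟪f₂, (e l).2⟫ - ⟪f₁, (e l).2⟫ * ⟪f₂, (e k).2⟫)) := by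
  rw [curvature, he, he, he, he, hf, hf, hf, hf]
  unfold planar
  field_simp
  ring

/-- In the reference frame e₀ the first vector has no angular part and the other two are angular, so
for the pairs (1,2), (2,0), (0,1) the planar minors vanish and the angular minors are 1, 0, 0. The
equality of curvatures thus becomes the system of `gauss_algebra`, with m = M/r³. -/
lemma rigidity_of_curvature_eq {M Λ : ℝ} (hM : M ≠ 0) {p p₀ : ℝ × E3}
    (hp : p.2 ≠ 0) (hp₀ : p₀.2 ≠ 0) (hV : V M Λ ‖p.2‖ ≠ 0) (hV₀ : V M Λ ‖p₀.2‖ ≠ 0)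
    {e e₀ : Fin 3 → ℝ × E3}
    (he : ∀ i j, metric M Λ p (e i) (e j) = if i = j then 1 else 0)
    (he₀ : ∀ i j, metric M Λ p₀ (e₀ i) (e₀ j) = if i = j then 1 else 0)
    (hc : ∀ i j k l, curvature M Λ p (e i) (e j) (e k) (e l)
      = curvature M Λ p₀ (e₀ i) (e₀ j) (e₀ k) (e₀ l))
    {f₁ f₂ : E3}
    (hf : ∀ u v, angular p₀.2 u v = ⟪f₁, u⟫ * ⟪f₁, v⟫ + ⟪f₂, u⟫ * ⟪f₂, v⟫)
    (h0 : ⟪f₁, (e₀ 0).2⟫ = 0) (h0' : ⟪f₂, (e₀ 0).2⟫ = 0)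
    (h1 : (e₀ 1) = (0, f₁)) (h2 : (e₀ 2) = (0, f₂)) (h11 : ⟪f₁, f₁⟫ = 1) (h22 : ⟪f₂, f₂⟫ = 1)
    (h12 : ⟪f₁, f₂⟫ = 0) (hr1 : radial p₀.2 f₁ = 0) (hr2 : radial p₀.2 f₂ = 0) :
    ‖p.2‖ = ‖p₀.2‖ ∧ angular p.2 (e 0).2 (e 0).2 = 0 := by
  obtain ⟨g₁, g₂, -, -, -, -, -, hg⟩ := exists_angular_frame hp
  have hρ := norm_pos_iff.2 hp
  have hρ₀ := norm_pos_iff.2 hp₀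
  have key := fun i j k l => (curvature_frame hV he hg i j k l).symm.trans
    ((hc i j k l).trans (curvature_frame hV₀ he₀ hf i j k l))
  have h21 : ⟪f₂, f₁⟫ = 0 := by rw [real_inner_comm]; exact h12
  obtain ⟨m, hm⟩ : ∃ m, m = M / ‖p.2‖ ^ 3 := ⟨_, rfl⟩
  obtain ⟨m₀, hm₀⟩ : ∃ m, m = M / ‖p₀.2‖ ^ 3 := ⟨_, rfl⟩
  have hm0 : m ≠ 0 := hm ▸ div_ne_zero hM (by positivity)
  simp only [← hm, ← hm₀] at key
  have k11 := key 1 2 1 2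
  have k22 := key 2 0 2 0
  have k33 := key 0 1 0 1
  have k12 := key 1 2 2 0
  have k13 := key 1 2 0 1
  have k23 := key 2 0 0 1
  simp only [h0, h0', h1, h2, h11, h22, h12, h21, hr1, hr2] at k11 k22 k33 k12 k13 k23
  simp at k11 k22 k33 k12 k13 k23
  have hmm : 0 < m * m₀ := by
    rw [hm, hm₀, div_mul_div_comm]
    have : 0 < M * M := mul_self_pos.2 hM
    positivity
  have c12 := k12.resolve_left hm0
  have c13 := k13.resolve_left hm0
  have c23 := k23.resolve_left hm0
  have concl := gauss_algebra hmm
    (A₁ := (e 1).1 * radial p.2 (e 2).2 - (e 2).1 * radial p.2 (e 1).2)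
    (A₂ := (e 2).1 * radial p.2 (e 0).2 - (e 0).1 * radial p.2 (e 2).2)
    (A₃ := (e 0).1 * radial p.2 (e 1).2 - (e 1).1 * radial p.2 (e 0).2)
    (B₁ := ⟪g₁, (e 1).2⟫ * ⟪g₂, (e 2).2⟫ - ⟪g₁, (e 2).2⟫ * ⟪g₂, (e 1).2⟫)
    (B₂ := ⟪g₁, (e 2).2⟫ * ⟪g₂, (e 0).2⟫ - ⟪g₁, (e 0).2⟫ * ⟪g₂, (e 2).2⟫)
    (B₃ := ⟪g₁, (e 0).2⟫ * ⟪g₂, (e 1).2⟫ - ⟪g₁, (e 1).2⟫ * ⟪g₂, (e 0).2⟫)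
    (by linarith) (by linarith) (by linarith) (by linarith) (by linarith) (by linarith)
  obtain ⟨hmeq, hB1, hB2, hB3⟩ := concl
  constructor
  · have h3 : ‖p.2‖ ^ 3 = ‖p₀.2‖ ^ 3 := by
      rw [hm, hm₀, div_eq_div_iff (by positivity) (by positivity)] at hmeq
      exact (mul_left_cancel₀ hM hmeq).symm
    exact (pow_left_inj₀ hρ.le hρ₀.le (by norm_num)).1 h3
  -- By B₂ = B₃ = 0 the angular part of e 0 is parallel to those of e 1 and e 2, which are
  -- independent because B₁ ≠ 0; hence it vanishes.
  · have z1 : ⟪g₁, (e 0).2⟫ = 0 := by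
      refine (mul_eq_zero.1 (?_ : ⟪g₁, (e 0).2⟫ * (⟪g₁, (e 1).2⟫ * ⟪g₂, (e 2).2⟫
        - ⟪g₁, (e 2).2⟫ * ⟪g₂, (e 1).2⟫) = 0)).resolve_right hB1
      linear_combination -⟪g₁, (e 1).2⟫ * hB2 - ⟪g₁, (e 2).2⟫ * hB3
    have z2 : ⟪g₂, (e 0).2⟫ = 0 := by
      refine (mul_eq_zero.1 (?_ : ⟪g₂, (e 0).2⟫ * (⟪g₁, (e 1).2⟫ * ⟪g₂, (e 2).2⟫
        - ⟪g₁, (e 2).2⟫ * ⟪g₂, (e 1).2⟫) = 0)).resolve_right hB1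
      linear_combination -⟪g₂, (e 1).2⟫ * hB2 - ⟪g₂, (e 2).2⟫ * hB3
    rw [hg, z1, z2]; ring

section

/-! ## The normal form of an embedding of the data -/

lemma dl_retrVec {q : ℝ × E3} (hq : q ∈ punctured) (v : ℝ × E3) :
    dl (retr q) (retrVec q v) = v.1 := by
  rw [dl, ← fderiv_comp_retr contMDiff_fst_data hq v]
  change fderiv ℝ (fun q : ℝ × E3 => q.1) q v = v.1
  rw [fderiv_fst]
  rfl

lemma sphereVec_retrVec {q : ℝ × E3} (hq : q ∈ punctured) (v : ℝ × E3) :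
    sphereVec (retr q) (retrVec q v) =
      ‖q.2‖⁻¹ • (v.2 - (radial q.2 v.2 / ‖q.2‖) • q.2) := by
  rw [sphereVec, ← fderiv_comp_retr contMDiff_snd_data hq v]
  refine fderiv_apply_of_line (differentiableAt_comp_retr contMDiff_snd_data hq) ?_
  have hq' : q.2 ≠ 0 := hq
  have hn := norm_ne_zero_iff.2 hq'
  have h2 := hasDerivAt_line_snd q v
  have e : q + (0 : ℝ) • v = q := by simp
  have hN := hasDerivAt_norm h2 (by rw [e]; exact hq')
  have hev : ∀ᶠ s : ℝ in 𝓝 0, q + s • v ∈ punctured := by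
    have hc : Continuous fun s : ℝ => q + s • v := by fun_prop
    exact hc.continuousAt.eventually_mem (isOpen_punctured.mem_nhds (by simpa using hq))
  have h3 := (hN.inv (by rw [e]; exact hn)).smul h2
  refine (h3.congr_of_eventuallyEq (hev.mono fun s hs => coe_proj hs)).congr_deriv ?_
  simp only [e, Pi.inv_apply, smul_sub, smul_smul]
  rw [sub_eq_add_neg, ← neg_smul]
  congr 2
  field_simp

lemma norm_incl_snd (p : ℝ × S2) : ‖(incl p).2‖ = 1 := norm_eq_of_mem_sphere p.2

lemma sphereVec_retrVec_incl (p : ℝ × S2) {v : ℝ × E3} (hv : ⟪(p.2 : E3), v.2⟫ = 0) :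
    sphereVec (retr (incl p)) (retrVec (incl p) v) = v.2 := by
  have h1 : radial (incl p).2 v.2 = 0 := by
    rw [radial, show ⟪(incl p).2, v.2⟫ = 0 from hv, zero_div]
  rw [sphereVec_retrVec (incl_mem_punctured p), norm_incl_snd, h1]
  simp

/-- The first fundamental form of the data, pulled back to `ℝ × (ℝ³ ∖ {0})`. -/
def firstForm (r : ℝ → ℝ) (q u v : ℝ × E3) : ℝ :=
  dataMetric r (retr q) (retrVec q u) (retrVec q v)

/-- The second fundamental form of the data, pulled back to `ℝ × (ℝ³ ∖ {0})`. -/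
def secondForm (K C : ℝ) (r : ℝ → ℝ) (q u v : ℝ × E3) : ℝ :=
  dataSecond K C r (retr q) (retrVec q u) (retrVec q v)

lemma firstForm_incl (r : ℝ → ℝ) (p : ℝ × S2) {u v : ℝ × E3} (hu : ⟪(p.2 : E3), u.2⟫ = 0)
    (hv : ⟪(p.2 : E3), v.2⟫ = 0) :
    firstForm r (incl p) u v = u.1 * v.1 + r p.1 ^ 2 * ⟪u.2, v.2⟫ := by
  rw [firstForm, dataMetric, gS2, dl_retrVec (incl_mem_punctured p),
    dl_retrVec (incl_mem_punctured p), sphereVec_retrVec_incl p hu, sphereVec_retrVec_incl p hv]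
  rfl

/-- The parameter domain has dimension four and `firstForm` is degenerate in the radial direction.
This is harmless, since the Gauss argument only needs three vectors that are orthonormal for it. -/
lemma exists_isHypersurface {M Λ K C : ℝ} {r : ℝ → ℝ} {Φ : ℝ × S2 → ℝ × E3}
    (hΦ : ContMDiff IData 𝓘(ℝ, ℝ × E3) ∞ Φ) (hmem : ∀ p, Φ p ∈ exterior M Λ)
    (hI : Induces M Λ K C r Φ) : ∃ N, IsHypersurface M Λ punctured (firstForm r)
      (secondForm K C r) (fun q => Φ (retr q)) N := by
  obtain ⟨h1, N, hN, h2, -, h3, h4⟩ := hI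
  have hd : ∀ q ∈ punctured, ∀ v, dirDeriv v (fun q => Φ (retr q)) q
      = mvfderiv IData Φ (retr q) (retrVec q v) := fun q hq v => fderiv_comp_retr hΦ hq v
  have hdN : ∀ q ∈ punctured, ∀ v, dirDeriv v (fun q => N (retr q)) q
      = mvfderiv IData N (retr q) (retrVec q v) := fun q hq v => fderiv_comp_retr hN hq v
  refine ⟨fun q => N (retr q), contDiffOn_comp_retr hΦ, contDiffOn_comp_retr hN,
    fun q _ => hmem _, fun q hq u v => ?_, fun q _ => h2 _, fun q hq v => ?_, fun q hq u v => ?_⟩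
  · rw [hd q hq, hd q hq, h1]; rfl
  · rw [hd q hq, h3]
  · rw [hd q hq, hd q hq, hdN q hq, h4]; rfl

lemma angular_eq_norm_sq {x : E3} (hx : x ≠ 0) (u : E3) :
    angular x u u = ‖u - (radial x u / ‖x‖) • x‖ ^ 2 := by
  have hn := norm_ne_zero_iff.2 hx
  rw [norm_sub_sq_real, inner_smul_right, norm_smul, mul_pow, angular, real_inner_self_eq_norm_sq,
    Real.norm_eq_abs, sq_abs, real_inner_comm]
  unfold radial
  field_simp
  ring

lemma angular_nonneg {x : E3} (hx : x ≠ 0) (u : E3) : 0 ≤ angular x u u := by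
  rw [angular_eq_norm_sq hx]; positivity

lemma eq_of_angular_eq_zero {x u : E3} (hx : x ≠ 0) (h : angular x u u = 0) :
    u = (radial x u / ‖x‖) • x := by
  rw [angular_eq_norm_sq hx, sq_eq_zero_iff, norm_eq_zero, sub_eq_zero] at h
  exact h

lemma angular_eq_zero_of_left {x u : E3} (hx : x ≠ 0) (h : angular x u u = 0) (v : E3) :
    angular x u v = 0 := by
  have hn := norm_ne_zero_iff.2 hx
  have h1 := eq_of_angular_eq_zero hx h
  have h2 : ⟪u, v⟫ = radial x u / ‖x‖ * ⟪x, v⟫ := by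
    conv_lhs => rw [h1]
    rw [inner_smul_left]; rfl
  rw [angular, h2, radial, radial]
  field_simp
  ring

namespace Profile

variable {M Λ K C a b : ℝ} {r : ℝ → ℝ}

lemma M_ne_zero (h : Profile M Λ K C a b r) : M ≠ 0 := by
  rcases h.subextremal with h | h
  · exact h.ne
  · exact h.1.ne'

lemma norm_smul_coe (h : Profile M Λ K C a b r) (l : ℝ) (z : S2) : ‖r l • (z : E3)‖ = r l := by
  rw [norm_smul, norm_eq_of_mem_sphere, Real.norm_of_nonneg (h.radius.pos l).le, mul_one]

lemma refMap_mem_exterior (h : Profile M Λ K C a b r) (p : ℝ × S2) :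
    refMap M Λ K C r (incl p) ∈ exterior M Λ := by
  change horizon M Λ < ‖r p.1 • (p.2 : E3)‖
  rw [h.norm_smul_coe]
  exact h.horizon_lt_r p.1

lemma dirDeriv_refMap_retr (h : Profile M Λ K C a b r) (p : ℝ × S2) {v : ℝ × E3}
    (hv : ⟪(p.2 : E3), v.2⟫ = 0) :
    dirDeriv v (fun q => refMap M Λ K C r (incl (retr q))) (incl p) =
      (slope M Λ K C r p.1 * v.1, (deriv r p.1 * v.1) • (p.2 : E3) + r p.1 • v.2) := by
  have h1 := fderiv_comp_retr (Φ := fun p => refMap M Λ K C r (incl p))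
    (h.contDiff_refMap.contMDiff.comp contMDiff_incl) (incl_mem_punctured p) v
  rw [dirDeriv, h1, mvfderiv_comp_incl _ (h.contDiff_refMap.differentiable (by simp) _),
    h.fderiv_refMap, dl_retrVec (incl_mem_punctured p), sphereVec_retrVec_incl p hv, retr_incl]
  rfl

/-- The pointwise consequence of the Gauss equation for an embedding of the data. -/
theorem pointwise_rigidity (h : Profile M Λ K C a b r) {Φ : ℝ × S2 → ℝ × E3}
    (hΦ : ContMDiff IData 𝓘(ℝ, ℝ × E3) ∞ Φ) (hmem : ∀ p, Φ p ∈ exterior M Λ)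
    (hI : Induces M Λ K C r Φ) (p : ℝ × S2) :
    ‖(Φ p).2‖ = r p.1 ∧ angular (Φ p).2 (dirDeriv (1, 0) (fun q => Φ (retr q)) (incl p)).2
      (dirDeriv (1, 0) (fun q => Φ (retr q)) (incl p)).2 = 0 := by
  obtain ⟨N, S⟩ := exists_isHypersurface hΦ hmem hI
  obtain ⟨N₀, S₀⟩ := exists_isHypersurface
    (Φ := fun p => refMap M Λ K C r (incl p)) (h.contDiff_refMap.contMDiff.comp contMDiff_incl)
    h.refMap_mem_exterior h.induces_refMap
  have hρ := h.radius.pos p.1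
  have hz : (p.2 : E3) ≠ 0 := ne_zero_of_mem_unit_sphere p.2
  have hz1 : ‖(p.2 : E3)‖ = 1 := norm_eq_of_mem_sphere p.2
  have hρz : r p.1 • (p.2 : E3) ≠ 0 := smul_ne_zero hρ.ne' hz
  obtain ⟨f₁, f₂, h11, h22, h12, hz1', hz2', hf⟩ := exists_angular_frame hρz
  have h21 : ⟪f₂, f₁⟫ = 0 := by rw [real_inner_comm]; exact h12
  have hf1 : ⟪(p.2 : E3), f₁⟫ = 0 := by
    rw [inner_smul_left] at hz1'; exact (mul_eq_zero.1 hz1').resolve_left hρ.ne'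
  have hf2 : ⟪(p.2 : E3), f₂⟫ = 0 := by
    rw [inner_smul_left] at hz2'; exact (mul_eq_zero.1 hz2').resolve_left hρ.ne'
  -- An orthonormal frame for g; the factor 1/r compensates the scale of the sphere of radius r.
  let d : Fin 3 → ℝ × E3 := ![(1, 0), (0, (r p.1)⁻¹ • f₁), (0, (r p.1)⁻¹ • f₂)]
  have hdz : ∀ i, ⟪(p.2 : E3), (d i).2⟫ = 0 := by
    intro i
    fin_cases i <;> simp [d, inner_smul_right, hf1, hf2]
  have hd : ∀ i j, firstForm r (incl p) (d i) (d j) = if i = j then 1 else 0 := by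
    intro i j
    rw [firstForm_incl r p (hdz i) (hdz j)]
    fin_cases i <;> fin_cases j <;>
      simp [d, inner_smul_left, inner_smul_right, h11, h22, h12, h21,
        -inner_self_eq_norm_sq_to_K] <;> field_simp
  have hr : retr (incl p) = p := retr_incl p
  have hq := incl_mem_punctured p
  have hc := fun i j k l => S.curvature_eq h.Λ_pos h.subextremal isOpen_punctured S₀ hq hd
    (d i) (d j) (d k) (d l)
  have hS := fun i j => (S.first _ hq (d i) (d j)).trans (hd i j)
  have hS₀ := fun i j => (S₀.first _ hq (d i) (d j)).trans (hd i j)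
  have hv : ∀ i, dirDeriv (d i) (fun q => refMap M Λ K C r (incl (retr q))) (incl p) = _ :=
    fun i => h.dirDeriv_refMap_retr p (hdz i)
  have hfz1 : ⟪f₁, (p.2 : E3)⟫ = 0 := by rw [real_inner_comm]; exact hf1
  have hfz2 : ⟪f₂, (p.2 : E3)⟫ = 0 := by rw [real_inner_comm]; exact hf2
  have hm := S.mapsTo hq
  have hm₀ := S₀.mapsTo hq
  simp only [hr] at hc hS hS₀ hm hm₀
  have hne := FlatProfile.ne_zero_of_mem_exterior h.Λ_pos h.subextremal hm
  have hne₀ := FlatProfile.ne_zero_of_mem_exterior h.Λ_pos h.subextremal hm₀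
  have hpos : (refMap M Λ K C r (incl p)).2 = r p.1 • (p.2 : E3) := rfl
  have key := rigidity_of_curvature_eq h.M_ne_zero hne hne₀
    (KottlerCMC.V_neg h.Λ_pos h.subextremal hm).ne (KottlerCMC.V_neg h.Λ_pos h.subextremal hm₀).ne
    (e := fun i => dirDeriv (d i) (fun q => Φ (retr q)) (incl p))
    (e₀ := fun i => dirDeriv (d i) (fun q => refMap M Λ K C r (incl (retr q))) (incl p))
    hS hS₀ hc (f₁ := f₁) (f₂ := f₂) (by rw [hpos]; exact hf)
    (by rw [hv]; simp [d, inner_smul_right, hfz1]) (by rw [hv]; simp [d, inner_smul_right, hfz2])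
    (by rw [hv]; simp [d, hρ.ne']) (by rw [hv]; simp [d, hρ.ne']) h11 h22 h12
    (by rw [hpos, radial, hz1', zero_div]) (by rw [hpos, radial, hz2', zero_div])
  rw [hpos, h.norm_smul_coe] at key
  exact key

end Profile

end

/-! ### Integration of the pointwise rigidity -/

section

/-- The differential of a radially constant map of `ℝ × (ℝ³ ∖ {0})` in terms of its values along
`ℝ × S²`. -/
lemma fderiv_comp_retr_eq {X : Type*} [NormedAddCommGroup X] [NormedSpace ℝ X]
    {Φ : ℝ × S2 → X} (hΦ : ContMDiff IData 𝓘(ℝ, X) ∞ Φ) {q : ℝ × E3}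
    (hq : q ∈ punctured) (v : ℝ × E3) :
    fderiv ℝ (fun q => Φ (retr q)) q v = fderiv ℝ (fun q => Φ (retr q)) (incl (retr q))
      (v.1, sphereVec (retr q) (retrVec q v)) := by
  have h := mvfderiv_comp_incl (H := fun q => Φ (retr q)) (retr q)
    (differentiableAt_comp_retr hΦ (incl_mem_punctured _)) (retrVec q v)
  simp only [retr_incl, dl_retrVec hq] at h
  rw [fderiv_comp_retr hΦ hq, h]

lemma hasDerivAt_comp_retr {X : Type*} [NormedAddCommGroup X] [NormedSpace ℝ X]
    {Φ : ℝ × S2 → X} (hΦ : ContMDiff IData 𝓘(ℝ, X) ∞ Φ) (p : ℝ × S2) :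
    HasDerivAt (fun l => Φ (l, p.2)) (fderiv ℝ (fun q => Φ (retr q)) (incl p) (1, 0)) p.1 := by
  have h1 := (differentiableAt_comp_retr hΦ (incl_mem_punctured p)).hasFDerivAt
  have h2 : HasDerivAt (fun l : ℝ => (l, (p.2 : E3))) (1, 0) p.1 :=
    (hasDerivAt_id p.1).prodMk (hasDerivAt_const _ _)
  have h3 := HasFDerivAt.comp_hasDerivAt (f := fun l : ℝ => (l, (p.2 : E3))) p.1 h1 h2
  refine h3.congr_of_eventuallyEq (Eventually.of_forall fun l => ?_)
  simp [retr, proj_coe]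

lemma isPreconnected_ne_zero : IsPreconnected ({0}ᶜ : Set E3) :=
  (isConnected_compl_singleton_of_one_lt_rank (by
    rw [← Module.finrank_eq_rank, finrankE3.out]; norm_num) 0).isPreconnected

namespace Profile

variable {M Λ K C a b : ℝ} {r : ℝ → ℝ}

/-- The derivatives of an embedding of the data. -/
lemma fderiv_embedding (h : Profile M Λ K C a b r) {Φ : ℝ × S2 → ℝ × E3}
    (hΦ : ContMDiff IData 𝓘(ℝ, ℝ × E3) ∞ Φ) (hmem : ∀ p, Φ p ∈ exterior M Λ)
    (hI : Induces M Λ K C r Φ) (p : ℝ × S2) :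
    (fderiv ℝ (fun q => Φ (retr q)) (incl p) (1, 0)).1 ^ 2 = slope M Λ K C r p.1 ^ 2 ∧
    (fderiv ℝ (fun q => Φ (retr q)) (incl p) (1, 0)).2 = (deriv r p.1 / r p.1) • (Φ p).2 ∧
    (∀ f : E3, ⟪(p.2 : E3), f⟫ = 0 →
      (fderiv ℝ (fun q => Φ (retr q)) (incl p) (0, f)).1 = 0 ∧
      ⟪(Φ p).2, (fderiv ℝ (fun q => Φ (retr q)) (incl p) (0, f)).2⟫ = 0) ∧
    (∀ f f' : E3, ⟪(p.2 : E3), f⟫ = 0 → ⟪(p.2 : E3), f'⟫ = 0 →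
      ⟪(fderiv ℝ (fun q => Φ (retr q)) (incl p) (0, f)).2,
        (fderiv ℝ (fun q => Φ (retr q)) (incl p) (0, f')).2⟫ = r p.1 ^ 2 * ⟪f, f'⟫) := by
  obtain ⟨N, S⟩ := exists_isHypersurface hΦ hmem hI
  have hq := incl_mem_punctured p
  have hρ := h.radius.pos p.1
  have hnorm : ∀ p, ‖(Φ p).2‖ = r p.1 := fun p => (h.pointwise_rigidity hΦ hmem hI p).1
  have hang := (h.pointwise_rigidity hΦ hmem hI p).2
  have hy : (Φ p).2 ≠ 0 := norm_ne_zero_iff.1 (by rw [hnorm]; exact hρ.ne')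
  have hV := (h.V_neg p.1).ne
  have hD : ∀ v, ⟪(Φ p).2, (fderiv ℝ (fun q => Φ (retr q)) (incl p) v).2⟫
      = r p.1 * (deriv r p.1 * v.1) := fun v => by
    have hd := differentiableAt_comp_retr hΦ hq
    have h1 : HasFDerivAt (fun q => ‖(Φ (retr q)).2‖ ^ 2) _ (incl p) :=
      ((hasFDerivAt_snd (𝕜 := ℝ)).comp (incl p) hd.hasFDerivAt).norm_sq
    have h2 : HasFDerivAt (fun q : ℝ × E3 => r q.1 ^ 2) _ (incl p) :=
      ((h.radius.hasDerivAt p.1).comp_hasFDerivAt (incl p) (hasFDerivAt_fst (𝕜 := ℝ))).pow 2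
    have h3 : (fun q => ‖(Φ (retr q)).2‖ ^ 2) = fun q : ℝ × E3 => r q.1 ^ 2 :=
      funext fun q => by rw [hnorm]; rfl
    rw [h3] at h1
    have h4 := DFunLike.congr_fun (h1.unique h2) v
    simp [retr_incl] at h4
    change 2 * _ = 2 * r p.1 * (deriv r p.1 * v.1) at h4
    linarith
  have hrad : ∀ v, radial (Φ p).2 (fderiv ℝ (fun q => Φ (retr q)) (incl p) v).2
      = deriv r p.1 * v.1 := fun v => by
    rw [radial, hD, hnorm]; field_simp
  have hm : ∀ u v : ℝ × E3, ⟪(p.2 : E3), u.2⟫ = 0 → ⟪(p.2 : E3), v.2⟫ = 0 →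
      metric M Λ (Φ p) (fderiv ℝ (fun q => Φ (retr q)) (incl p) u)
        (fderiv ℝ (fun q => Φ (retr q)) (incl p) v) = u.1 * v.1 + r p.1 ^ 2 * ⟪u.2, v.2⟫ :=
    fun u v hu hv => by
      rw [← firstForm_incl r p hu hv, ← S.first _ hq u v, retr_incl]; rfl
  simp only [dirDeriv] at hang
  have e1 : (fderiv ℝ (fun q => Φ (retr q)) (incl p) (1, 0)).1 ^ 2 = slope M Λ K C r p.1 ^ 2 := by
    have h1 := hm (1, 0) (1, 0) (inner_zero_right _) (inner_zero_right _)
    rw [metric_eq, hrad, hang, hnorm, inner_zero_right] at h1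
    have h2 : deriv r p.1 ^ 2 = V M Λ (r p.1) + drift K C (r p.1) ^ 2 := h.radius.ode _
    rw [slope]
    field_simp at h1 ⊢
    linear_combination -h1 + h2
  have hne : (fderiv ℝ (fun q => Φ (retr q)) (incl p) (1, 0)).1 ≠ 0 := fun h0 => by
    rw [h0] at e1
    have := h.slope_pos p.1
    nlinarith
  -- ∂_l is g-orthogonal to the sphere, ∂_lΦ has no angular part, and r does not vary along f. Of
  -- the metric product only −V times the two t-components survives, and the t-component of ∂_lΦ is
  -- nonzero.
  have e3 : ∀ f : E3, ⟪(p.2 : E3), f⟫ = 0 →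
      (fderiv ℝ (fun q => Φ (retr q)) (incl p) (0, f)).1 = 0 := fun f hf => by
    have h1 := hm (1, 0) (0, f) (inner_zero_right _) hf
    rw [metric_eq, hrad, hrad, angular_eq_zero_of_left hy hang, hnorm, inner_zero_left] at h1
    simpa [hV, hne] using h1
  refine ⟨e1, ?_, fun f hf => ⟨e3 f hf, by rw [hD]; simp⟩, fun f f' hf hf' => ?_⟩
  · rw [eq_of_angular_eq_zero hy hang, hrad, hnorm, mul_one]
  · have h1 := hm (0, f) (0, f') hf hf'
    rw [metric_eq, angular, hrad, hrad, e3 f hf] at h1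
    simpa using h1

/-- An embedding of the data is, up to a translation and a reflection of `t`, spherically
symmetric. -/
theorem normal_form (h : Profile M Λ K C a b r) {Φ : ℝ × S2 → ℝ × E3}
    (hΦ : ContMDiff IData 𝓘(ℝ, ℝ × E3) ∞ Φ) (hmem : ∀ p, Φ p ∈ exterior M Λ)
    (hI : Induces M Λ K C r Φ) : ∃ (t₀ σ : ℝ) (A : S2 → S2), (σ = 1 ∨ σ = -1) ∧
      Function.Surjective A ∧ ∀ l z, Φ (l, z) = (t₀ + σ * height M Λ K C r l, r l • (A z : E3)) := by
  have hF := h.fderiv_embedding hΦ hmem hI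
  have hnorm : ∀ p, ‖(Φ p).2‖ = r p.1 := fun p => (h.pointwise_rigidity hΦ hmem hI p).1
  have hr0 : ∀ l, r l ≠ 0 := fun l => (h.radius.pos l).ne'
  -- the time component does not depend on the point of the sphere
  have ht : ∀ l z z', (Φ (l, z)).1 = (Φ (l, z')).1 := fun l z z' => by
    have hd : ∀ x ∈ ({0}ᶜ : Set E3), HasFDerivAt (fun x => (Φ (retr (l, x))).1)
        ((ContinuousLinearMap.fst ℝ ℝ E3).comp ((fderiv ℝ (fun q => Φ (retr q)) (l, x)).comp
          (ContinuousLinearMap.inr ℝ ℝ E3))) x := fun x hx => by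
      have h1 := (differentiableAt_comp_retr hΦ (q := (l, x)) hx).hasFDerivAt
      exact (hasFDerivAt_fst (𝕜 := ℝ)).comp x
        (HasFDerivAt.comp (f := fun x : E3 => (l, x)) x h1 (hasFDerivAt_prodMk_right l x))
    have h2 := isOpen_compl_singleton.is_const_of_fderiv_eq_zero isPreconnected_ne_zero
      (fun x hx => (hd x hx).differentiableAt.differentiableWithinAt) (fun x hx => by
        rw [(hd x hx).fderiv]
        ext f
        have h3 := fderiv_comp_retr_eq hΦ (q := (l, x)) hx (0, f)
        simp only [ContinuousLinearMap.comp_apply, ContinuousLinearMap.inr_apply, h3]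
        exact ((hF (retr (l, x))).2.2.1 _ (inner_sphereVec _ _)).1)
      (x := (z : E3)) (y := (z' : E3)) (ne_zero_of_mem_unit_sphere z) (ne_zero_of_mem_unit_sphere z')
    simpa [retr, proj_coe] using h2
  -- the time component along the first factor
  obtain ⟨σ, hσ, t₀, ht₀⟩ : ∃ σ : ℝ, (σ = 1 ∨ σ = -1) ∧
      ∃ t₀, ∀ l, (Φ (l, default)).1 = t₀ + σ * height M Λ K C r l := by
    have hd : ∀ l, HasDerivAt (fun l => (Φ (l, default)).1)
        (fderiv ℝ (fun q => Φ (retr q)) (incl (l, default)) (1, 0)).1 l := fun l =>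
      (hasDerivAt_comp_retr hΦ (l, default)).fst
    have hc : Continuous fun l : ℝ =>
        (fderiv ℝ (fun q => Φ (retr q)) (incl (l, default)) (1, 0)).1 := by
      have h1 := (contDiffOn_dirDeriv isOpen_punctured (contDiffOn_comp_retr hΦ) (1, 0)).continuousOn
      refine continuous_fst.comp (h1.comp_continuous (f := fun l : ℝ => incl (l, default)) ?_
        fun l => incl_mem_punctured _)
      unfold incl
      fun_prop
    -- Two continuous functions on ℝ with equal squares, one of them without zeros, differ by a
    -- constant sign.
    have hsign := isPreconnected_univ.eq_or_eq_neg_of_sq_eq hc.continuousOn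
      h.contDiff_slope.continuous.continuousOn (fun l _ => (hF (l, default)).1)
      (fun {l} _ => (h.slope_pos l).ne')
    obtain ⟨σ, hσ, hs⟩ : ∃ σ : ℝ, (σ = 1 ∨ σ = -1) ∧ ∀ l : ℝ,
        (fderiv ℝ (fun q => Φ (retr q)) (incl (l, default)) (1, 0)).1 = σ * slope M Λ K C r l := by
      rcases hsign with hs | hs
      · exact ⟨1, Or.inl rfl, fun l => by rw [one_mul]; exact hs (mem_univ l)⟩
      · exact ⟨-1, Or.inr rfl, fun l => by rw [neg_one_mul]; exact hs (mem_univ l)⟩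
    refine ⟨σ, hσ, (Φ (0, default)).1 - σ * height M Λ K C r 0, fun l => ?_⟩
    have hd' : ∀ l, HasDerivAt (fun l => (Φ (l, default)).1 - σ * height M Λ K C r l) 0 l :=
      fun l => ((hd l).sub ((h.hasDerivAt_height l).const_mul σ)).congr_deriv (by rw [hs, sub_self])
    have := is_const_of_deriv_eq_zero (fun l => (hd' l).differentiableAt)
      (fun l => (hd' l).deriv) l 0
    linarith
  -- the direction in space is constant along the first factor
  have hdir : ∀ l z, (Φ (l, z)).2 = r l • ((r 0)⁻¹ • (Φ (0, z)).2) := fun l z => by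
    have hd : ∀ l, HasDerivAt (fun l => (r l)⁻¹ • (Φ (l, z)).2) 0 l := fun l => by
      refine (((h.radius.hasDerivAt l).inv (hr0 l)).smul
        (hasDerivAt_comp_retr hΦ (l, z)).snd).congr_deriv ?_
      rw [(hF (l, z)).2.1, smul_smul, ← add_smul]
      have := hr0 l
      simp only [Pi.inv_apply]
      rw [show (r l)⁻¹ * (deriv r l / r l) + -deriv r l / r l ^ 2 = 0 by field_simp; ring, zero_smul]
    have := is_const_of_deriv_eq_zero (fun l => (hd l).differentiableAt)
      (fun l => (hd l).deriv) l 0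
    rw [← this, smul_smul, mul_inv_cancel₀ (hr0 l), one_smul]
  obtain ⟨A, hA⟩ : ∃ A : S2 → S2, ∀ z, (Φ (0, z)).2 = r 0 • (A z : E3) := by
    refine ⟨fun z => ⟨(r 0)⁻¹ • (Φ (0, z)).2, ?_⟩, fun z => ?_⟩
    · rw [mem_sphere_zero_iff_norm, norm_smul, hnorm, norm_inv,
        Real.norm_of_nonneg (h.radius.pos 0).le]
      exact inv_mul_cancel₀ (hr0 0)
    · rw [smul_smul, mul_inv_cancel₀ (hr0 0), one_smul]
  refine ⟨t₀, σ, A, hσ, fun z₀ => ?_, fun l z => Prod.ext ?_ ?_⟩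
  -- Surjectivity of A: let z maximize ⟪Φ(0, z), z₀⟫ over the sphere. There z₀ is orthogonal to the
  -- image of the differential, which together with Φ(0, z) spans ℝ³, so A z = ±z₀.
  · have hcont : Continuous fun z : S2 => ⟪(Φ (0, z)).2, (z₀ : E3)⟫ :=
      (continuous_snd.comp (hΦ.continuous.comp (Continuous.prodMk_right 0))).inner continuous_const
    obtain ⟨z, -, hz⟩ := isCompact_univ.exists_isMaxOn univ_nonempty hcont.continuousOn
    have hzmax : ∀ z', ⟪(Φ (0, z')).2, (z₀ : E3)⟫ ≤ ⟪(Φ (0, z)).2, (z₀ : E3)⟫ :=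
      fun z' => hz (mem_univ z')
    have hder : ∀ x ∈ ({0}ᶜ : Set E3), HasFDerivAt (fun x => (Φ (retr (0, x))).2)
        ((ContinuousLinearMap.snd ℝ ℝ E3).comp ((fderiv ℝ (fun q => Φ (retr q)) (0, x)).comp
          (ContinuousLinearMap.inr ℝ ℝ E3))) x := fun x hx => by
      have h1 := (differentiableAt_comp_retr hΦ (q := (0, x)) hx).hasFDerivAt
      exact (hasFDerivAt_snd (𝕜 := ℝ)).comp x
        (HasFDerivAt.comp (f := fun x : E3 => ((0 : ℝ), x)) x h1 (hasFDerivAt_prodMk_right 0 x))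
    have hzne : (z : E3) ∈ ({0}ᶜ : Set E3) := ne_zero_of_mem_unit_sphere z
    have hcrit : ∀ f : E3, ⟪(fderiv ℝ (fun q => Φ (retr q)) (incl (0, z)) (0, f)).2, (z₀ : E3)⟫
        = 0 := fun f => by
      have h1 := ((hder _ hzne).inner ℝ (hasFDerivAt_const (z₀ : E3) (z : E3)))
      have h2 : IsLocalMax (fun x => ⟪(Φ (retr (0, x))).2, (z₀ : E3)⟫) (z : E3) :=
        Eventually.of_forall fun x => by
          simpa [retr, proj_coe] using hzmax (proj x)
      have h3 := DFunLike.congr_fun (h2.hasFDerivAt_eq_zero h1) f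
      simpa [incl, fderivInnerCLM_apply] using h3
    obtain ⟨f₁, f₂, h11, h22, h12, hz1, hz2, -⟩ := exists_angular_frame hzne
    have hF0 := hF (0, z)
    have h21 : ⟪f₂, f₁⟫ = 0 := by rw [real_inner_comm]; exact h12
    let e : Fin 3 → E3 := ![(Φ (0, z)).2, (fderiv ℝ (fun q => Φ (retr q)) (incl (0, z)) (0, f₁)).2,
      (fderiv ℝ (fun q => Φ (retr q)) (incl (0, z)) (0, f₂)).2]
    have hw := hF0.2.2.2
    have hy1 := (hF0.2.2.1 f₁ hz1).2
    have hy2 := (hF0.2.2.1 f₂ hz2).2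
    have hyy : ⟪(Φ (0, z)).2, (Φ (0, z)).2⟫ = r 0 ^ 2 := by
      rw [real_inner_self_eq_norm_sq, hnorm]
    have hexp := bilin_eq_sum_of_orthogonal (finrankE3.out : Module.finrank ℝ E3 = 3)
      (innerₗ E3) e (fun i j hij => by
        fin_cases i <;> fin_cases j <;> first | exact absurd rfl hij | skip
        · exact hy1
        · exact hy2
        · exact (real_inner_comm _ _).trans hy1
        · exact (hw f₁ f₂ hz1 hz2).trans (by rw [h12, mul_zero])
        · exact (real_inner_comm _ _).trans hy2
        · exact (hw f₂ f₁ hz2 hz1).trans (by rw [h21, mul_zero]))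
      (fun i => by
        have := pow_ne_zero 2 (hr0 0)
        fin_cases i
        · exact hyy.trans_ne this
        · exact (hw f₁ f₁ hz1 hz1).trans_ne (by rw [h11, mul_one]; exact this)
        · exact (hw f₂ f₂ hz2 hz2).trans_ne (by rw [h22, mul_one]; exact this))
      (z₀ : E3) (z₀ : E3)
    have hz0 : ‖(z₀ : E3)‖ = 1 := norm_eq_of_mem_sphere z₀
    have hAz : ‖(A z : E3)‖ = 1 := norm_eq_of_mem_sphere (A z)
    have hsq : ⟪(A z : E3), (z₀ : E3)⟫ ^ 2 = 1 := by
      rw [Fin.sum_univ_three] at hexp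
      have e1 : ⟪e 1, (z₀ : E3)⟫ = 0 := hcrit f₁
      have e2 : ⟪e 2, (z₀ : E3)⟫ = 0 := hcrit f₂
      simp only [innerₗ_apply_apply, e1, e2, show e 0 = (Φ (0, z)).2 from rfl, hyy, mul_zero,
        zero_div, add_zero] at hexp
      rw [real_inner_self_eq_norm_sq, hz0, hA, inner_smul_right, inner_smul_left,
        real_inner_comm (A z : E3) (z₀ : E3)] at hexp
      have := hr0 0
      simp only [conj_trivial] at hexp
      field_simp at hexp
      exact hexp.symm
    rcases sq_eq_sq_iff_eq_or_eq_neg.1 (hsq.trans (one_pow 2).symm) with h1 | h1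
    · exact ⟨z, Subtype.ext ((inner_eq_one_iff_of_norm_eq_one hAz hz0).1 h1)⟩
    -- If A z = −z₀, the maximum of the product is its least possible value, so Φ(0, ·) is constant,
    -- whereas its differential scales lengths by r(0).
    · exfalso
      have hconst : ∀ z', (Φ (0, z')).2 = r 0 • (-(z₀ : E3)) := fun z' => by
        have h2 := hzmax z'
        have hAz' : ‖(A z' : E3)‖ = 1 := norm_eq_of_mem_sphere (A z')
        rw [hA, hA, inner_smul_left, inner_smul_left, h1] at h2
        have h3 : ⟪(A z' : E3), (z₀ : E3)⟫ ≤ -1 := le_of_mul_le_mul_left h2 (h.radius.pos 0)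
        have h4 := neg_le_of_abs_le (abs_real_inner_le_norm (A z' : E3) (z₀ : E3))
        rw [hAz', hz0, one_mul] at h4
        have h5 : ⟪(A z' : E3), -(z₀ : E3)⟫ = 1 := by rw [inner_neg_right]; linarith
        rw [hA, (inner_eq_one_iff_of_norm_eq_one hAz' (by rw [norm_neg, hz0])).1 h5]
      have h2 := hder _ hzne
      have h3 : (fun x : E3 => (Φ (retr (0, x))).2) = fun _ => r 0 • (-(z₀ : E3)) :=
        funext fun x => hconst _
      rw [h3] at h2
      have h4 := DFunLike.congr_fun (h2.unique (hasFDerivAt_const _ _)) f₁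
      have h5 := hw f₁ f₁ hz1 hz1
      rw [show (fderiv ℝ (fun q => Φ (retr q)) (incl (0, z)) (0, f₁)).2 = 0 from h4, h11,
        inner_zero_left, mul_one] at h5
      exact pow_ne_zero 2 (hr0 0) h5.symm
  · rw [ht l z default, ht₀]
  · rw [hdir, hA, smul_smul (r 0)⁻¹, inv_mul_cancel₀ (hr0 0), one_smul]

end Profile

end

section

/-! ## The height function -/

namespace Profile

variable {M Λ K C a b : ℝ} {r : ℝ → ℝ}

lemma height_zero : height M Λ K C r 0 = 0 := intervalIntegral.integral_same

lemma strictMono_height (h : Profile M Λ K C a b r) : StrictMono (height M Λ K C r) :=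
  strictMono_of_deriv_pos fun l => by rw [(h.hasDerivAt_height l).deriv]; exact h.slope_pos l

lemma height_neg (h : Profile M Λ K C a b r) (l : ℝ) :
    height M Λ K C r (-l) = -height M Λ K C r l := by
  have hd : ∀ l, HasDerivAt (fun l => height M Λ K C r (-l) + height M Λ K C r l) 0 l := fun l => by
    have h1 := (h.hasDerivAt_height (-l)).comp l (hasDerivAt_neg l)
    refine (h1.add (h.hasDerivAt_height l)).congr_deriv ?_
    rw [slope, slope, h.radius.even h.well]
    ring
  have := is_const_of_deriv_eq_zero (fun l => (hd l).differentiableAt) (fun l => (hd l).deriv) l 0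
  simp only [neg_zero, height_zero] at this
  linarith

lemma calT_eq (h : Profile M Λ K C a b r) :
    calT M Λ K C a b r = height M Λ K C r (halfPeriod M Λ K C a b) := by
  have hL := (h.radius.halfPeriod_spec h.well).1
  have h1 : (∫ l in (0 : ℝ)..halfPeriod M Λ K C a b,
      (V M Λ (r l))⁻¹ * (K * r l / 3 - C / r l ^ 2))
      = -height M Λ K C r (halfPeriod M Λ K C a b) := by
    rw [height, ← intervalIntegral.integral_neg]
    congr 1
    funext l
    rw [drift, div_neg, neg_neg, div_eq_inv_mul _ (V M Λ (r l))]
  rw [calT, h1, abs_neg, abs_of_pos]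
  have := h.strictMono_height hL
  rwa [height_zero] at this

lemma calT_pos (h : Profile M Λ K C a b r) : 0 < calT M Λ K C a b r := by
  have := h.strictMono_height (h.radius.halfPeriod_spec h.well).1
  rwa [height_zero, ← h.calT_eq] at this

/-- The increment over 2L is constant because the slope is 2L-periodic; at −L it equals h(L) − h(−L)
= 2h(L) by oddness. -/
lemma height_add_period (h : Profile M Λ K C a b r) (l : ℝ) :
    height M Λ K C r (l + 2 * halfPeriod M Λ K C a b)
      = height M Λ K C r l + 2 * calT M Λ K C a b r := by
  have hd : ∀ l, HasDerivAt (fun l => height M Λ K C r (l + 2 * halfPeriod M Λ K C a b)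
      - height M Λ K C r l) 0 l := fun l => by
    refine (((h.hasDerivAt_height _).comp_add_const l _).sub (h.hasDerivAt_height l)).congr_deriv ?_
    rw [slope, slope, h.radius.periodic h.well, sub_self]
  have := is_const_of_deriv_eq_zero (fun l => (hd l).differentiableAt) (fun l => (hd l).deriv) l
    (-halfPeriod M Λ K C a b)
  rw [h.height_neg, ← h.calT_eq, show -halfPeriod M Λ K C a b + 2 * halfPeriod M Λ K C a b
    = halfPeriod M Λ K C a b by ring, ← h.calT_eq] at this
  linarith

lemma height_add_int_mul (h : Profile M Λ K C a b r) (m : ℤ) (l : ℝ) :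
    height M Λ K C r (l + m * (2 * halfPeriod M Λ K C a b))
      = height M Λ K C r l + m * (2 * calT M Λ K C a b r) := by
  induction m using Int.induction_on generalizing l with
  | zero => simp
  | succ i hi =>
    have h1 := h.height_add_period (l + (i : ℤ) * (2 * halfPeriod M Λ K C a b))
    rw [hi] at h1
    push_cast at h1 ⊢
    rw [show l + ((i : ℝ) + 1) * (2 * halfPeriod M Λ K C a b) = l + i * (2 * halfPeriod M Λ K C a b)
      + 2 * halfPeriod M Λ K C a b by ring, h1]
    ring
  | pred i hi =>
    have h1 := h.height_add_period (l + (-(i : ℤ) - 1 : ℤ) * (2 * halfPeriod M Λ K C a b))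
    have h2 := hi l
    push_cast at h1 h2 ⊢
    rw [show l + (-(i : ℝ) - 1) * (2 * halfPeriod M Λ K C a b) + 2 * halfPeriod M Λ K C a b
      = l + -(i : ℝ) * (2 * halfPeriod M Λ K C a b) by ring, h2] at h1
    linarith

lemma height_add_int_mul_cover (h : Profile M Λ K C a b r) (n : ℕ) (m : ℤ) (l : ℝ) :
    height M Λ K C r (l + m * (n * (2 * halfPeriod M Λ K C a b)))
      = height M Λ K C r l + m * (2 * (n * calT M Λ K C a b r)) := by
  have := h.height_add_int_mul (m * n) l
  push_cast at this
  rw [← mul_assoc, this]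
  ring

lemma radius_add_int_mul_cover (h : Profile M Λ K C a b r) (n : ℕ) (m : ℤ) (l : ℝ) :
    r (l + m * (n * (2 * halfPeriod M Λ K C a b))) = r l := by
  have := (h.radius.periodic h.well).int_mul (m * n) l
  push_cast at this
  rw [← mul_assoc, this]

lemma surjective_height (h : Profile M Λ K C a b r) :
    Function.Surjective (height M Λ K C r) := by
  have hub : ∀ y : ℝ, ∃ l, y ≤ height M Λ K C r l := fun y => by
    have hT := h.calT_pos
    obtain ⟨n, hn⟩ := exists_nat_gt (y / (2 * calT M Λ K C a b r))
    refine ⟨0 + (n : ℤ) * (2 * halfPeriod M Λ K C a b), ?_⟩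
    rw [h.height_add_int_mul, height_zero, zero_add]
    rw [div_lt_iff₀ (by positivity)] at hn
    exact_mod_cast hn.le
  refine h.contDiff_height.continuous.surjective
    (h.strictMono_height.monotone.tendsto_atTop_atTop hub)
    (h.strictMono_height.monotone.tendsto_atBot_atBot fun y => ?_)
  obtain ⟨l, hl⟩ := hub (-y)
  exact ⟨-l, by rw [h.height_neg]; linarith⟩

lemma height_half_cover (h : Profile M Λ K C a b r) (n : ℕ) :
    height M Λ K C r (n * halfPeriod M Λ K C a b) = n * calT M Λ K C a b r := by
  have h1 := h.height_add_int_mul n (-(n * halfPeriod M Λ K C a b))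
  push_cast at h1
  rw [h.height_neg, show -(n * halfPeriod M Λ K C a b) + n * (2 * halfPeriod M Λ K C a b)
    = n * halfPeriod M Λ K C a b by ring] at h1
  linarith

/-! ## The images of the embeddings -/

lemma embedding_normal_form (h : Profile M Λ K C a b r) {T L : ℝ} {n : ℕ}
    {φ : DataManifold n L → FC M Λ T} (hφ : IsDataEmbedding M Λ K C T n L r φ) :
    ∃ (t₀ σ : ℝ) (A : S2 → S2), (σ = 1 ∨ σ = -1) ∧ Function.Surjective A ∧
      ∀ (l : ℝ) (z : S2), (φ ((l : AddCircle ((n : ℝ) * (2 * L))), z)).1 =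
        (((t₀ + σ * height M Λ K C r l : ℝ) : AddCircle (2 * T)), r l • (A z : E3)) := by
  obtain ⟨Φ, hlift, hΦ, hI⟩ := hφ.exists_lift
  have hmem : ∀ p, Φ p ∈ exterior M Λ := fun p => by
    have h1 := (φ ((p.1 : AddCircle ((n : ℝ) * (2 * L))), p.2)).2
    rw [hlift p] at h1
    exact h1
  obtain ⟨t₀, σ, A, hσ, hA, hN⟩ := h.normal_form hΦ hmem hI
  refine ⟨t₀, σ, A, hσ, hA, fun l z => ?_⟩
  rw [hlift (l, z), hN]

/-- The spherically symmetric hypersurface `t = t₀ + height l`, `r = r(l)` of `FC[T]`. -/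
def slice (M Λ K C T : ℝ) (r : ℝ → ℝ) (t₀ : ℝ) : Set (FC M Λ T) :=
  {p | ∃ (l : ℝ) (z : S2),
    p.1 = (((t₀ + height M Λ K C r l : ℝ) : AddCircle (2 * T)), r l • (z : E3))}

/-- The reflection σ = −1 is undone by l ↦ −l, as r is even and the height odd, and A is onto. Only
t₀ remains. -/
lemma exists_range_eq_slice (h : Profile M Λ K C a b r) {T L : ℝ} {n : ℕ}
    {φ : DataManifold n L → FC M Λ T} (hφ : IsDataEmbedding M Λ K C T n L r φ) :
    ∃ t₀, range φ = slice M Λ K C T r t₀ := by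
  obtain ⟨t₀, σ, A, hσ, hA, hN⟩ := h.embedding_normal_form hφ
  have key : ∀ l, ∃ l', r l' = r l ∧ σ * height M Λ K C r l' = height M Λ K C r l := fun l => by
    rcases hσ with rfl | rfl
    · exact ⟨l, rfl, one_mul _⟩
    · exact ⟨-l, h.radius.even h.well l, by rw [h.height_neg]; ring⟩
  have key' : ∀ l, ∃ l', r l' = r l ∧ height M Λ K C r l' = σ * height M Λ K C r l := fun l => by
    rcases hσ with rfl | rfl
    · exact ⟨l, rfl, (one_mul _).symm⟩
    · exact ⟨-l, h.radius.even h.well l, by rw [h.height_neg]; ring⟩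
  refine ⟨t₀, Subset.antisymm ?_ fun p hp => ?_⟩
  · rintro _ ⟨⟨θ, z⟩, rfl⟩
    induction θ using QuotientAddGroup.induction_on with | H l =>
    obtain ⟨l', h1, h2⟩ := key' l
    exact ⟨l', A z, by rw [h1, h2]; exact hN l z⟩
  · obtain ⟨l, z, hp⟩ := hp
    obtain ⟨l', h1, h2⟩ := key l
    obtain ⟨z', rfl⟩ := hA z
    exact ⟨(l', z'), Subtype.ext (by rw [hN, hp, h1, h2])⟩

lemma killingFlow_image_slice (T s t₀ : ℝ) :
    killingFlow s '' slice M Λ K C T r t₀ = slice M Λ K C T r (t₀ + s) := by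
  ext p
  constructor
  · rintro ⟨q, ⟨l, z, hq⟩, rfl⟩
    refine ⟨l, z, ?_⟩
    change ((q.1.1 + (s : AddCircle (2 * T)), q.1.2) : AddCircle (2 * T) × E3) = _
    rw [hq, ← AddCircle.coe_add, add_right_comm]
  · rintro ⟨l, z, hp⟩
    refine ⟨killingFlow (-s) p, ⟨l, z, ?_⟩, Subtype.ext ?_⟩
    · change ((p.1.1 + ((-s : ℝ) : AddCircle (2 * T)), p.1.2) : AddCircle (2 * T) × E3) = _
      rw [hp, ← AddCircle.coe_add, add_right_comm, add_neg_cancel_right]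
    · simp [killingFlow]

/-- The period of `t` is determined by the existence of an embedding. -/
theorem period_eq (h : Profile M Λ K C a b r) {T : ℝ} {n : ℕ} (hn : 1 ≤ n) (hT : 0 < T)
    {φ : DataManifold n (halfPeriod M Λ K C a b) → FC M Λ T}
    (hφ : IsDataEmbedding M Λ K C T n (halfPeriod M Λ K C a b) r φ) :
    T = n * calT M Λ K C a b r := by
  obtain ⟨t₀, σ, A, hσ, -, hN⟩ := h.embedding_normal_form hφ
  have hL := (h.radius.halfPeriod_spec h.well).1
  have hn' : (0 : ℝ) < n := by exact_mod_cast hn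
  have hτ := mul_pos hn' h.calT_pos
  -- One turn around the n-fold circle changes t by ±2n𝒯, which must be 0 modulo 2T.
  obtain ⟨m, hm⟩ : ∃ m : ℤ, m * (2 * T) = 2 * (n * calT M Λ K C a b r) := by
    have h1 := hN 0 default
    have h2 := hN (0 + (1 : ℤ) * (n * (2 * halfPeriod M Λ K C a b))) default
    rw [h.height_add_int_mul_cover, h.radius_add_int_mul_cover, height_zero,
      show ((0 + (1 : ℤ) * (n * (2 * halfPeriod M Λ K C a b)) : ℝ) :
        AddCircle ((n : ℝ) * (2 * halfPeriod M Λ K C a b))) = (0 : ℝ) by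
          rw [Int.cast_one, one_mul, zero_add, AddCircle.coe_period, AddCircle.coe_zero], h1] at h2
    have h3 := sub_eq_zero.2 (Prod.ext_iff.1 h2).1.symm
    rw [← AddCircle.coe_sub, AddCircle.coe_eq_zero_iff] at h3
    obtain ⟨k, hk⟩ := h3
    rw [height_zero] at hk
    rcases hσ with rfl | rfl
    · exact ⟨k, by rw [← zsmul_eq_mul, hk]; push_cast; ring⟩
    · exact ⟨-k, by rw [← zsmul_eq_mul, neg_zsmul, hk]; push_cast; ring⟩
  have hm0 : 0 < m := by
    have : (0 : ℝ) < m := by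
      by_contra hneg
      nlinarith
    exact_mod_cast this
  rcases (show m = 1 ∨ 2 ≤ m by omega) with rfl | hm2
  · push_cast at hm; linarith
  -- If m ≥ 2, then T < n𝒯, so the l of height T satisfies 0 < l < nL. The points l and −l have
  -- equal radii and heights that differ by 2T, hence equal images, but 2l is not a multiple of 2nL.
  exfalso
  obtain ⟨l, hl⟩ := h.surjective_height T
  have hl0 : 0 < l := h.strictMono_height.lt_iff_lt.1 (by rw [hl, height_zero]; exact hT)
  have hl1 : l < n * halfPeriod M Λ K C a b := h.strictMono_height.lt_iff_lt.1 (by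
    have : (2 : ℝ) ≤ m := by exact_mod_cast hm2
    rw [hl, h.height_half_cover]
    nlinarith)
  have heq : φ ((l : AddCircle ((n : ℝ) * (2 * halfPeriod M Λ K C a b))), default)
      = φ (((-l : ℝ) : AddCircle ((n : ℝ) * (2 * halfPeriod M Λ K C a b))), default) := by
    refine Subtype.ext ?_
    rw [hN, hN, h.radius.even h.well, h.height_neg, hl]
    refine Prod.ext ?_ rfl
    rw [← sub_eq_zero, ← AddCircle.coe_sub, AddCircle.coe_eq_zero_iff]
    rcases hσ with rfl | rfl
    · exact ⟨1, by rw [one_zsmul]; ring⟩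
    · exact ⟨-1, by rw [neg_one_zsmul]; ring⟩
  have h1 := (Prod.ext_iff.1 (hφ.isEmbedding.injective heq)).1
  rw [← sub_eq_zero, ← AddCircle.coe_sub, AddCircle.coe_eq_zero_iff] at h1
  obtain ⟨k, hk⟩ := h1
  rw [zsmul_eq_mul] at hk
  have hk0 : 0 < k := by
    have : (0 : ℝ) < k := by
      by_contra hneg
      nlinarith [mul_pos hn' hL]
    exact_mod_cast this
  have hk1 : k < 1 := by
    have : (k : ℝ) < 1 := by
      by_contra hneg
      nlinarith [mul_pos hn' hL]
    exact_mod_cast this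
  omega

/-- The `n`-fold covering of the data embeds for the period `n 𝒯`. -/
theorem exists_embedding (h : Profile M Λ K C a b r) {T : ℝ} {n : ℕ} (hn : 1 ≤ n)
    (hT : T = n * calT M Λ K C a b r) :
    ∃ φ : DataManifold n (halfPeriod M Λ K C a b) → FC M Λ T,
      IsDataEmbedding M Λ K C T n (halfPeriod M Λ K C a b) r φ := by
  have hL := (h.radius.halfPeriod_spec h.well).1
  have hn' : (0 : ℝ) < n := by exact_mod_cast hn
  obtain ⟨P, hP⟩ : ∃ P, P = (n : ℝ) * (2 * halfPeriod M Λ K C a b) := ⟨_, rfl⟩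
  have hfact : Fact (0 < P) := ⟨by rw [hP]; positivity⟩
  have hτ : Function.Periodic (fun l => ((height M Λ K C r l : ℝ) : AddCircle (2 * T))) P :=
    fun l => by
      have h1 := h.height_add_int_mul_cover n 1 l
      rw [← hP, ← hT] at h1
      push_cast at h1
      rw [one_mul, one_mul] at h1
      simp only [h1, AddCircle.coe_add_period]
  have hρ : Function.Periodic r P := fun l => by
    have h1 := h.radius_add_int_mul_cover n 1 l
    rw [← hP] at h1
    push_cast at h1
    rwa [one_mul] at h1
  have hρmem : ∀ (θ : AddCircle P) (z : S2), horizon M Λ < ‖hρ.lift θ • (z : E3)‖ := fun θ z => by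
    induction θ using QuotientAddGroup.induction_on with | H l =>
    exact (h.horizon_lt_r l).trans_eq (h.norm_smul_coe l z).symm
  have hcτ : Continuous hτ.lift :=
    isQuotientMap_quotient_mk'.continuous_iff.2
      ((AddCircle.continuous_mk' _).comp h.contDiff_height.continuous)
  have hcρ : Continuous hρ.lift :=
    isQuotientMap_quotient_mk'.continuous_iff.2 h.radius.continuous
  subst hP
  let φ : DataManifold n (halfPeriod M Λ K C a b) → FC M Λ T :=
    fun p => ⟨(hτ.lift p.1, hρ.lift p.1 • (p.2 : E3)), hρmem p.1 p.2⟩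
  have hcφ : Continuous φ := by
    refine Continuous.subtype_mk ?_ _
    fun_prop
  have hinj : Function.Injective φ := by
    rintro ⟨θ, z⟩ ⟨θ', z'⟩ heq
    induction θ using QuotientAddGroup.induction_on with | H l =>
    induction θ' using QuotientAddGroup.induction_on with | H l' =>
    have h1 := Subtype.ext_iff.1 heq
    have h2 : ((height M Λ K C r l : ℝ) : AddCircle (2 * T)) = (height M Λ K C r l' : ℝ) :=
      (Prod.ext_iff.1 h1).1
    have h3 : r l • (z : E3) = r l' • (z' : E3) := (Prod.ext_iff.1 h1).2
    have h4 : r l = r l' := by rw [← h.norm_smul_coe l z, h3, h.norm_smul_coe]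
    rw [h4] at h3
    have h5 : z = z' := Subtype.ext (smul_right_injective E3 (h.radius.pos l').ne' h3)
    rw [← sub_eq_zero, ← AddCircle.coe_sub, AddCircle.coe_eq_zero_iff] at h2
    obtain ⟨k, hk⟩ := h2
    rw [zsmul_eq_mul] at hk
    have h6 := h.height_add_int_mul_cover n k l'
    rw [← hT, hk] at h6
    have h7 := h.strictMono_height.injective (h6.trans (add_sub_cancel _ _))
    refine Prod.ext ?_ h5
    change (l : AddCircle ((n : ℝ) * (2 * halfPeriod M Λ K C a b))) = l'
    rw [← sub_eq_zero, ← AddCircle.coe_sub, AddCircle.coe_eq_zero_iff]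
    exact ⟨k, by rw [zsmul_eq_mul]; linarith⟩
  refine ⟨φ, (hcφ.isClosedEmbedding hinj).isEmbedding, fun p => refMap M Λ K C r (incl p),
    fun p => rfl, h.contDiff_refMap.contMDiff.comp contMDiff_incl, h.induces_refMap⟩

end Profile

end

section

/-! ## Causal curves and the Cauchy property -/

/-- A function whose derivative is positive at each of its zeros has at most one zero. -/
lemma eq_of_deriv_pos_at_zeros {F F' : ℝ → ℝ} (hF : ∀ s, HasDerivAt F (F' s) s)
    (hpos : ∀ s, F s = 0 → 0 < F' s) {s₁ s₂ : ℝ} (h₁ : F s₁ = 0) (h₂ : F s₂ = 0) : s₁ = s₂ := by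
  have key : ∀ {s₁ s₂ : ℝ}, F s₁ = 0 → F s₂ = 0 → ¬ s₁ < s₂ := fun {s₁ s₂} h₁ h₂ hlt => by
    have h3 : ∀ ⦃x⦄, x ∈ Icc s₁ s₂ → 0 ≤ F x :=
      image_le_of_deriv_right_lt_deriv_boundary (f := fun _ => (0 : ℝ)) (f' := fun _ => 0)
        continuousOn_const (fun x _ => hasDerivWithinAt_const _ _ _) h₁.ge hF
        fun x _ hx => hpos x hx.symm
    have h4 := eventually_nhdsWithin_sign_eq_of_deriv_pos
      (by rw [(hF s₂).deriv]; exact hpos s₂ h₂) h₂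
    obtain ⟨x, hx, hx'⟩ := ((h4.filter_mono nhdsWithin_le_nhds).and (Ioo_mem_nhdsLT hlt)).exists
    rw [sign_neg (sub_neg.2 hx'.2), sign_eq_neg_one_iff] at hx
    exact absurd (h3 ⟨hx'.1.le, hx'.2.le⟩) (not_le.2 hx)
  exact le_antisymm (not_lt.1 (key h₂ h₁)) (not_lt.1 (key h₁ h₂))

/-- A curve whose speed is bounded by the derivative of a convergent function converges. -/
lemma exists_tendsto_of_norm_deriv_le {E : Type*} [NormedAddCommGroup E] [NormedSpace ℝ E]
    [CompleteSpace E] {c c' : ℝ → E} {ρ ρ' : ℝ → ℝ} {k s₀ ℓ : ℝ}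
    (hc : ∀ s, HasDerivAt c (c' s) s) (hρ : ∀ s, HasDerivAt ρ (ρ' s) s)
    (hk : ∀ s, s₀ ≤ s → ‖c' s‖ ≤ k * ρ' s) (hℓ : Tendsto ρ atTop (𝓝 ℓ)) :
    ∃ x, Tendsto c atTop (𝓝 x) := by
  have hb : ∀ s s', s₀ ≤ s → s ≤ s' → ‖c s' - c s‖ ≤ k * ρ s' - k * ρ s := fun s s' hs hss => by
    have h1 : ∀ x, HasDerivAt (fun x => c x - c s) (c' x) x := fun x => (hc x).sub_const _
    have h2 : ∀ x, HasDerivAt (fun x => k * ρ x - k * ρ s) (k * ρ' x) x := fun x =>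
      ((hρ x).const_mul k).sub_const _
    exact image_norm_le_of_norm_deriv_right_le_deriv_boundary (a := s) (b := s')
      (fun x _ => (h1 x).continuousAt.continuousWithinAt)
      (fun x _ => (h1 x).hasDerivWithinAt) (by simp) h2 (fun x hx => hk x (hs.trans hx.1))
      ⟨hss, le_rfl⟩
  have h1 : CauchySeq fun s => k * ρ s := (hℓ.const_mul k).cauchySeq
  have h2 : CauchySeq c := by
    rw [Metric.cauchySeq_iff'] at h1 ⊢
    intro ε hε
    obtain ⟨N, hN⟩ := h1 (ε / 2) (half_pos hε)
    refine ⟨max N s₀, fun s hs => ?_⟩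
    have h3 := hN s ((le_max_left _ _).trans hs)
    have h4 := hN (max N s₀) (le_max_left _ _)
    rw [Real.dist_eq, abs_lt] at h3 h4
    rw [dist_eq_norm]
    have h5 := hb _ _ (le_max_right N s₀) hs
    linarith [h3.2, h4.1]
  exact cauchySeq_tendsto_of_complete h2

lemma norm_sq_eq_angular_add {x : E3} (u : E3) :
    ‖u‖ ^ 2 = angular x u u + radial x u ^ 2 := by
  rw [angular, real_inner_self_eq_norm_sq]; ring

/-- The speed of a causal vector is controlled by its radial part. -/
lemma norm_le_of_causal {M Λ w : ℝ} {p u : ℝ × E3} (hp : p.2 ≠ 0) (hw : 0 < w)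
    (hV : w ≤ -V M Λ ‖p.2‖) (hc : metric M Λ p u u ≤ 0) (hf : 0 < radial p.2 u.2) :
    |u.1| ≤ radial p.2 u.2 / -V M Λ ‖p.2‖ ∧ ‖u‖ ≤ (w⁻¹ + 1) * radial p.2 u.2 := by
  obtain ⟨W, hW⟩ : ∃ W, W = -V M Λ ‖p.2‖ := ⟨_, rfl⟩
  have hang := angular_nonneg hp u.2
  have hn := norm_sq_eq_angular_add (x := p.2) u.2
  rw [metric_eq, ← neg_neg (V M Λ ‖p.2‖), ← hW] at hc
  rw [← hW] at hV ⊢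
  have hW0 : 0 < W := hw.trans_le hV
  obtain ⟨ρ, hρ⟩ : ∃ ρ, ρ = radial p.2 u.2 := ⟨_, rfl⟩
  rw [← hρ] at hc hf hn ⊢
  have h1 : W * u.1 ^ 2 + angular p.2 u.2 u.2 ≤ W⁻¹ * ρ ^ 2 := by
    rw [neg_neg, inv_neg] at hc
    linarith
  have h2 : |u.1| ≤ ρ / W := by
    refine abs_le_of_sq_le_sq ?_ (by positivity)
    rw [div_pow, le_div_iff₀ (by positivity)]
    have h3 : W * (W * u.1 ^ 2) ≤ W * (W⁻¹ * ρ ^ 2) :=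
      mul_le_mul_of_nonneg_left (by linarith) hW0.le
    rw [mul_inv_cancel_left₀ hW0.ne'] at h3
    linarith
  have h3 : W⁻¹ ≤ w⁻¹ := inv_anti₀ hw hV
  have hw' : 0 < w⁻¹ := inv_pos.2 hw
  refine ⟨h2, ?_⟩
  rw [Prod.norm_def]
  refine max_le ?_ ?_
  · rw [Real.norm_eq_abs]
    refine h2.trans ?_
    rw [div_eq_inv_mul]
    exact mul_le_mul_of_nonneg_right (by linarith) hf.le
  · refine le_of_sq_le_sq ?_ (by positivity)
    rw [hn]
    have h4 : W⁻¹ * ρ ^ 2 ≤ w⁻¹ * ρ ^ 2 := mul_le_mul_of_nonneg_right h3 (sq_nonneg _)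
    have h5 : 0 ≤ W * u.1 ^ 2 := by positivity
    nlinarith [mul_pos hw' (pow_pos hf 2), mul_pos (mul_pos hw' hw') (pow_pos hf 2)]

namespace Profile

variable {M Λ K C a b : ℝ} {r : ℝ → ℝ}

/-- The radius of the spherically symmetric hypersurface as a function of `t`. -/
lemma exists_radius_of_time (h : Profile M Λ K C a b r) (t₀ : ℝ) : ∃ R R' : ℝ → ℝ,
    (∀ l, R (t₀ + height M Λ K C r l) = r l) ∧ (∀ t, ∃ l, t = t₀ + height M Λ K C r l) ∧
    (∀ t, HasDerivAt R (R' t) t) ∧ ∀ t, |R' t| < -V M Λ (R t) := by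
  let e := h.strictMono_height.orderIsoOfSurjective _ h.surjective_height
  have he : ∀ l, e.symm (height M Λ K C r l) = l := fun l => e.symm_apply_apply l
  have he' : ∀ t, height M Λ K C r (e.symm t) = t := fun t => e.apply_symm_apply t
  have hd : ∀ t, HasDerivAt e.symm (slope M Λ K C r (e.symm t))⁻¹ t := fun t =>
    HasDerivAt.of_local_left_inverse e.symm.continuous.continuousAt
      (h.hasDerivAt_height _) (h.slope_pos _).ne' (Eventually.of_forall he')
  refine ⟨fun t => r (e.symm (t - t₀)),
    fun t => deriv r (e.symm (t - t₀)) * (slope M Λ K C r (e.symm (t - t₀)))⁻¹,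
    fun l => ?_, fun t => ⟨e.symm (t - t₀), ?_⟩, fun t => ?_, fun t => ?_⟩
  · simp only [add_sub_cancel_left, he]
  · rw [he']; ring
  · exact (h.radius.hasDerivAt _).comp t ((hd (t - t₀)).comp_sub_const t t₀)
  · have hs := h.slope_pos (e.symm (t - t₀))
    have hV := h.V_neg (e.symm (t - t₀))
    have hχ := h.drift_pos (e.symm (t - t₀))
    have hode : deriv r (e.symm (t - t₀)) ^ 2 = V M Λ (r (e.symm (t - t₀)))
      + drift K C (r (e.symm (t - t₀))) ^ 2 := h.radius.ode _
    rw [abs_mul, abs_inv, abs_of_pos hs, ← div_eq_mul_inv, div_lt_iff₀ hs, slope,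
      mul_div_cancel₀ _ (neg_pos.2 hV).ne']
    exact abs_lt_of_sq_lt_sq (by linarith) hχ.le

/-- Since T = n𝒯, the preimage of the slice in the cover is a single graph r = R(t). As |R'| < −V,
the function r − R(t) increases through each of its zeros along a causal curve, so there is at most
one. There is one because r passes both below r_min and above r_max: otherwise r would converge in
one direction, and since the coordinate speed is at most a constant times r' there, so would the
curve. -/
theorem isCauchy_slice (h : Profile M Λ K C a b r) {T : ℝ} {n : ℕ}
    (hT : T = n * calT M Λ K C a b r) (t₀ : ℝ) : IsCauchy (slice M Λ K C T r t₀) := by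
  obtain ⟨R, R', hR, hRs, hRd, hRV⟩ := h.exists_radius_of_time t₀
  rintro γ ⟨c, hc, hlift, hcausal⟩ ⟨htop, hbot⟩
  have hext : ∀ s, c s ∈ exterior M Λ := fun s => by
    have := (γ s).2
    rw [hlift s] at this
    exact this
  have hne : ∀ s, (c s).2 ≠ 0 := fun s =>
    FlatProfile.ne_zero_of_mem_exterior h.Λ_pos h.subextremal (hext s)
  have hcd : ∀ s, HasDerivAt c (deriv c s) s := fun s =>
    (hc.differentiable (by norm_num) s).hasDerivAt
  have hρd : ∀ s, HasDerivAt (fun s => ‖(c s).2‖) (radial (c s).2 (deriv c s).2) s := fun s =>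
    hasDerivAt_norm (hcd s).snd (hne s)
  have hρpos : ∀ s, 0 < radial (c s).2 (deriv c s).2 := fun s =>
    div_pos (hcausal s).2 (norm_pos_iff.2 (hne s))
  have hmono : StrictMono fun s => ‖(c s).2‖ :=
    strictMono_of_deriv_pos fun s => by rw [(hρd s).deriv]; exact hρpos s
  have hanti := strictAntiOn_V h.Λ_pos h.subextremal
  have hVneg : ∀ {x}, horizon M Λ < x → 0 < -V M Λ x := fun hx =>
    neg_pos.2 (KottlerCMC.V_neg h.Λ_pos h.subextremal hx)
  have hRmem : ∀ t, R t ∈ Icc a b := fun t => by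
    obtain ⟨l, rfl⟩ := hRs t
    rw [hR]
    exact h.radius.mem_Icc h.well l
  -- convergence of `c` gives an end point of `γ`
  have hend : ∀ (f : Filter ℝ) (p : ℝ × E3), Tendsto c f (𝓝 p) → horizon M Λ < ‖p.2‖ →
      ∃ q, Tendsto γ f (𝓝 q) := fun f p hp hlt => by
    refine ⟨⟨((p.1 : AddCircle (2 * T)), p.2), hlt⟩, tendsto_subtype_rng.2 ?_⟩
    have h1 : Continuous fun p : ℝ × E3 => ((p.1 : AddCircle (2 * T)), p.2) :=
      ((AddCircle.continuous_mk' _).comp continuous_fst).prodMk continuous_snd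
    exact ((h1.tendsto p).comp hp).congr fun s => (hlift s).symm
  have hbound : ∀ s x, horizon M Λ < x → x ≤ ‖(c s).2‖ →
      ‖deriv c s‖ ≤ ((-V M Λ x)⁻¹ + 1) * radial (c s).2 (deriv c s).2 := fun s x hx hxs =>
    (norm_le_of_causal (hne s) (hVneg hx)
      (neg_le_neg (hanti.antitoneOn hx (hext s) hxs)) (hcausal s).1 (hρpos s)).2
  have hlarge : ∃ s, b < ‖(c s).2‖ := by
    by_contra! hle
    have hbdd : BddAbove (range fun s => ‖(c s).2‖) := ⟨b, by rintro _ ⟨s, rfl⟩; exact hle s⟩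
    obtain ⟨p, hp⟩ := exists_tendsto_of_norm_deriv_le (s₀ := 0) hcd hρd
      (fun s hs => hbound s _ (hext 0) (hmono.monotone hs))
      (tendsto_atTop_ciSup hmono.monotone hbdd)
    refine htop (hend _ p hp ((hext 0).trans_le ?_))
    have h1 : Tendsto (fun s => ‖(c s).2‖) atTop (𝓝 ‖p.2‖) :=
      ((continuous_norm.comp continuous_snd).tendsto p).comp hp
    exact hmono.monotone.ge_of_tendsto h1 0
  have hsmall : ∃ s, ‖(c s).2‖ < a := by
    by_contra! hle
    have hbdd : BddBelow (range fun s => ‖(c s).2‖) := ⟨a, by rintro _ ⟨s, rfl⟩; exact hle s⟩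
    -- The past is treated as the future of s ↦ c(−s), with −r as the increasing function; the
    -- assumption r ≥ a > r_c keeps −V bounded below.
    have h1 := ((tendsto_atBot_ciInf hmono.monotone hbdd).comp tendsto_neg_atTop_atBot).neg
    obtain ⟨p, hp⟩ := exists_tendsto_of_norm_deriv_le (s₀ := 0)
      (c := fun s => c (-s)) (c' := fun s => -deriv c (-s))
      (ρ' := fun s => radial (c (-s)).2 (deriv c (-s)).2)
      (fun s => ((hcd (-s)).scomp s (hasDerivAt_neg s)).congr_deriv (by simp))
      (fun s => ((hρd (-s)).comp s (hasDerivAt_neg s)).neg.congr_deriv (by ring))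
      (fun s _ => by rw [norm_neg]; exact hbound (-s) a h.horizon_lt (hle _)) h1
    have hp' : Tendsto c atBot (𝓝 p) := by
      have := hp.comp tendsto_neg_atBot_atTop
      simpa [Function.comp_def] using this
    refine hbot (hend _ p hp' (h.horizon_lt.trans_le ?_))
    have h2 : Tendsto (fun s => ‖(c s).2‖) atBot (𝓝 ‖p.2‖) :=
      ((continuous_norm.comp continuous_snd).tendsto p).comp hp'
    exact ge_of_tendsto' h2 hle
  have hmem : ∀ s, γ s ∈ slice M Λ K C T r t₀ ↔ ‖(c s).2‖ - R (c s).1 = 0 := fun s => by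
    rw [sub_eq_zero]
    constructor
    · rintro ⟨l, z, hl⟩
      rw [hlift s, Prod.ext_iff] at hl
      obtain ⟨h1, h2⟩ := hl
      rw [show (c s).2 = r l • (z : E3) from h2, h.norm_smul_coe]
      have h3 := sub_eq_zero.2 h1
      rw [← AddCircle.coe_sub, AddCircle.coe_eq_zero_iff] at h3
      obtain ⟨m, hm⟩ := h3
      rw [zsmul_eq_mul] at hm
      have h4 := h.height_add_int_mul_cover n m l
      rw [← hT] at h4
      -- The ambiguity 2mT of t is absorbed by moving l through m periods of the covering, which
      -- leaves r unchanged.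
      rw [show (c s).1 = t₀ + height M Λ K C r (l + m * (n * (2 * halfPeriod M Λ K C a b))) by
        rw [h4]; linarith, hR, h.radius_add_int_mul_cover]
    · intro h1
      obtain ⟨l, hl⟩ := hRs (c s).1
      rw [hl, hR] at h1
      refine ⟨l, proj (c s).2, ?_⟩
      rw [hlift s, hl, coe_proj (hne s), ← h1, smul_smul,
        mul_inv_cancel₀ (norm_ne_zero_iff.2 (hne s)), one_smul]
  have hFd : ∀ s, HasDerivAt (fun s => ‖(c s).2‖ - R (c s).1)
      (radial (c s).2 (deriv c s).2 - R' (c s).1 * (deriv c s).1) s := fun s =>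
    (hρd s).sub ((hRd _).comp s (hcd s).fst)
  have hzero : ∀ s, ‖(c s).2‖ - R (c s).1 = 0 →
      0 < radial (c s).2 (deriv c s).2 - R' (c s).1 * (deriv c s).1 := fun s hs => by
    have h1 := (norm_le_of_causal (hne s) (hVneg (hext s)) le_rfl (hcausal s).1 (hρpos s)).1
    have h2 := hRV (c s).1
    rw [← sub_eq_zero.1 hs] at h2
    have hW : 0 < -V M Λ ‖(c s).2‖ := hVneg (hext s)
    have h3 : |R' (c s).1 * (deriv c s).1| < radial (c s).2 (deriv c s).2 := by
      rw [abs_mul]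
      calc |R' (c s).1| * |(deriv c s).1|
          ≤ |R' (c s).1| * (radial (c s).2 (deriv c s).2 / -V M Λ ‖(c s).2‖) :=
            mul_le_mul_of_nonneg_left h1 (abs_nonneg _)
        _ < -V M Λ ‖(c s).2‖ * (radial (c s).2 (deriv c s).2 / -V M Λ ‖(c s).2‖) :=
            mul_lt_mul_of_pos_right h2 (div_pos (hρpos s) hW)
        _ = radial (c s).2 (deriv c s).2 := mul_div_cancel₀ _ hW.ne'
    linarith [le_abs_self (R' (c s).1 * (deriv c s).1)]
  obtain ⟨s₁, hs₁⟩ := hsmall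
  obtain ⟨s₂, hs₂⟩ := hlarge
  have hcont : Continuous fun s => ‖(c s).2‖ - R (c s).1 :=
    continuous_iff_continuousAt.2 fun s => (hFd s).continuousAt
  obtain ⟨s, hs⟩ := mem_range_of_exists_le_of_exists_ge hcont (c := 0)
    ⟨s₁, by linarith [(hRmem (c s₁).1).1]⟩ ⟨s₂, by linarith [(hRmem (c s₂).1).2]⟩
  refine ⟨s, (hmem s).2 hs, fun s' hs' => ?_⟩
  exact eq_of_deriv_pos_at_zeros hFd hzero ((hmem s').1 hs') hs

end Profile

end

end KottlerCMC

end

/-! ### Embedding, Cauchy property and uniqueness combined -/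

theorem proposition1 (Λ M K C rmin rmax : ℝ) (r : ℝ → ℝ) (hΛ : 0 < Λ)
    (hM : M < 0 ∨ (0 < M ∧ 9 * M ^ 2 * Λ < 1))
    (hKC : (K, C) ∈ KottlerCMC.KC1 M Λ)
    (hwell : KottlerCMC.IsWell M Λ K C rmin rmax)
    (hr : KottlerCMC.IsRadius M Λ K C rmin r)
    (L : ℝ) (hL : L = KottlerCMC.halfPeriod M Λ K C rmin rmax) :
    -- the data embed in `FC[T]` iff `T = 𝒯`
    (∀ T : ℝ, 0 < T →
      ((∃ φ : KottlerCMC.DataManifold 1 L → KottlerCMC.FC M Λ T,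
          KottlerCMC.IsDataEmbedding M Λ K C T 1 L r φ) ↔ T = KottlerCMC.calT M Λ K C rmin rmax r)) ∧
    -- their `n`-fold covering embeds in `FC[T]` iff `T = n 𝒯`
    (∀ n : ℕ, 1 ≤ n → ∀ T : ℝ, 0 < T →
      ((∃ φ : KottlerCMC.DataManifold n L → KottlerCMC.FC M Λ T,
          KottlerCMC.IsDataEmbedding M Λ K C T n L r φ) ↔
        T = n * KottlerCMC.calT M Λ K C rmin rmax r)) ∧
    -- the embedded hypersurfaces are Cauchy hypersurfaces
    (∀ n : ℕ, 1 ≤ n → ∀ T : ℝ, 0 < T →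
      ∀ φ : KottlerCMC.DataManifold n L → KottlerCMC.FC M Λ T,
        KottlerCMC.IsDataEmbedding M Λ K C T n L r φ →
        KottlerCMC.IsCauchy (Set.range φ)) ∧
    -- the embedded hypersurface is unique modulo the Killing flow
    (∀ n : ℕ, 1 ≤ n → ∀ T : ℝ, 0 < T →
      ∀ φ ψ : KottlerCMC.DataManifold n L → KottlerCMC.FC M Λ T,
        KottlerCMC.IsDataEmbedding M Λ K C T n L r φ →
        KottlerCMC.IsDataEmbedding M Λ K C T n L r ψ →
        ∃ s : ℝ, Set.range ψ = KottlerCMC.killingFlow s '' Set.range φ) := by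
  have h : KottlerCMC.Profile M Λ K C rmin rmax r :=
    ⟨hΛ, hM, hKC.1, hwell, hKC.2.2 rmin rmax hwell, hr⟩
  subst hL
  have hmain : ∀ n : ℕ, 1 ≤ n → ∀ T : ℝ, 0 < T →
      ((∃ φ : KottlerCMC.DataManifold n (KottlerCMC.halfPeriod M Λ K C rmin rmax) →
            KottlerCMC.FC M Λ T,
          KottlerCMC.IsDataEmbedding M Λ K C T n (KottlerCMC.halfPeriod M Λ K C rmin rmax) r φ) ↔
        T = n * KottlerCMC.calT M Λ K C rmin rmax r) := fun n hn T hT =>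
    ⟨fun ⟨_, hφ⟩ => h.period_eq hn hT hφ, fun hT' => h.exists_embedding hn hT'⟩
  refine ⟨fun T hT => ?_, hmain, fun n hn T hT φ hφ => ?_, fun n hn T hT φ ψ hφ hψ => ?_⟩
  · simpa using hmain 1 le_rfl T hT
  · obtain ⟨t₀, ht₀⟩ := h.exists_range_eq_slice hφ
    rw [ht₀]
    exact h.isCauchy_slice (h.period_eq hn hT hφ) t₀
  · obtain ⟨t₀, ht₀⟩ := h.exists_range_eq_slice hφ
    obtain ⟨t₁, ht₁⟩ := h.exists_range_eq_slice hψ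
    refine ⟨t₁ - t₀, ?_⟩
    rw [ht₀, ht₁, KottlerCMC.Profile.killingFlow_image_slice, add_sub_cancel]
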